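/- Let $X$ be a proper geodesic $\mathrm{CAT}(-1)$ metric space whose boundary at infinity $\partial_\infty X$ (asymptotic classes of geodesic rays, with the cone topology) is infinite. A geodesic ray is an isometric map $[a,+\infty[\,\to X$ with $a\in\mathbb{R}$ and starts from its origin in $X$; a geodesic line is an isometric map $\mathbb{R}\to X$ and starts from its endpoint at $-\infty$ in $\partial_\infty X$. A horoball centered at $\eta\in\partial_\infty X$ is a set $H=\{y\in X:\beta_\eta(x,y)\ge s\}$ with $x\in X$, $s\in\mathbb{R}$, where $\beta_\eta(x,y)=\lim_{t\to+\infty}\bigl(d(x,\rho(t))-d(y,\rho(t))\bigr)$ for any geodesic ray $\rho$ ending at $\eta$; put $H[\infty]=\eta$. The penetration height of a geodesic ray or line $\gamma$ in $H$ is $$\mathrm{ph}_H(\gamma)=2\sup_t\max\{\beta_\eta(x,\gamma(t))-s,\,0\}\in[0,+\infty].$$ We say that $\gamma$ enters $H$ at time $t$ if $\gamma(t)\in H$, $t$ is not the initial time of $\gamma$, and $\gamma(s)\notin H$ for all $s<t$ in the domain of $\gamma$. Let $c_1'(\infty)=2\log(1+\sqrt2)$. Let $(H_\alpha)_{\alpha\in\mathcal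 A}$ be a family of horoballs in $X$ with pairwise disjoint interiors. If $0$ lies in the domain of $\gamma$, the penetration sequence $(a_i(\gamma))_i$ of $\gamma$ is the (finite or infinite) sequence of the values $\mathrm{ph}_{H_\alpha}(\gamma)$, listed in increasing order of the entrance times $t$, over all $t\ge 0$ and $\alpha\in\mathcal A$ such that $\gamma$ enters $H_\alpha$ at time $t$ and $\mathrm{ph}_{H_\alpha}(\gamma)>c_1'(\infty)$. Assume that there are $K\in[0,+\infty[$ and a dense subset $Y$ of $\partial_\infty X$ such that $\liminf_{t\to+\infty}d\bigl(\gamma(t),\bigcup_{\alpha\in\mathcal A}H_\alpha\bigr)\le K$ for every geodesic ray $\gamma$ in $X$ ending at a point of $Y$ (the distance to the empty set being $+\infty$). Let $\xi\in X\cup\partial_\infty X$ and $c,c'\ge 0$. Assume that for every real $h\ge c$ and every $\alpha\in\mathcal A$ with $\xi\notin H_\alpha\cup\{H_\alpha[\infty]\}$, there is a geodesic ray or line $\gamma$ starting from $\xi$ and entering $H_\alpha$ at time $0$, with $\mathrm{ph}_{H_\alpha}(\gamma)=h$, and with $\mathrm{ph}_{H_\beta}(\gamma)\le c'$ for every $\beta\in\mathcal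 A\setminus\{\alpha\}$ such that $\gamma(]0,+\infty[)$ meets $H_\beta$. Then for every real $h\ge\max\{c,\;c'+3c_1'(\infty)+10^{-5}\}$ there is a geodesic ray or line $\gamma$ starting from $\xi$ whose penetration sequence is infinite and satisfies $$\limsup_{i\to+\infty}a_i(\gamma)=h.$$ -/

import Mathlib

open Filter Set
open scoped NNReal ENNReal

noncomputable section

namespace NegCurv

/-- A metric space is geodesic if any two points are joined by an isometrically embedded segment. -/
def IsGeodesicSpace (X : Type*) [MetricSpace X] : Prop :=
  ∀ x y : X, ∃ γ : ℝ → X, γ 0 = x ∧ γ (dist x y) = y ∧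
    ∀ s ∈ Icc 0 (dist x y), ∀ t ∈ Icc 0 (dist x y), dist (γ s) (γ t) = |s - t|

/-- `p` lies on a geodesic segment between `x` and `y`
(in a geodesic space this is the equality case of the triangle inequality). -/
def OnSegment {X : Type*} [MetricSpace X] (x y p : X) : Prop :=
  dist x p + dist p y = dist x y

/-- Geodesic `CAT(-1)` spaces: for every geodesic triangle with vertices `x, y, z`, every
comparison triangle `x', y', z'` in the real hyperbolic plane (of curvature `-1`), and all points
`p` on a side `[x, y]` and `q` on a side `[x, z]` with comparison points `p'` and `q'`, one has
`d(p, q) ≤ d(p', q')`. -/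
structure IsGeodesicCATNegOne (X : Type*) [MetricSpace X] : Prop where
  geodesic : IsGeodesicSpace X
  comparison : ∀ (x y z p q : X) (x' y' z' p' q' : UpperHalfPlane),
    dist x' y' = dist x y → dist x' z' = dist x z → dist y' z' = dist y z →
    OnSegment x y p → OnSegment x z q →
    dist x' p' = dist x p → dist p' y' = dist p y →
    dist x' q' = dist x q → dist q' z' = dist q z →
    dist p q ≤ dist p' q'

/-- Geodesic rays parametrized by `[0, +∞[`. -/
structure Ray (X : Type*) [MetricSpace X] where
  toFun : ℝ≥0 → X
  isometry : Isometry toFun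

instance (X : Type*) [MetricSpace X] : CoeFun (Ray X) (fun _ => ℝ≥0 → X) := ⟨Ray.toFun⟩

/-- Two rays are asymptotic if they stay at bounded distance from each other. -/
instance asymptoticSetoid (X : Type*) [MetricSpace X] : Setoid (Ray X) where
  r ρ σ := ∃ C : ℝ, ∀ t, dist (ρ t) (σ t) ≤ C
  iseqv :=
    { refl := fun ρ => ⟨0, fun t => by simp⟩
      symm := fun ⟨C, h⟩ => ⟨C, fun t => by rw [dist_comm]; exact h t⟩
      trans := fun ⟨C, h⟩ ⟨D, k⟩ =>
        ⟨C + D, fun t => (dist_triangle _ _ _).trans (add_le_add (h t) (k t))⟩ }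

/-- The boundary at infinity: asymptotic classes of geodesic rays. -/
def Boundary (X : Type*) [MetricSpace X] : Type _ := Quotient (asymptoticSetoid X)

/-- The endpoint `ρ(+∞)` of a geodesic ray. -/
def Ray.endpoint {X : Type*} [MetricSpace X] (ρ : Ray X) : Boundary X :=
  Quotient.mk (asymptoticSetoid X) ρ

/-- The cone topology on the boundary at infinity: a set `U` is open if, for every ray `ρ` ending
in `U`, every ray with the same origin that is uniformly close enough to `ρ` on a large enough
compact interval also ends in `U`. -/
instance (X : Type*) [MetricSpace X] : TopologicalSpace (Boundary X) where
  IsOpen U := ∀ ρ : Ray X, ρ.endpoint ∈ U → ∃ R : ℝ≥0, ∃ ε : ℝ, 0 < ε ∧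
    ∀ σ : Ray X, σ 0 = ρ 0 → (∀ t ≤ R, dist (ρ t) (σ t) < ε) → σ.endpoint ∈ U
  isOpen_univ := fun _ _ => ⟨0, 1, one_pos, fun _ _ _ => mem_univ _⟩
  isOpen_inter := fun U V hU hV ρ hρ => by
    obtain ⟨R, ε, hε, h⟩ := hU ρ hρ.1
    obtain ⟨S, δ, hδ, k⟩ := hV ρ hρ.2
    refine ⟨max R S, min ε δ, lt_min hε hδ, fun σ h0 hσ => ⟨h σ h0 fun t ht => ?_,
      k σ h0 fun t ht => ?_⟩⟩
    · exact (hσ t (ht.trans (le_max_left _ _))).trans_le (min_le_left _ _)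
    · exact (hσ t (ht.trans (le_max_right _ _))).trans_le (min_le_right _ _)
  isOpen_sUnion := fun 𝒰 h ρ ⟨U, hU, hρ⟩ => by
    obtain ⟨R, ε, hε, k⟩ := h U hU ρ hρ
    exact ⟨R, ε, hε, fun σ h0 hσ => ⟨U, hU, k σ h0 hσ⟩⟩

/-- The Busemann function `β_η(x, y) = lim (d(x, ρ(t)) - d(y, ρ(t)))`, where `ρ` is a geodesic ray
ending at `η`. The limit exists for every ray, and in a `CAT(-1)` space it does not depend on the
choice of the ray ending at `η`. -/
def busemann {X : Type*} [MetricSpace X] (η : Boundary X) (x y : X) : ℝ :=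
  let ρ : Ray X := Quotient.out η
  lim (map (fun t : ℝ≥0 => dist x (ρ t) - dist y (ρ t)) atTop)

/-- A horoball `{y | β_η(x, y) ≥ s}`, given by its point at infinity `η`, a point `x` of the space
and a real number `s`. -/
structure Horoball (X : Type*) [MetricSpace X] where
  center : Boundary X
  base : X
  level : ℝ

/-- The horoball as a subset of the space. -/
def Horoball.carrier {X : Type*} [MetricSpace X] (H : Horoball X) : Set X :=
  {y | H.level ≤ busemann H.center H.base y}

/-- The subset `H ∪ {H[∞]}` of `X ∪ ∂_∞ X`. -/
def Horoball.withCenter {X : Type*} [MetricSpace X] (H : Horoball X) : Set (X ⊕ Boundary X) :=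
  Sum.inl '' H.carrier ∪ {Sum.inr H.center}

/-- The height map `y ↦ max {β_η(x₀, y), 0}`, where `x₀` is any point of the boundary horosphere
`{β_η(x, ·) = s}`, so that `β_η(x₀, y) = β_η(x, y) - s`. -/
def Horoball.height {X : Type*} [MetricSpace X] (H : Horoball X) (y : X) : ℝ :=
  max (busemann H.center H.base y - H.level) 0

/-- A geodesic ray `[a, +∞[ → X` or a geodesic line `ℝ → X`. Only the values of the map on its
domain `dom` are meaningful. -/
structure RayOrLine (X : Type*) [MetricSpace X] where
  dom : Set ℝ
  toFun : ℝ → X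
  dom_eq : dom = univ ∨ ∃ a : ℝ, dom = Ici a
  isometric : ∀ s ∈ dom, ∀ t ∈ dom, dist (toFun s) (toFun t) = |s - t|

instance (X : Type*) [MetricSpace X] : CoeFun (RayOrLine X) (fun _ => ℝ → X) := ⟨RayOrLine.toFun⟩

/-- A geodesic ray starts from its origin; a geodesic line starts from its endpoint at `-∞`. -/
def RayOrLine.StartsFrom {X : Type*} [MetricSpace X] (γ : RayOrLine X) : X ⊕ Boundary X → Prop
  | Sum.inl x => ∃ a : ℝ, γ.dom = Ici a ∧ γ a = x
  | Sum.inr η => γ.dom = univ ∧ ∃ ρ : Ray X, (∀ t : ℝ≥0, ρ t = γ (-(t : ℝ))) ∧ ρ.endpoint = η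

/-- `γ`, which is outside `C` at first, enters `C` at time `t`. -/
def RayOrLine.EntersAt {X : Type*} [MetricSpace X] (γ : RayOrLine X) (C : Set X) (t : ℝ) : Prop :=
  t ∈ γ.dom ∧ γ t ∈ C ∧ (∃ s ∈ γ.dom, s < t) ∧ ∀ s ∈ γ.dom, s < t → γ s ∉ C

/-- The penetration height of `γ` inside the horoball `H`: twice the supremum of the height. -/
def penetrationHeight {X : Type*} [MetricSpace X] (H : Horoball X) (γ : RayOrLine X) : ℝ≥0∞ :=
  2 * ⨆ t ∈ γ.dom, ENNReal.ofReal (H.height (γ t))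

/-- The constant `c₁'(∞) = 2 log (1 + √2)`, the bound for the difference between the
penetration height in a horoball and the length of the intersection with it. -/
def c₁Inf : ℝ := 2 * Real.log (1 + Real.sqrt 2)

/-- `γ` enters `H α` at time `t ≥ 0`, and its penetration height there exceeds `c₁'(∞)`. -/
def IsDeepEntry {X A : Type*} [MetricSpace X] (H : A → Horoball X) (γ : RayOrLine X)
    (t : ℝ) (α : A) : Prop :=
  0 ≤ t ∧ γ.EntersAt (H α).carrier t ∧ ENNReal.ofReal c₁Inf < penetrationHeight (H α) γ

/-- `(a i)`, for `i` in the initial segment `N` of `ℕ`, is the penetration sequence of `γ`: the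
deep entries at times `≥ 0` are enumerated as `(t i, α i)` in increasing order of time, and `a i`
is the penetration height of `γ` in `H (α i)`. -/
def IsPenetrationSequence {X A : Type*} [MetricSpace X] (H : A → Horoball X) (γ : RayOrLine X)
    (N : Set ℕ) (a : N → ℝ≥0∞) : Prop :=
  (0 : ℝ) ∈ γ.dom ∧ IsLowerSet N ∧
    ∃ (t : N → ℝ) (α : N → A), StrictMono t ∧
      (∀ i, IsDeepEntry H γ (t i) (α i) ∧ a i = penetrationHeight (H (α i)) γ) ∧
      ∀ s β, IsDeepEntry H γ s β → ∃ i, t i = s ∧ α i = β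

end NegCurv

end

open NegCurv

/-! Through comparison triangles, curvature `-1` becomes the hyperbolic Stewart inequality. In the
limit it gives the convexity of heights of horoballs (`IsHeight`) and the exponential contraction of
geodesics towards a common origin (`Pencil.sinh_half_le`). The structure `Pencil` treats origins in
`X` and at infinity alike. Two geodesics from `ξ` entering the same horoball do so at nearly the
same time and place, and are exponentially close before that (`Pencil.entry_close`,
`Pencil.dist_le_of_entry`).

Call a geodesic from `ξ` prescribed if its penetration height is `h` in one horoball and at most
`c'` in those met afterwards. It drifts away from every horoball, so a ray shadowing it and ending
in `Y` comes, much later, near a new horoball, whose prescribed geodesic follows the old one for a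
long time (`exists_isCandidate`). On the way the new geodesic might penetrate some other horoball
`β` by more than `h`. To prevent this, `exists_next` takes a candidate whose entrance time is within
`1` of the infimum. If `β` is met early, the old geodesic, being close, also penetrates `β` by more
than `c'`; this is what the gap between `h` and `c'` excludes. If `β` is met late, the prescribed
geodesic of `β` is itself a candidate, with an entrance time smaller by more than `1`.

Iteration, with closeness over longer and longer times, converges to a geodesic from `ξ` whose
penetration heights in the chosen horoballs tend to `h` and whose other late ones are at most `h +
o(1)` (`IsApproximation.isLimit`). Deep entrances then occur at arbitrarily large times and are
locally finite in time, so they can be enumerated. -/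

namespace NegCurv
open Real Topology

/-! ### Comparison triangles in the hyperbolic plane. -/

section HyperbolicPlane

/-- The point `e^τ i` of the upper half-plane. -/
noncomputable def axisPoint (τ : ℝ) : UpperHalfPlane := ⟨⟨0, exp τ⟩, exp_pos τ⟩

/-- Along the axis, the hyperbolic cosine of the distance to `z` is a combination of `exp τ` and
`exp (-τ)`. This reduces Stewart's relation in the plane to an identity between exponentials. -/
theorem cosh_dist_axisPoint (z : UpperHalfPlane) (τ : ℝ) :
    cosh (dist z (axisPoint τ)) =
      ((z.re ^ 2 + z.im ^ 2) / z.im * exp (-τ) + exp τ / z.im) / 2 := by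
  have h1 : (axisPoint τ).im = exp τ := rfl
  have h2 : (axisPoint τ).re = 0 := rfl
  have hz := z.im_pos
  rw [UpperHalfPlane.cosh_dist', h1, h2, exp_neg]
  have := exp_pos τ
  field_simp
  ring

theorem dist_axisPoint (σ τ : ℝ) (h : σ ≤ τ) : dist (axisPoint σ) (axisPoint τ) = τ - σ := by
  have h1 : (axisPoint σ).im = exp σ := rfl
  have h2 : (axisPoint σ).re = 0 := rfl
  have key : cosh (dist (axisPoint σ) (axisPoint τ)) = cosh (τ - σ) := by
    rw [cosh_dist_axisPoint, h1, h2, cosh_eq, show -(τ - σ) = σ + -τ by ring, exp_add,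
      sub_eq_add_neg, exp_add, exp_neg, exp_neg]
    have := exp_pos σ
    have := exp_pos τ
    field_simp
    ring
  have h3 := (Real.cosh_le_cosh (x := dist (axisPoint σ) (axisPoint τ)) (y := τ - σ)).1 key.le
  have h4 := (Real.cosh_le_cosh (x := τ - σ) (y := dist (axisPoint σ) (axisPoint τ))).1 key.ge
  rw [abs_of_nonneg dist_nonneg, abs_of_nonneg (sub_nonneg.2 h)] at h3 h4
  exact le_antisymm h3 h4

/-- A triangle of the hyperbolic plane with prescribed side lengths, one side being on the
imaginary axis. -/
theorem exists_comparison_vertex {l r s : ℝ} (hl : 0 < l) (hr : 0 ≤ r) (hs : 0 ≤ s)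
    (h1 : l ≤ r + s) (h2 : r ≤ l + s) (h3 : s ≤ l + r) :
    ∃ z : UpperHalfPlane, dist z (axisPoint 0) = r ∧ dist z (axisPoint l) = s := by
  have hsl : 0 < sinh l := sinh_pos_iff.2 hl
  -- `A` and `B` solve `2 cosh d = A exp (-τ) + B exp τ` with `d = r` at `τ = 0` and `d = s` at `τ =
  -- l`. The vertex is recovered from `|z|² / im z = A` and `1 / im z = B`.
  set B := (cosh s - cosh r * exp (-l)) / sinh l with hB
  set A := (cosh r * exp l - cosh s) / sinh l with hA
  have hel : exp l * exp (-l) = 1 := by rw [← exp_add]; simp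
  have e1 : exp l = cosh l + sinh l := (cosh_add_sinh l).symm
  have e2 : exp (-l) = cosh l - sinh l := (cosh_sub_sinh l).symm
  have hBpos : 0 < B := by
    apply div_pos _ hsl
    have : cosh r ≤ cosh (l + s) := cosh_le_cosh.2 (by
      rw [abs_of_nonneg hr, abs_of_nonneg (by linarith)]; exact h2)
    have h4 : cosh (l + s) < cosh s * exp l := by
      rw [cosh_add, e1]
      have : sinh s < cosh s := sinh_lt_cosh s
      nlinarith
    have h5 : cosh r * exp (-l) < cosh s * exp l * exp (-l) :=
      mul_lt_mul_of_pos_right (this.trans_lt h4) (exp_pos _)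
    rw [mul_assoc, hel, mul_one] at h5
    linarith
  -- This is the condition for the real part to exist. It follows from the triangle inequalities in
  -- the form `cosh (r - s) ≤ cosh l ≤ cosh (r + s)`.
  have hAB : 1 ≤ A * B := by
    rw [hA, hB, div_mul_div_comm, le_div_iff₀ (by positivity)]
    have f1 : cosh l ≤ cosh (r + s) := cosh_le_cosh.2 (by
      rw [abs_of_nonneg hl.le, abs_of_nonneg (by linarith)]; exact h1)
    have f2 : cosh (r - s) ≤ cosh l := cosh_le_cosh.2 (by
      rw [abs_of_nonneg hl.le, abs_le]; constructor <;> linarith)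
    have f3 := mul_nonneg (sub_nonneg.2 f1) (sub_nonneg.2 f2)
    rw [cosh_add, cosh_sub] at f3
    have g1 := cosh_sq r
    have g2 := cosh_sq s
    have g3 := cosh_sq l
    rw [e1, e2]
    have k : (sinh r * sinh s) ^ 2 = (cosh r ^ 2 - 1) * (cosh s ^ 2 - 1) := by
      rw [g1, g2]; ring
    nlinarith
  have hY : 0 < 1 / B := by positivity
  refine ⟨⟨⟨√(A * B - 1) / B, 1 / B⟩, hY⟩, ?_, ?_⟩
  all_goals
    have hre : (⟨⟨√(A * B - 1) / B, 1 / B⟩, hY⟩ : UpperHalfPlane).re = √(A * B - 1) / B := rfl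
    have him : (⟨⟨√(A * B - 1) / B, 1 / B⟩, hY⟩ : UpperHalfPlane).im = 1 / B := rfl
    have hq : ((√(A * B - 1) / B) ^ 2 + (1 / B) ^ 2) / (1 / B) = A := by
      rw [div_pow, sq_sqrt (by linarith)]
      field_simp
      ring
  · have key : cosh (dist (⟨⟨√(A * B - 1) / B, 1 / B⟩, hY⟩ : UpperHalfPlane) (axisPoint 0))
        = cosh r := by
      rw [cosh_dist_axisPoint, hre, him, hq]
      simp only [neg_zero, exp_zero, mul_one, one_div_one_div]
      rw [hA, hB, e1, e2]
      field_simp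
      ring
    have h3 := (Real.cosh_le_cosh).1 key.le
    have h4 := (Real.cosh_le_cosh).1 key.ge
    rw [abs_of_nonneg dist_nonneg, abs_of_nonneg hr] at h3 h4
    exact le_antisymm h3 h4
  · have key : cosh (dist (⟨⟨√(A * B - 1) / B, 1 / B⟩, hY⟩ : UpperHalfPlane) (axisPoint l))
        = cosh s := by
      rw [cosh_dist_axisPoint, hre, him, hq]
      rw [show exp l / (1 / B) = B * exp l by field_simp, hA, hB, div_mul_eq_mul_div,
        div_mul_eq_mul_div, sub_mul, sub_mul, mul_assoc, hel, mul_assoc, mul_comm (exp (-l)), hel,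
        e1, e2]
      field_simp
      ring
    have h3 := (Real.cosh_le_cosh).1 key.le
    have h4 := (Real.cosh_le_cosh).1 key.ge
    rw [abs_of_nonneg dist_nonneg, abs_of_nonneg hs] at h3 h4
    exact le_antisymm h3 h4

end HyperbolicPlane

/-! ### Stewart's inequality and convexity of heights. -/

variable {X : Type*} [MetricSpace X]

/-- The hyperbolic Stewart inequality. -/
theorem IsGeodesicCATNegOne.stewart (hX : IsGeodesicCATNegOne X) {x y m : X}
    (hm : OnSegment x y m) (z : X) :
    cosh (dist z m) * sinh (dist x y) ≤
      cosh (dist z x) * sinh (dist m y) + cosh (dist z y) * sinh (dist x m) := by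
  rcases (dist_nonneg (x := x) (y := y)).eq_or_lt with h0 | hl
  · rw [← h0, sinh_zero, mul_zero]
    have := sinh_nonneg_iff.2 (dist_nonneg (x := m) (y := y))
    have := sinh_nonneg_iff.2 (dist_nonneg (x := x) (y := m))
    have := cosh_pos (dist z x)
    have := cosh_pos (dist z y)
    positivity
  have hm' : dist x m + dist m y = dist x y := hm
  have hxm := dist_nonneg (x := x) (y := m)
  have hmy := dist_nonneg (x := m) (y := y)
  obtain ⟨w, hw0, hwl⟩ := exists_comparison_vertex hl (dist_nonneg (x := z) (y := x))
    (dist_nonneg (x := z) (y := y)) (dist_triangle_left x y z)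
    ((dist_triangle z y x).trans (by rw [dist_comm y x, add_comm]))
    ((dist_triangle z x y).trans (by rw [add_comm]))
  -- With `q = z`, only the distance from a vertex to a point of the opposite side is compared.
  have h := hX.comparison x y z m z (axisPoint 0) (axisPoint (dist x y)) w
    (axisPoint (dist x m)) w
    (by rw [dist_axisPoint _ _ hl.le, sub_zero])
    (by rw [dist_comm, hw0, dist_comm]) (by rw [dist_comm, hwl, dist_comm])
    hm (by simp [OnSegment])
    (by rw [dist_axisPoint _ _ hxm, sub_zero])
    (by rw [dist_axisPoint _ _ (by linarith)]; linarith)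
    (by rw [dist_comm, hw0, dist_comm]) (by simp)
  rw [dist_comm m z, dist_comm _ w] at h
  have hc : cosh (dist z m) ≤ cosh (dist w (axisPoint (dist x m))) := cosh_le_cosh.2 (by
    rwa [abs_of_nonneg dist_nonneg, abs_of_nonneg dist_nonneg])
  refine (mul_le_mul_of_nonneg_right hc (sinh_nonneg_iff.2 hl.le)).trans (le_of_eq ?_)
  rw [← hw0, ← hwl, ← hm']
  simp only [cosh_dist_axisPoint]
  generalize (w.re ^ 2 + w.im ^ 2) / w.im = A
  generalize dist x m = a
  generalize dist m y = b
  rw [div_eq_mul_inv (exp a), div_eq_mul_inv (exp 0), div_eq_mul_inv (exp (a + b))]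
  generalize w.im⁻¹ = B
  simp only [sinh_eq, neg_add, exp_add, neg_zero, exp_zero, exp_neg]
  have := exp_pos a
  have := exp_pos b
  field_simp
  ring

theorem IsGeodesicSpace.exists_between (hX : IsGeodesicSpace X) (x y : X) {a : ℝ} (h0 : 0 ≤ a)
    (h1 : a ≤ dist x y) : ∃ m, dist x m = a ∧ dist m y = dist x y - a := by
  obtain ⟨γ, g0, g1, hg⟩ := hX x y
  have hl : 0 ≤ dist x y := dist_nonneg
  refine ⟨γ a, ?_, ?_⟩
  · conv_lhs => rw [← g0]
    rw [hg 0 ⟨le_rfl, hl⟩ a ⟨h0, h1⟩, zero_sub, abs_neg, abs_of_nonneg h0]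
  · conv_lhs => rw [← g1]
    rw [hg a ⟨h0, h1⟩ _ ⟨hl, le_rfl⟩, abs_of_nonpos (by linarith)]
    ring

theorem IsGeodesicSpace.exists_midpoint (hX : IsGeodesicSpace X) (x y : X) :
    ∃ m, dist x m = dist x y / 2 ∧ dist m y = dist x y / 2 := by
  have hl : 0 ≤ dist x y := dist_nonneg
  obtain ⟨m, h1, h2⟩ := hX.exists_between x y (a := dist x y / 2) (by linarith) (by linarith)
  exact ⟨m, h1, by rw [h2]; ring⟩

theorem IsGeodesicCATNegOne.stewart_midpoint (hX : IsGeodesicCATNegOne X) {x y m : X}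
    (h1 : dist x m = dist x y / 2) (h2 : dist m y = dist x y / 2) (z : X) :
    cosh (dist z m) * (2 * cosh (dist x y / 2)) ≤ cosh (dist z x) + cosh (dist z y) := by
  rcases (dist_nonneg (x := x) (y := y)).eq_or_lt with h0 | hl
  · have hxy : x = y := dist_eq_zero.1 h0.symm
    have hxm : x = m := dist_eq_zero.1 (by rw [h1, ← h0, zero_div])
    subst hxy; subst hxm
    simp only [dist_self, zero_div, cosh_zero]
    linarith
  · have h := hX.stewart (x := x) (y := y) (m := m) (by rw [OnSegment, h1, h2]; ring) z
    have hs : 0 < sinh (dist x y / 2) := sinh_pos_iff.2 (by linarith)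
    rw [h1, h2, show sinh (dist x y) = 2 * sinh (dist x y / 2) * cosh (dist x y / 2) by
      rw [← sinh_two_mul]; congr 1; ring] at h
    nlinarith

theorem exp_le_two_mul_cosh (x : ℝ) : exp x ≤ 2 * cosh x := by
  rw [cosh_eq]; have := exp_pos (-x); linarith

theorem cosh_le_exp_of_nonneg {x : ℝ} (hx : 0 ≤ x) : cosh x ≤ exp x := by
  rw [← cosh_add_sinh]; have := sinh_nonneg_iff.2 hx; linarith

/-- `1`-Lipschitz functions which are as convex as the height functions of horoballs. -/
structure IsHeight (f : X → ℝ) : Prop where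
  lip : ∀ x y, f x - f y ≤ dist x y
  stewart : ∀ x y m, OnSegment x y m →
    exp (-f m) * sinh (dist x y) ≤ exp (-f x) * sinh (dist m y) + exp (-f y) * sinh (dist x m)

namespace IsHeight

variable {f : X → ℝ}

theorem continuous (hf : IsHeight f) : Continuous f := by
  have : LipschitzWith 1 f := LipschitzWith.of_le_add fun x y => by linarith [hf.lip x y]
  exact this.continuous

theorem add_const (hf : IsHeight f) (c : ℝ) : IsHeight fun x => f x + c where
  lip x y := by linarith [hf.lip x y]
  stewart x y m h := by
    have := mul_le_mul_of_nonneg_right (hf.stewart x y m h) (exp_pos (-c)).le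
    simp only [neg_add, exp_add]
    linarith

theorem midpoint (hf : IsHeight f) {x y m : X}
    (h1 : dist x m = dist x y / 2) (h2 : dist m y = dist x y / 2) :
    exp (-f m) * (2 * cosh (dist x y / 2)) ≤ exp (-f x) + exp (-f y) := by
  rcases (dist_nonneg (x := x) (y := y)).eq_or_lt with h0 | hl
  · have hxy : x = y := dist_eq_zero.1 h0.symm
    have hxm : x = m := dist_eq_zero.1 (by rw [h1, ← h0, zero_div])
    subst hxy; subst hxm
    simp only [dist_self, zero_div, cosh_zero]
    linarith
  · have h := hf.stewart x y m (by rw [OnSegment, h1, h2]; ring)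
    have hs : 0 < sinh (dist x y / 2) := sinh_pos_iff.2 (by linarith)
    rw [h1, h2, show sinh (dist x y) = 2 * sinh (dist x y / 2) * cosh (dist x y / 2) by
      rw [← sinh_two_mul]; congr 1; ring] at h
    nlinarith

theorem sinh_add_sinh_le {a b : ℝ} (ha : 0 ≤ a) (hb : 0 ≤ b) :
    sinh a + sinh b ≤ sinh (a + b) := by
  rw [sinh_add]
  have h1 := sinh_nonneg_iff.2 ha
  have h2 := sinh_nonneg_iff.2 hb
  nlinarith [one_le_cosh a, one_le_cosh b]

/-- Superlevel sets are convex. -/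
theorem le_of_onSegment (hf : IsHeight f) {x y m : X} (hm : OnSegment x y m) {c : ℝ}
    (hx : c ≤ f x) (hy : c ≤ f y) : c ≤ f m := by
  have hm' : dist x m + dist m y = dist x y := hm
  rcases (dist_nonneg (x := x) (y := y)).eq_or_lt with h0 | hl
  · have hxm : x = m := dist_eq_zero.1 (le_antisymm
      (by linarith [dist_nonneg (x := m) (y := y)]) dist_nonneg)
    rwa [← hxm]
  have h := hf.stewart x y m hm
  have h3 := sinh_add_sinh_le (dist_nonneg (x := x) (y := m)) (dist_nonneg (x := m) (y := y))
  rw [hm'] at h3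
  have h1 := sinh_nonneg_iff.2 (dist_nonneg (x := x) (y := m))
  have h2 := sinh_nonneg_iff.2 (dist_nonneg (x := m) (y := y))
  have hs := sinh_pos_iff.2 hl
  have k1 := mul_le_mul_of_nonneg_right (exp_le_exp.2 (neg_le_neg hx)) h2
  have k2 := mul_le_mul_of_nonneg_right (exp_le_exp.2 (neg_le_neg hy)) h1
  have k3 := mul_le_mul_of_nonneg_left h3 (exp_pos (-c)).le
  have : exp (-f m) ≤ exp (-c) := le_of_mul_le_mul_right (by linarith) hs
  linarith [exp_le_exp.1 this]

theorem pos_of_onSegment (hf : IsHeight f) {x y m : X} (hm : OnSegment x y m)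
    (hx : 0 ≤ f x) (hy : 0 < f y) (hxm : x ≠ m) : 0 < f m := by
  have hm' : dist x m + dist m y = dist x y := hm
  have hd := dist_pos.2 hxm
  have hl : 0 < dist x y := by linarith [dist_nonneg (x := m) (y := y)]
  have h := hf.stewart x y m hm
  have h3 := sinh_add_sinh_le (dist_nonneg (x := x) (y := m)) (dist_nonneg (x := m) (y := y))
  rw [hm'] at h3
  have h1 := sinh_pos_iff.2 hd
  have h2 := sinh_nonneg_iff.2 (dist_nonneg (x := m) (y := y))
  have hs := sinh_pos_iff.2 hl
  have k1 := mul_le_mul_of_nonneg_right (exp_le_one_iff.2 (neg_nonpos.2 hx)) h2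
  have k2 := mul_lt_mul_of_pos_right (exp_lt_one_iff.2 (neg_neg_of_pos hy)) h1
  have : exp (-f m) < 1 := lt_of_mul_lt_mul_right (by linarith) hs.le
  linarith [exp_lt_one_iff.1 this]

end IsHeight

theorem onSegment_of_isometric {g : ℝ → X} {D : Set ℝ}
    (hg : ∀ s ∈ D, ∀ t ∈ D, dist (g s) (g t) = |s - t|) {r s t : ℝ} (hr : r ∈ D) (hs : s ∈ D)
    (ht : t ∈ D) (h1 : r ≤ s) (h2 : s ≤ t) : OnSegment (g r) (g t) (g s) := by
  rw [OnSegment, hg r hr s hs, hg s hs t ht, hg r hr t ht, abs_of_nonpos (by linarith),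
    abs_of_nonpos (by linarith), abs_of_nonpos (by linarith)]
  ring

theorem sinh_le_exp_neg_mul_sinh {a b : ℝ} (hb : 0 ≤ b) :
    sinh a ≤ exp (-b) * sinh (a + b) := by
  rw [sinh_eq, sinh_eq, neg_add, exp_add, exp_add]
  have h1 : exp (-b) * exp b = 1 := by rw [← exp_add]; simp
  have h2 : exp (-b) ≤ 1 := exp_le_one_iff.2 (by linarith)
  have h3 := exp_pos (-b)
  have h4 := exp_pos (-a)
  have h5 : exp (-b) * exp (-b) ≤ 1 := by nlinarith
  have : exp (-b) * ((exp a * exp b - exp (-a) * exp (-b)) / 2)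
      = (exp a * (exp (-b) * exp b) - exp (-a) * (exp (-b) * exp (-b))) / 2 := by ring
  rw [this, h1]
  nlinarith

/-- A height function which is bounded below along a geodesic ray grows at unit speed. -/
theorem IsHeight.unit_speed {f : X → ℝ} (hf : IsHeight f) {g : ℝ → X} {a C : ℝ}
    (hg : ∀ s ∈ Ici a, ∀ t ∈ Ici a, dist (g s) (g t) = |s - t|)
    (hC : ∀ t ≥ a, C ≤ f (g t)) {t : ℝ} (ht : a ≤ t) : f (g t) = f (g a) + (t - a) := by
  apply le_antisymm
  · have := hf.lip (g t) (g a)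
    rw [hg t ht a self_mem_Ici, abs_of_nonneg (by linarith)] at this
    linarith
  -- Stewart's inequality on `[g a, g T]`. The far end has weight `sinh (t - a) / sinh (T - a)`,
  -- bounded crudely through `(T - a)⁻¹`, which vanishes as `T` grows.
  have key : ∀ T, t < T → exp (-f (g t)) ≤
      exp (-f (g a)) * exp (-(t - a)) + exp (-C) * sinh (t - a) * (T - a)⁻¹ := by
    intro T hT
    have haT : a < T := by linarith
    have h := hf.stewart _ _ _ (onSegment_of_isometric hg self_mem_Ici ht haT.le ht hT.le)
    rw [hg a self_mem_Ici T haT.le, hg t ht T haT.le, hg a self_mem_Ici t ht,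
      abs_of_nonpos (by linarith), abs_of_nonpos (by linarith), abs_of_nonpos (by linarith),
      neg_sub, neg_sub, neg_sub] at h
    have hs : 0 < sinh (T - a) := sinh_pos_iff.2 (by linarith)
    have h1 := sinh_le_exp_neg_mul_sinh (a := T - t) (b := t - a) (by linarith)
    rw [show T - t + (t - a) = T - a by ring] at h1
    have h2 : exp (-f (g T)) ≤ exp (-C) := exp_le_exp.2 (neg_le_neg (hC T haT.le))
    have h3 := sinh_nonneg_iff.2 (sub_nonneg.2 ht)
    have h4 : 1 ≤ (T - a)⁻¹ * sinh (T - a) := by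
      rw [← div_eq_inv_mul, le_div_iff₀ (by linarith), one_mul]
      exact self_le_sinh_iff.2 (by linarith)
    have h5 := exp_pos (-f (g a))
    have k1 := mul_le_mul_of_nonneg_left h1 h5.le
    have k2 := mul_le_mul_of_nonneg_right h2 h3
    have k3 := mul_le_mul_of_nonneg_left h4 (mul_nonneg (exp_pos (-C)).le h3)
    refine le_of_mul_le_mul_right ?_ hs
    rw [add_mul]
    linarith
  have hlim : Tendsto (fun T : ℝ => exp (-f (g a)) * exp (-(t - a)) +
      exp (-C) * sinh (t - a) * (T - a)⁻¹) atTop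
      (𝓝 (exp (-f (g a)) * exp (-(t - a)) + exp (-C) * sinh (t - a) * 0)) := by
    refine tendsto_const_nhds.add (tendsto_const_nhds.mul ?_)
    exact tendsto_inv_atTop_zero.comp (tendsto_atTop_add_const_right _ (-a) tendsto_id)
  rw [mul_zero, add_zero] at hlim
  have := ge_of_tendsto hlim (eventually_atTop.2 ⟨t + 1, fun T hT => key T (by linarith)⟩)
  rw [← exp_add] at this
  have := exp_le_exp.1 this
  linarith

/-! ### Busemann functions of rays. -/

namespace Ray

theorem dist_eq (ρ : Ray X) (s t : ℝ≥0) : dist (ρ s) (ρ t) = |(s : ℝ) - t| := by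
  rw [ρ.isometry.dist_eq, NNReal.dist_eq]

/-- A ray as a function on the real line, constant on the negative numbers. -/
def ext (ρ : Ray X) (t : ℝ) : X := ρ t.toNNReal

@[simp] theorem ext_coe (ρ : Ray X) (t : ℝ≥0) : ρ.ext t = ρ t := by simp [ext]

theorem ext_isometric (ρ : Ray X) : ∀ s ∈ Ici (0 : ℝ), ∀ t ∈ Ici (0 : ℝ),
    dist (ρ.ext s) (ρ.ext t) = |s - t| := by
  intro s hs t ht
  rw [ext, ext, dist_eq, Real.coe_toNNReal _ hs, Real.coe_toNNReal _ ht]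

/-- The ray defined by a map which is isometric on a half-line. -/
def ofIsometric (g : ℝ → X) (a : ℝ) (hg : ∀ s ∈ Ici a, ∀ t ∈ Ici a, dist (g s) (g t) = |s - t|) :
    Ray X where
  toFun t := g (a + t)
  isometry := Isometry.of_dist_eq fun s t => by
    rw [hg _ (by simp) _ (by simp), NNReal.dist_eq]
    congr 1
    ring

@[simp] theorem ofIsometric_apply (g : ℝ → X) (a : ℝ)
    (hg : ∀ s ∈ Ici a, ∀ t ∈ Ici a, dist (g s) (g t) = |s - t|) (t : ℝ≥0) :
    ofIsometric g a hg t = g (a + t) := rfl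

theorem bounded_below (ρ : Ray X) (y : X) (t : ℝ) (ht : 0 ≤ t) :
    -dist y (ρ 0) ≤ dist y (ρ.ext t) - t := by
  have h1 := ρ.ext_isometric 0 self_mem_Ici t ht
  have h2 := dist_triangle_left (ρ.ext 0) (ρ.ext t) y
  have h3 : ρ.ext 0 = ρ 0 := by simpa using ρ.ext_coe 0
  rw [zero_sub, abs_neg, abs_of_nonneg ht] at h1
  rw [h3] at h1 h2
  linarith

/-- The Busemann function of a ray, normalized to be `0` at its origin and to decrease along it. -/
noncomputable def bus (ρ : Ray X) (y : X) : ℝ := ⨅ t : Ici (0 : ℝ), (dist y (ρ.ext t) - (t : ℝ))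

theorem tendsto_bus (ρ : Ray X) (y : X) :
    Tendsto (fun t : ℝ => dist y (ρ.ext t) - t) atTop (𝓝 (ρ.bus y)) := by
  have hanti : Antitone fun t : Ici (0 : ℝ) => dist y (ρ.ext t) - (t : ℝ) := by
    intro s t hst
    have h := dist_triangle y (ρ.ext s) (ρ.ext t)
    rw [ρ.ext_isometric s s.2 t t.2, abs_of_nonpos (sub_nonpos.2 (show (s : ℝ) ≤ t from hst))] at h
    simp only
    linarith
  have hb : BddBelow (range fun t : Ici (0 : ℝ) => dist y (ρ.ext t) - (t : ℝ)) :=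
    ⟨-dist y (ρ 0), by rintro _ ⟨t, rfl⟩; exact ρ.bounded_below y t t.2⟩
  exact tendsto_comp_val_Ici_atTop.1 (tendsto_atTop_ciInf hanti hb)

theorem bus_apply (ρ : Ray X) {s : ℝ} (hs : 0 ≤ s) : ρ.bus (ρ.ext s) = -s := by
  refine tendsto_nhds_unique (ρ.tendsto_bus _) (tendsto_const_nhds.congr' ?_)
  filter_upwards [eventually_ge_atTop s] with t ht
  rw [ρ.ext_isometric s hs t (hs.trans ht), abs_of_nonpos (by linarith)]
  ring

theorem bus_sub_le (ρ : Ray X) (x y : X) : ρ.bus x - ρ.bus y ≤ dist x y := by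
  refine le_of_tendsto ((ρ.tendsto_bus x).sub (ρ.tendsto_bus y)) (Eventually.of_forall fun t => ?_)
  have := dist_triangle x y (ρ.ext t)
  linarith

/-- The factor `exp (-t)` kills the decaying half of `2 cosh`. Exponentials of Busemann functions
thus become limits of quantities governed by Stewart's inequality. -/
theorem tendsto_cosh (ρ : Ray X) (y : X) :
    Tendsto (fun t : ℝ => 2 * exp (-t) * cosh (dist y (ρ.ext t))) atTop (𝓝 (exp (ρ.bus y))) := by
  have h1 := (continuous_exp.tendsto _).comp (ρ.tendsto_bus y)
  have h2 : Tendsto (fun t : ℝ => exp (-t) * exp (-dist y (ρ.ext t))) atTop (𝓝 0) := by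
    refine squeeze_zero (fun t => by positivity) (fun t => ?_)
      (tendsto_exp_neg_atTop_nhds_zero)
    exact mul_le_of_le_one_right (exp_pos _).le
      (exp_le_one_iff.2 (neg_nonpos.2 dist_nonneg))
  have h3 := h1.add h2
  rw [add_zero] at h3
  refine h3.congr fun t => ?_
  simp only [Function.comp]
  rw [cosh_eq, sub_eq_add_neg, exp_add]
  ring

/-- The convexity is Stewart's inequality with vertex `ρ.ext t`, multiplied by `2 exp (-t)`, in the
limit. -/
theorem isHeight_neg_bus (hX : IsGeodesicCATNegOne X) (ρ : Ray X) :
    IsHeight fun y => -ρ.bus y where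
  lip x y := by
    have := ρ.bus_sub_le y x
    rw [dist_comm] at this
    linarith
  stewart x y m hm := by
    simp only [neg_neg]
    refine le_of_tendsto_of_tendsto ((ρ.tendsto_cosh m).mul_const _)
      (((ρ.tendsto_cosh x).mul_const _).add ((ρ.tendsto_cosh y).mul_const _))
      (Eventually.of_forall fun t => ?_)
    have h := hX.stewart hm (ρ.ext t)
    rw [dist_comm (ρ.ext t) m, dist_comm (ρ.ext t) x, dist_comm (ρ.ext t) y] at h
    have := mul_le_mul_of_nonneg_left h (mul_pos two_pos (exp_pos (-t))).le
    simp only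
    linarith

/-- Bounded distance to `ρ` keeps `-ρ.bus` bounded below along `σ`, so `unit_speed` applies. -/
theorem bus_of_equiv (hX : IsGeodesicCATNegOne X) {σ ρ : Ray X} (h : σ ≈ ρ) {t : ℝ}
    (ht : 0 ≤ t) : ρ.bus (σ.ext t) = ρ.bus (σ 0) - t := by
  obtain ⟨C, hC⟩ := h
  have := (isHeight_neg_bus hX ρ).unit_speed (a := 0) (C := -C) σ.ext_isometric (fun t ht => by
    have h1 := ρ.bus_sub_le (σ.ext t) (ρ.ext t)
    rw [ρ.bus_apply ht] at h1
    have h2 := hC t.toNNReal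
    change dist (σ.ext t) (ρ.ext t) ≤ C at h2
    have ht' : 0 ≤ t := ht
    linarith) ht
  have h3 : σ.ext 0 = σ 0 := by simpa using σ.ext_coe 0
  rw [h3] at this
  linarith

/-- A ray along which the Busemann function of `ρ` decreases at unit speed becomes arbitrarily
close to `ρ`. -/
theorem tendsto_dist_of_bus (hX : IsGeodesicCATNegOne X) {σ ρ : Ray X}
    (h : ∀ t : ℝ, 0 ≤ t → ρ.bus (σ.ext t) = ρ.bus (σ 0) - t) :
    Tendsto (fun t : ℝ => dist (σ.ext t) (ρ.ext (t - ρ.bus (σ 0)))) atTop (𝓝 0) := by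
  set c := ρ.bus (σ 0) with hc
  have hδ : Tendsto (fun t : ℝ => dist (σ 0) (ρ.ext (t - c)) - t) atTop (𝓝 0) := by
    have h1 := (ρ.tendsto_bus (σ 0)).comp (tendsto_atTop_add_const_right _ (-c) tendsto_id)
    have h2 := h1.add_const (-c)
    rw [← hc, add_neg_cancel] at h2
    refine h2.congr fun t => ?_
    simp only [Function.comp, id, ← sub_eq_add_neg]
    ring
  have hF : Tendsto (fun t : ℝ => exp (-t) * (cosh t + cosh (dist (σ 0) (ρ.ext (t - c)))) - 1)
      atTop (𝓝 0) := by
    have h1 : Tendsto (fun t : ℝ => exp (-t) * exp (-t)) atTop (𝓝 (0 * 0)) :=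
      tendsto_exp_neg_atTop_nhds_zero.mul tendsto_exp_neg_atTop_nhds_zero
    have h2 : Tendsto (fun t : ℝ => exp (-t) * exp (-dist (σ 0) (ρ.ext (t - c)))) atTop (𝓝 0) :=
      squeeze_zero (fun t => by positivity) (fun t => mul_le_of_le_one_right (exp_pos _).le
        (exp_le_one_iff.2 (neg_nonpos.2 dist_nonneg))) tendsto_exp_neg_atTop_nhds_zero
    have h3 := (continuous_exp.tendsto _).comp hδ
    have h4 := ((((h1.add h2).add h3).div_const 2).add_const (1 / 2 : ℝ)).sub_const 1
    have h5 : ((0 : ℝ) * 0 + 0 + exp 0) / 2 + 1 / 2 - 1 = 0 := by norm_num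
    rw [h5] at h4
    refine h4.congr fun t => ?_
    simp only [Function.comp]
    have : exp (-t) * exp t = 1 := by rw [← exp_add]; simp
    rw [cosh_eq, cosh_eq, sub_eq_add_neg (dist _ _), exp_add]
    linear_combination (-1 / 2) * this
  have hsq : ∀ᶠ t : ℝ in atTop, dist (σ.ext t) (ρ.ext (t - c)) ^ 2 ≤
      4 * (exp (-t) * (cosh t + cosh (dist (σ 0) (ρ.ext (t - c)))) - 1) := by
    filter_upwards [eventually_ge_atTop (0 : ℝ), eventually_ge_atTop c] with t ht htc
    set l := dist (σ.ext t) (ρ.ext (t - c)) with hl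
    -- Both ends have Busemann value `c - t`, so convexity puts `m` at distance at least `t + log
    -- (cosh (l / 2))` from `σ 0`. Stewart's inequality bounds this distance from above. Together
    -- they force `cosh (l / 2) ^ 2` to tend to `1`.
    obtain ⟨m, hm1, hm2⟩ := hX.geodesic.exists_midpoint (σ.ext t) (ρ.ext (t - c))
    have k1 := (isHeight_neg_bus hX ρ).midpoint hm1 hm2
    simp only [neg_neg] at k1
    rw [h t ht, ρ.bus_apply (sub_nonneg.2 htc), neg_sub, ← hl] at k1
    have k2 := hX.stewart_midpoint hm1 hm2 (σ 0)
    have k3 : dist (σ 0) (σ.ext t) = t := by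
      have := σ.ext_isometric 0 self_mem_Ici t ht
      rw [zero_sub, abs_neg, abs_of_nonneg ht] at this
      rwa [show σ.ext 0 = σ 0 by simpa using σ.ext_coe 0] at this
    rw [k3, ← hl] at k2
    have k4 := ρ.bus_sub_le (σ 0) m
    rw [← hc] at k4
    have hcp := cosh_pos (l / 2)
    have k5 : exp t * cosh (l / 2) ≤ 2 * cosh (dist (σ 0) m) := by
      refine le_trans ?_ ((exp_le_exp.2 k4).trans (exp_le_two_mul_cosh _))
      have : exp (ρ.bus m) * cosh (l / 2) ≤ exp (c - t) := by linarith
      have e1 : exp t * exp (c - t) = exp (c - ρ.bus m) * exp (ρ.bus m) := by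
        rw [← exp_add, ← exp_add]; congr 1; ring
      have e2 : exp t * cosh (l / 2) * exp (ρ.bus m) ≤ exp (c - ρ.bus m) * exp (ρ.bus m) := by
        rw [← e1]
        nlinarith [exp_pos t]
      exact le_of_mul_le_mul_right e2 (exp_pos _)
    have k6 : exp t * (cosh (l / 2)) ^ 2 ≤ cosh t + cosh (dist (σ 0) (ρ.ext (t - c))) := by
      nlinarith
    have k7 : cosh (l / 2) ^ 2 ≤ exp (-t) * (cosh t + cosh (dist (σ 0) (ρ.ext (t - c)))) := by
      have : exp (-t) * exp t = 1 := by rw [← exp_add]; simp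
      have k8 := mul_le_mul_of_nonneg_left k6 (exp_pos (-t)).le
      rwa [← mul_assoc, this, one_mul] at k8
    have k9 : l / 2 ≤ sinh (l / 2) := self_le_sinh_iff.2 (by positivity)
    have k10 : 0 ≤ l / 2 := by positivity
    rw [cosh_sq] at k7
    nlinarith
  have hlim : Tendsto (fun t : ℝ => dist (σ.ext t) (ρ.ext (t - c)) ^ 2) atTop (𝓝 0) := by
    have := hF.const_mul 4
    rw [mul_zero] at this
    exact tendsto_of_tendsto_of_tendsto_of_le_of_le' tendsto_const_nhds this
      (Eventually.of_forall fun t => by positivity) hsq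
  have := (continuous_sqrt.tendsto _).comp hlim
  rw [sqrt_zero] at this
  exact this.congr fun t => by simp [sqrt_sq dist_nonneg]

theorem equiv_of_bus (hX : IsGeodesicCATNegOne X) {σ ρ : Ray X}
    (h : ∀ t : ℝ, 0 ≤ t → ρ.bus (σ.ext t) = ρ.bus (σ 0) - t) : σ ≈ ρ := by
  have h1 := (tendsto_dist_of_bus hX h).eventually (gt_mem_nhds zero_lt_one)
  obtain ⟨T, hT⟩ := eventually_atTop.1 h1
  set c := ρ.bus (σ 0)
  set T' := max (max T 0) c
  refine ⟨1 + |c| + (dist (σ 0) (ρ 0) + 2 * T'), fun t => ?_⟩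
  have hT0 : 0 ≤ T' := (le_max_right _ _).trans (le_max_left _ _)
  have hdn := dist_nonneg (x := σ 0) (y := ρ 0)
  rcases le_total T' t with ht | ht
  · have k1 := hT t (((le_max_left _ _).trans (le_max_left _ _)).trans ht)
    have k2 := ρ.ext_isometric (t - c) (sub_nonneg.2 ((le_max_right _ _).trans ht)) t t.2
    rw [show (t : ℝ) - c - t = -c by ring, abs_neg] at k2
    have k3 := dist_triangle (σ.ext t) (ρ.ext (t - c)) (ρ.ext t)
    rw [σ.ext_coe, ρ.ext_coe] at *
    linarith
  · have k1 := σ.dist_eq t 0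
    have k2 := ρ.dist_eq 0 t
    have k3 := dist_triangle4 (σ t) (σ 0) (ρ 0) (ρ t)
    simp only [NNReal.coe_zero, sub_zero, zero_sub, abs_neg, NNReal.abs_eq] at k1 k2
    have := abs_nonneg c
    linarith

/-- After a time shift by `ρ.bus (σ 0)` the two rays become arbitrarily close, so the shift is the
only difference between their Busemann functions. -/
theorem bus_eq_of_bus (hX : IsGeodesicCATNegOne X) {σ ρ : Ray X}
    (h : ∀ t : ℝ, 0 ≤ t → ρ.bus (σ.ext t) = ρ.bus (σ 0) - t) (y : X) :
    σ.bus y = ρ.bus y - ρ.bus (σ 0) := by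
  set c := ρ.bus (σ 0)
  have h1 := tendsto_dist_of_bus hX h
  have h2 : Tendsto (fun t : ℝ => dist y (ρ.ext (t - c)) - t) atTop (𝓝 (ρ.bus y - c)) := by
    have h1 := (ρ.tendsto_bus y).comp (tendsto_atTop_add_const_right _ (-c) tendsto_id)
    refine (h1.sub_const c).congr fun t => ?_
    simp only [Function.comp, id, ← sub_eq_add_neg]
    ring
  have h3 : Tendsto (fun t : ℝ => (dist y (σ.ext t) - t) - (dist y (ρ.ext (t - c)) - t)) atTop
      (𝓝 0) := by
    refine squeeze_zero_norm (fun t => ?_) h1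
    rw [Real.norm_eq_abs]
    have := abs_dist_sub_le (σ.ext t) (ρ.ext (t - c)) y
    rw [dist_comm _ y, dist_comm _ y] at this
    simpa using this
  have h4 := (σ.tendsto_bus y).sub h2
  have := tendsto_nhds_unique h3 h4
  linarith

end Ray

/-- The `lim` of the definition is a genuine limit, since each distance converges after subtracting
`t`. -/
theorem busemann_eq (η : Boundary X) (x y : X) :
    busemann η x y = (Quotient.out η : Ray X).bus x - (Quotient.out η : Ray X).bus y := by
  set ρ : Ray X := Quotient.out η
  have h := ((ρ.tendsto_bus x).sub (ρ.tendsto_bus y)).comp (NNReal.tendsto_coe_atTop.2 tendsto_id)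
  refine Filter.Tendsto.limUnder_eq (h.congr fun t => ?_)
  simp only [Function.comp, id, Ray.ext_coe]
  ring

/-! ### Pencils: contraction towards the origin and entrance into a horoball. -/

/-- `g`, restricted to the times `t ≤ T` of `D`, is a geodesic calibrated by the function `b`. -/
structure IsArc (D : Set ℝ) (b : X → ℝ) (g : ℝ → X) (T : ℝ) : Prop where
  isometric : ∀ s ∈ D ∩ Iic T, ∀ t ∈ D ∩ Iic T, dist (g s) (g t) = |s - t|
  calibrated : ∀ t ∈ D ∩ Iic T, b (g t) = t

/-- The pencil of the geodesics starting from a point of `X` or of its boundary at infinity. They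
are parametrized by the distance to this point, respectively by its Busemann function. -/
structure Pencil (X : Type*) [MetricSpace X] where
  dom : Set ℝ
  time : X → ℝ
  zero_mem : 0 ∈ dom
  upward : ∀ s ∈ dom, ∀ t, s ≤ t → t ∈ dom
  half_mem : ∀ x y s, time x ≤ s → time y ≤ s → s - dist x y / 2 ∈ dom
  time_sub_le : ∀ x y, time x - time y ≤ dist x y
  time_midpoint : ∀ x y m, dist x m = dist x y / 2 → dist m y = dist x y / 2 →
    exp (time m) * (2 * cosh (dist x y / 2)) ≤ exp (time x) + exp (time y)
  cosh_le : ∀ g T, IsArc dom time g T → ∀ t ∈ dom, t ≤ T → ∀ y,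
    cosh (dist (g t) y) ≤ exp (time y - T) * sinh (T - t) + exp (t - T) * cosh (dist (g T) y)
  exists_arc : ∀ x, ∃ g, IsArc dom time g (time x) ∧ g (time x) = x

namespace Pencil

variable (P : Pencil X)

/-- Calibrated geodesics of a pencil. -/
def IsGeod (g : ℝ → X) : Prop := ∀ T, IsArc P.dom P.time g T

variable {P} {g g' : ℝ → X} {t T T' : ℝ}

theorem IsArc.mono {D : Set ℝ} {b : X → ℝ} (hg : IsArc D b g T) (h : T' ≤ T) :
    IsArc D b g T' where
  isometric s hs t ht := hg.isometric s ⟨hs.1, hs.2.trans h⟩ t ⟨ht.1, ht.2.trans h⟩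
  calibrated t ht := hg.calibrated t ⟨ht.1, ht.2.trans h⟩

theorem IsGeod.isometric (hg : P.IsGeod g) : ∀ s ∈ P.dom, ∀ t ∈ P.dom,
    dist (g s) (g t) = |s - t| := fun s hs t ht =>
  (hg (max s t)).isometric s ⟨hs, mem_Iic.2 (le_max_left _ _)⟩ t
    ⟨ht, mem_Iic.2 (le_max_right _ _)⟩

theorem IsGeod.time_eq (hg : P.IsGeod g) (ht : t ∈ P.dom) : P.time (g t) = t :=
  (hg t).calibrated t ⟨ht, self_mem_Iic⟩

theorem exp_neg_mul_sinh (x : ℝ) : exp (-x) * sinh x = (1 - exp (-x) ^ 2) / 2 := by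
  have : exp (-x) * exp x = 1 := by rw [← exp_add]; simp
  rw [sinh_eq]
  linear_combination this / 2

/-- Apply `cosh_le` twice, moving first along `g` and then along `g'`. With `a = exp (t - T)`, `b =
exp (t - T')` and `L` the distance at the far ends, the outcome is `cosh d ≤ 1 - (a - b)² / 2 + a b
(cosh L - 1)`, and the square is dropped. -/
theorem sinh_half_le (hg : IsArc P.dom P.time g T) (hg' : IsArc P.dom P.time g' T')
    (ht : t ∈ P.dom) (h : t ≤ T) (h' : t ≤ T') :
    sinh (dist (g t) (g' t) / 2) ≤ exp (t - (T + T') / 2) * sinh (dist (g T) (g' T') / 2) := by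
  have h1 := P.cosh_le g T hg t ht h (g' T')
  have h2 := P.cosh_le g' T' hg' t ht h' (g t)
  rw [hg'.calibrated T' ⟨P.upward t ht _ h', self_mem_Iic⟩] at h1
  rw [hg.calibrated t ⟨ht, h⟩, dist_comm (g' T'), dist_comm (g' t)] at h2
  set a := exp (t - T) with ha
  set b := exp (t - T') with hb
  have e1 : b * exp (T' - T) = a := by rw [ha, hb, ← exp_add]; congr 1; ring
  have e2 : a * sinh (T - t) = (1 - a ^ 2) / 2 := by
    have := exp_neg_mul_sinh (T - t)
    rwa [neg_sub] at this
  have e3 : b * sinh (T' - t) = (1 - b ^ 2) / 2 := by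
    have := exp_neg_mul_sinh (T' - t)
    rwa [neg_sub] at this
  have hb0 : 0 < b := exp_pos _
  have h3 := mul_le_mul_of_nonneg_left h1 hb0.le
  have e4 : b * (exp (T' - T) * sinh (T - t)) = (1 - a ^ 2) / 2 := by rw [← mul_assoc, e1, e2]
  have e5 : exp (t - (T + T') / 2) ^ 2 = a * b := by
    rw [ha, hb, ← exp_add, ← exp_nat_mul]; congr 1; push_cast; ring
  have c1 : ∀ d : ℝ, cosh d = 1 + 2 * sinh (d / 2) ^ 2 := fun d => by
    have := cosh_two_mul (d / 2)
    rw [mul_div_cancel₀ _ two_ne_zero] at this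
    rw [this, cosh_sq]; ring
  have h4 : sinh (dist (g t) (g' t) / 2) ^ 2 ≤
      (exp (t - (T + T') / 2) * sinh (dist (g T) (g' T') / 2)) ^ 2 := by
    rw [mul_pow, e5]
    have k1 := c1 (dist (g t) (g' t))
    have k2 := c1 (dist (g T) (g' T'))
    rw [k2] at h3
    nlinarith [sq_nonneg (a - b)]
  exact (abs_le_of_sq_le_sq' h4
    (mul_nonneg (exp_pos _).le (sinh_nonneg_iff.2 (by positivity)))).2

/-- Two geodesics of a pencil approach each other exponentially fast towards their origin. -/
theorem dist_le_sinh (hg : IsArc P.dom P.time g T) (hg' : IsArc P.dom P.time g' T')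
    (ht : t ∈ P.dom) (h : t ≤ T) (h' : t ≤ T') :
    dist (g t) (g' t) ≤ 2 * sinh (dist (g T) (g' T') / 2) * exp (t - (T + T') / 2) := by
  have h1 := sinh_half_le hg hg' ht h h'
  have h2 : dist (g t) (g' t) / 2 ≤ sinh (dist (g t) (g' t) / 2) :=
    self_le_sinh_iff.2 (by positivity)
  linarith

theorem dist_le_exp (hg : IsArc P.dom P.time g T) (hg' : IsArc P.dom P.time g' T')
    (ht : t ∈ P.dom) (h : t ≤ T) (h' : t ≤ T') :
    dist (g t) (g' t) ≤ exp (dist (g T) (g' T') / 2 + t - (T + T') / 2) := by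
  refine (dist_le_sinh hg hg' ht h h').trans ?_
  rw [add_sub_assoc, exp_add]
  refine mul_le_mul_of_nonneg_right ?_ (exp_pos _).le
  rw [sinh_eq]
  linarith [exp_pos (-(dist (g T) (g' T') / 2))]

theorem exp_five_fourths_bounds : 3.4 ≤ exp (5 / 4) ∧ exp (5 / 4) ≤ 3.6 := by
  have h1 := exp_one_gt_d9
  have h2 := exp_one_lt_d9
  have h3 : exp (5 / 4) ^ 4 = exp 1 ^ 5 := by
    rw [← exp_nat_mul, ← exp_nat_mul]; norm_num
  constructor
  · refine le_of_pow_le_pow_left₀ (n := 4) (by norm_num) (exp_pos _).le ?_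
    rw [h3]
    calc (3.4 : ℝ) ^ 4 ≤ 2.718 ^ 5 := by norm_num
      _ ≤ exp 1 ^ 5 := pow_le_pow_left₀ (by norm_num) (by linarith) _
  · refine le_of_pow_le_pow_left₀ (n := 4) (by norm_num) (by norm_num) ?_
    rw [h3]
    calc exp 1 ^ 5 ≤ 2.719 ^ 5 := pow_le_pow_left₀ (exp_pos _).le (by linarith) _
      _ ≤ (3.6 : ℝ) ^ 4 := by norm_num

theorem add_inv_le_add_inv {u v : ℝ} (hu : 1 ≤ u) (h : u ≤ v) : u + u⁻¹ ≤ v + v⁻¹ := by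
  have hu0 : 0 < u := by linarith
  have hv0 : 0 < v := by linarith
  have : v + v⁻¹ - (u + u⁻¹) = (v - u) * (u * v - 1) / (u * v) := by field_simp; ring
  have h2 : 0 ≤ (v - u) * (u * v - 1) / (u * v) :=
    div_nonneg (mul_nonneg (by linarith) (by nlinarith)) (by positivity)
  linarith

/-- The midpoint `m` of the entrance points, at distance `l` from each other, has height at least
`log (cosh (l / 2))`. The point `g (T - l / 2)` has height at most `0`, so its distance `d` to `m`
satisfies `cosh (l / 2) ≤ exp d`. The pencil inequalities bound `cosh d` from above, and the
comparison gives both conclusions. -/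
theorem entry_aux (hX : IsGeodesicSpace X) {f : X → ℝ} (hf : IsHeight f)
    (hg : IsArc P.dom P.time g T) (hg' : IsArc P.dom P.time g' T') (hT' : T' ∈ P.dom)
    (hTT : T' ≤ T) (h0 : f (g T) = 0) (h0' : f (g' T') = 0)
    (hneg : ∀ t ∈ P.dom, t < T → f (g t) ≤ 0) :
    cosh (dist (g T) (g' T') / 2) + (cosh (dist (g T) (g' T') / 2))⁻¹ ≤ 3 ∧ T - T' ≤ 5 / 2 := by
  have hT : T ∈ P.dom := P.upward _ hT' _ hTT
  have b1 := hg.calibrated T ⟨hT, self_mem_Iic⟩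
  have b2 := hg'.calibrated T' ⟨hT', self_mem_Iic⟩
  set l := dist (g T) (g' T') with hl
  have hl0 : 0 ≤ l := dist_nonneg
  obtain ⟨m, hm1, hm2⟩ := hX.exists_midpoint (g T) (g' T')
  have k1 := hf.midpoint hm1 hm2
  rw [h0, h0', ← hl] at k1
  set Y := cosh (l / 2) with hY
  have hY1 : 1 ≤ Y := one_le_cosh _
  have hmem : T - l / 2 ∈ P.dom := P.half_mem (g T) (g' T') T b1.le (by rw [b2]; exact hTT)
  have hft : f (g (T - l / 2)) ≤ 0 := by
    rcases hl0.eq_or_lt with h | h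
    · rw [← h]; simp [h0]
    · exact hneg _ hmem (by linarith)
  set d := dist (g (T - l / 2)) m with hd
  have hYd : Y ≤ exp d := by
    have h1 : f m ≤ d := by
      have := hf.lip m (g (T - l / 2))
      rw [dist_comm] at this
      linarith
    refine le_trans ?_ (exp_le_exp.2 h1)
    have : exp (-f m) * exp (f m) = 1 := by rw [← exp_add]; simp
    have h2 := exp_pos (f m)
    norm_num at k1
    nlinarith
  have k2 := P.time_midpoint _ _ m hm1 hm2
  rw [b1, b2, ← hl, ← hY] at k2
  have k3 := P.cosh_le g T hg _ hmem (by linarith) m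
  rw [hm1, ← hl, ← hd, sub_sub_cancel, ← hY, show T - l / 2 - T = -(l / 2) by ring] at k3
  have k4 : Y + Y⁻¹ ≤ 2 * cosh d := by
    refine (add_inv_le_add_inv hY1 hYd).trans (le_of_eq ?_)
    rw [cosh_eq, exp_neg]; ring
  set S := sinh (l / 2) with hS
  set F := exp (-(l / 2)) with hF
  have hS0 : 0 ≤ S := sinh_nonneg_iff.2 (by linarith)
  have hF0 : 0 < F := exp_pos _
  have hYF : Y - S = F := cosh_sub_sinh _
  have hFY : F * (2 * Y) = 1 + F ^ 2 := by
    have : F * exp (l / 2) = 1 := by rw [hF, ← exp_add]; simp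
    rw [hY, cosh_eq]; linear_combination this
  have k5 : exp (P.time m - T) * (2 * Y) ≤ 1 + exp (T' - T) := by
    have e1 : exp (P.time m - T) * exp T = exp (P.time m) := by rw [← exp_add]; congr 1; ring
    have e2 : exp (T' - T) * exp T = exp T' := by rw [← exp_add]; congr 1; ring
    refine le_of_mul_le_mul_right ?_ (exp_pos T)
    rw [add_mul, e2, mul_right_comm, e1]
    linarith
  have hF1 : F ≤ 1 := exp_le_one_iff.2 (by linarith)
  set q := exp (T' - T) with hq
  have hq1 : q ≤ 1 := exp_le_one_iff.2 (by linarith)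
  have k6 : 2 * cosh d * Y ≤ (1 + q) * S + (1 + F ^ 2) * Y := by
    have := mul_le_mul_of_nonneg_right k5 hS0
    have := mul_le_mul_of_nonneg_right k3 (by linarith : (0 : ℝ) ≤ 2 * Y)
    have e : F * Y * (2 * Y) = (1 + F ^ 2) * Y := by rw [← hFY]; ring
    linarith
  have hYpos : 0 < Y := by linarith
  constructor
  · refine k4.trans (le_of_mul_le_mul_right (k6.trans ?_) hYpos)
    have : q * S ≤ S := mul_le_of_le_one_left hS0 hq1
    nlinarith
  -- If `T - T' > 5 / 2` then `l > 5 / 2`, so `q` and `F ^ 2` are below `0.0866`. Then `2 cosh d <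
  -- 2.18`, whereas `Y + Y⁻¹ > 2.28`.
  · by_contra hx
    push Not at hx
    have hlx : T - T' ≤ l := by rw [← b1, ← b2]; exact P.time_sub_le _ _
    obtain ⟨hE, -⟩ := exp_five_fourths_bounds
    have e0 : exp (5 / 4) ≤ exp (l / 2) := exp_le_exp.2 (by linarith)
    have hYbig : 1.7 ≤ Y := by
      rw [hY, cosh_eq]
      linarith [exp_pos (-(l / 2))]
    have e1 : exp (-(5 / 4)) ≤ 0.2942 := by
      rw [exp_neg, inv_le_comm₀ (exp_pos _) (by norm_num)]
      exact le_trans (by norm_num) hE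
    have e2 : exp (-(5 / 4)) ^ 2 ≤ 0.0866 := by
      have := exp_pos (-(5 / 4 : ℝ))
      nlinarith
    have e3 : q ≤ exp (-(5 / 4)) ^ 2 := by
      rw [← exp_nat_mul]; exact exp_le_exp.2 (by push_cast; linarith)
    have e4 : F ^ 2 ≤ exp (-(5 / 4)) ^ 2 := by
      rw [hF]
      exact pow_le_pow_left₀ (exp_pos _).le (exp_le_exp.2 (by linarith)) _
    have k7 := add_inv_le_add_inv (by norm_num) hYbig
    have k8 : 2 * cosh d ≤ 2 + q + F ^ 2 := by
      refine le_of_mul_le_mul_right (k6.trans ?_) hYpos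
      have : (1 + q) * S ≤ (1 + q) * Y :=
        mul_le_mul_of_nonneg_left (by linarith) (by linarith [exp_pos (T' - T)])
      linarith
    norm_num at k7
    linarith

/-- Two geodesics of a pencil enter the same horoball at almost the same time and place. -/
theorem entry_close (hX : IsGeodesicSpace X) {f : X → ℝ} (hf : IsHeight f)
    (hg : IsArc P.dom P.time g T) (hg' : IsArc P.dom P.time g' T') (hT : T ∈ P.dom)
    (hT' : T' ∈ P.dom) (h0 : f (g T) = 0) (h0' : f (g' T') = 0)
    (hneg : ∀ t ∈ P.dom, t < T → f (g t) ≤ 0) (hneg' : ∀ t ∈ P.dom, t < T' → f (g' t) ≤ 0) :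
    cosh (dist (g T) (g' T') / 2) + (cosh (dist (g T) (g' T') / 2))⁻¹ ≤ 3 ∧
      |T - T'| ≤ 5 / 2 := by
  rcases le_total T' T with h | h
  · obtain ⟨h1, h2⟩ := entry_aux hX hf hg hg' hT' h h0 h0' hneg
    exact ⟨h1, by rwa [abs_of_nonneg (by linarith)]⟩
  · obtain ⟨h1, h2⟩ := entry_aux hX hf hg' hg hT h h0' h0 hneg'
    exact ⟨by rwa [dist_comm], by rw [abs_of_nonpos (by linarith)]; linarith⟩

/-- `entry_close` controls the separation at the entrance and `dist_le_sinh` its decay before. Since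
`cosh (l / 2) ≤ (3 + √5) / 2`, one has `sinh (l / 2) ≤ 2.45`, and `2 * 2.45 * 3.6 ≤ 18` where `3.6`
bounds `exp (5 / 4)`. -/
theorem dist_le_of_entry (hX : IsGeodesicSpace X) {f : X → ℝ} (hf : IsHeight f)
    (hg : IsArc P.dom P.time g T) (hg' : IsArc P.dom P.time g' T') (hT : T ∈ P.dom)
    (hT' : T' ∈ P.dom) (h0 : f (g T) = 0) (h0' : f (g' T') = 0)
    (hneg : ∀ t ∈ P.dom, t < T → f (g t) ≤ 0) (hneg' : ∀ t ∈ P.dom, t < T' → f (g' t) ≤ 0)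
    (ht : t ∈ P.dom) (h : t ≤ T) (h' : t ≤ T') :
    dist (g t) (g' t) ≤ 18 * exp (t - T') := by
  obtain ⟨h1, h2⟩ := entry_close hX hf hg hg' hT hT' h0 h0' hneg hneg'
  have h3 := dist_le_sinh hg hg' ht h h'
  set l := dist (g T) (g' T')
  have hY1 := one_le_cosh (l / 2)
  have hYs := cosh_sq (l / 2)
  set Y := cosh (l / 2)
  have hS0 : 0 ≤ sinh (l / 2) := sinh_nonneg_iff.2 (by positivity)
  set S := sinh (l / 2)
  have hY3 : Y ^ 2 + 1 ≤ 3 * Y := by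
    have : (Y + Y⁻¹) * Y = Y ^ 2 + 1 := by
      have : Y ≠ 0 := by linarith
      field_simp
    rw [← this]
    exact mul_le_mul_of_nonneg_right h1 (by linarith)
  have hY4 : Y ≤ 2.62 := by nlinarith
  have hS4 : S ≤ 2.45 := by nlinarith
  have e : exp (t - (T + T') / 2) = exp ((T' - T) / 2) * exp (t - T') := by
    rw [← exp_add]; congr 1; ring
  have e2 : exp ((T' - T) / 2) ≤ 3.6 :=
    (exp_le_exp.2 (by linarith [(abs_le.1 h2).1])).trans exp_five_fourths_bounds.2
  rw [e, ← mul_assoc] at h3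
  refine h3.trans (mul_le_mul_of_nonneg_right ?_ (exp_pos _).le)
  have := exp_pos ((T' - T) / 2)
  nlinarith

end Pencil

/-! ### The pencils of a point of the space and of a point at infinity. -/

/-- The pencil of the geodesics starting from a point of the space. -/
noncomputable def pointPencil (hX : IsGeodesicCATNegOne X) (ξ : X) : Pencil X where
  dom := Ici 0
  time x := dist ξ x
  zero_mem := self_mem_Ici
  upward s hs t h := le_trans (mem_Ici.1 hs) h
  half_mem x y s hx hy := by
    have := dist_triangle_left x y ξ
    rw [mem_Ici]
    linarith
  time_sub_le x y := by
    have := dist_triangle_right ξ x y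
    linarith [dist_comm x y, dist_triangle ξ y x]
  time_midpoint x y m h1 h2 := by
    have h := hX.stewart_midpoint h1 h2 ξ
    have hc := cosh_pos (dist x y / 2)
    -- The companion of `h` with `sinh`, obtained by squaring `h` and using `cosh (dist ξ x - dist ξ
    -- y) ≤ cosh (dist x y)`. The sum of the two is the claim for exponentials.
    have hs : sinh (dist ξ m) * (2 * cosh (dist x y / 2)) ≤
        sinh (dist ξ x) + sinh (dist ξ y) := by
      have p1 := sinh_nonneg_iff.2 (dist_nonneg (x := ξ) (y := x))
      have p2 := sinh_nonneg_iff.2 (dist_nonneg (x := ξ) (y := y))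
      have h3 : cosh (dist ξ x - dist ξ y) ≤ cosh (dist x y) := by
        rw [cosh_le_cosh, abs_of_nonneg (dist_nonneg (x := x))]
        have := abs_dist_sub_le x y ξ
        rwa [dist_comm x ξ, dist_comm y ξ] at this
      rw [cosh_sub] at h3
      have h4 : cosh (dist x y) = 2 * cosh (dist x y / 2) ^ 2 - 1 := by
        have := cosh_two_mul (dist x y / 2)
        rw [mul_div_cancel₀ _ two_ne_zero] at this
        rw [this, sinh_sq]; ring
      refine (abs_le_of_sq_le_sq' ?_ (by linarith)).2
      have g1 := cosh_sq (dist ξ x)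
      have g2 := cosh_sq (dist ξ y)
      have g3 := cosh_sq (dist ξ m)
      have h5 := pow_le_pow_left₀ (by positivity) h 2
      rw [mul_pow, g3] at h5
      nlinarith
    simp only [← cosh_add_sinh]
    linarith
  cosh_le g T hg t ht h y := by
    have ht0 : (0 : ℝ) ≤ t := ht
    have hT0 : 0 ≤ T := ht0.trans h
    have g0 : ξ = g 0 := dist_eq_zero.1 (hg.calibrated 0 ⟨self_mem_Ici, hT0⟩)
    have gt := hg.calibrated t ⟨ht, h⟩
    have gT := hg.calibrated T ⟨hT0, self_mem_Iic⟩
    change dist ξ (g t) = t at gt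
    change dist ξ (g T) = T at gT
    have hs := hg.isometric t ⟨ht, h⟩ T ⟨hT0, self_mem_Iic⟩
    rw [abs_of_nonpos (by linarith)] at hs
    have hst := hX.stewart (x := ξ) (y := g T) (m := g t) (by
      rw [OnSegment, gt, gT, hs]; ring) y
    rw [gt, gT, hs, neg_sub, dist_comm y ξ, dist_comm y, dist_comm y] at hst
    rcases hT0.eq_or_lt with hz | hTpos
    · have : t = 0 := by linarith
      subst this
      rw [← hz]
      simp
    have hsT := sinh_pos_iff.2 hTpos
    have hle := sinh_le_exp_neg_mul_sinh (a := t) (b := T - t) (by linarith)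
    rw [neg_sub, add_sub_cancel] at hle
    have hbd : cosh (T - dist ξ y) ≤ cosh (dist (g T) y) := by
      rw [cosh_le_cosh, abs_of_nonneg (dist_nonneg (x := g T))]
      have := abs_dist_sub_le (g T) y ξ
      rwa [dist_comm (g T) ξ, dist_comm y ξ, gT] at this
    -- The slack in the claim grows with `cosh (dist (g T) y)`, so the worst case is `dist (g T) y =
    -- |T - dist ξ y|`. There `id1` and `id2` show that both sides agree.
    have key := mul_le_mul_of_nonneg_right hle (sub_nonneg.2 hbd)
    refine le_of_mul_le_mul_right ?_ hsT
    refine hst.trans ?_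
    have id1 : cosh (dist ξ y) * sinh (T - t) + cosh (T - dist ξ y) * sinh t =
        cosh (t - dist ξ y) * sinh T := by
      simp only [cosh_sub, sinh_sub]
      ring
    have id2 : exp (dist ξ y - T) * sinh (T - t) + exp (t - T) * cosh (T - dist ξ y) =
        cosh (t - dist ξ y) := by
      rw [sinh_eq, cosh_eq, cosh_eq]
      have e1 : exp (dist ξ y - T) * exp (T - t) = exp (-(t - dist ξ y)) := by
        rw [← exp_add]; congr 1; ring
      have e2 : exp (dist ξ y - T) * exp (-(T - t)) = exp (t - T) * exp (-(T - dist ξ y)) := by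
        rw [← exp_add, ← exp_add]; congr 1; ring
      have e3 : exp (t - T) * exp (T - dist ξ y) = exp (t - dist ξ y) := by
        rw [← exp_add]; congr 1; ring
      linear_combination e1 / 2 - e2 / 2 + e3 / 2
    linear_combination key + id1 - sinh T * id2
  exists_arc x := by
    obtain ⟨γ, g0, g1, hg⟩ := hX.geodesic ξ x
    refine ⟨γ, ⟨hg, fun t ht => ?_⟩, g1⟩
    have := hg 0 ⟨le_rfl, dist_nonneg⟩ t ht
    rwa [g0, zero_sub, abs_neg, abs_of_nonneg ht.1] at this

theorem Ray.ext_zero (σ : Ray X) : σ.ext 0 = σ 0 := by simpa using σ.ext_coe 0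

theorem Ray.isArc (σ : Ray X) (T : ℝ) : IsArc (Ici 0) (fun x => dist (σ 0) x) σ.ext T where
  isometric s hs t ht := σ.ext_isometric s hs.1 t ht.1
  calibrated t ht := by
    have := σ.ext_isometric 0 self_mem_Ici t ht.1
    rwa [σ.ext_zero, zero_sub, abs_neg, abs_of_nonneg ht.1] at this

theorem Ray.abs_bus_sub_le (ρ : Ray X) (x y : X) : |ρ.bus x - ρ.bus y| ≤ dist x y :=
  abs_sub_le_iff.2 ⟨ρ.bus_sub_le x y, by rw [dist_comm]; exact ρ.bus_sub_le y x⟩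

theorem Ray.bus_zero (ρ : Ray X) : ρ.bus (ρ 0) = 0 := by
  have := ρ.bus_apply le_rfl
  rwa [ρ.ext_zero, neg_zero] at this

/-- Every point of the space is the origin of a geodesic ray with prescribed endpoint. -/
theorem exists_ray [CompleteSpace X] (hX : IsGeodesicCATNegOne X) (x : X) (ρ : Ray X) :
    ∃ σ : Ray X, σ 0 = x ∧ σ ≈ ρ := by
  set D := dist x (ρ 0)
  have harc := fun n : ℕ => (pointPencil hX x).exists_arc (ρ.ext n)
  choose g hg hgρ using harc
  change ∀ n : ℕ, IsArc (Ici 0) (fun y => dist x y) (g n) (dist x (ρ.ext n)) at hg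
  change ∀ n : ℕ, g n (dist x (ρ.ext n)) = ρ.ext n at hgρ
  have hL : ∀ n : ℕ, (n : ℝ) - D ≤ dist x (ρ.ext n) := fun n => by
    have := ρ.bounded_below x n n.cast_nonneg
    linarith
  have hlim : ∀ t : ℝ, 0 ≤ t → ∃ p, Tendsto (fun n => g n t) atTop (𝓝 p) := by
    intro t ht
    obtain ⟨N, hN⟩ := exists_nat_ge (t + D)
    -- Up to the shift by `N`, the far ends are `m - n` apart and at distances at least `n - D` and
    -- `m - D` from `x`; contraction leaves the exponent `t - n + D`.
    have hc : CauchySeq fun n => g (n + N) t := by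
      refine cauchySeq_of_le_tendsto_0' (fun n : ℕ => exp (t - ((n + N : ℕ) : ℝ) + D)) ?_ ?_
      · intro n m hnm
        have h1 := hL (n + N)
        have h2 := hL (m + N)
        have hnm' : ((n + N : ℕ) : ℝ) ≤ ((m + N : ℕ) : ℝ) := by
          exact_mod_cast Nat.add_le_add_right hnm N
        have hNn : (N : ℝ) ≤ ((n + N : ℕ) : ℝ) := by exact_mod_cast Nat.le_add_left N n
        refine (Pencil.dist_le_exp (P := pointPencil hX x) (hg (n + N)) (hg (m + N)) ht
          (by linarith) (by linarith)).trans (exp_le_exp.2 ?_)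
        rw [hgρ, hgρ, ρ.ext_isometric _ (mem_Ici.2 (Nat.cast_nonneg _)) _
          (mem_Ici.2 (Nat.cast_nonneg _)),
          abs_of_nonpos (by linarith)]
        linarith
      · have h1 : Tendsto (fun n : ℕ => ((n + N : ℕ) : ℝ)) atTop atTop :=
          tendsto_natCast_atTop_atTop.comp (tendsto_add_atTop_nat N)
        have h2 := (tendsto_exp_neg_atTop_nhds_zero.comp h1).const_mul (exp (t + D))
        rw [mul_zero] at h2
        refine h2.congr fun n => ?_
        rw [Function.comp, ← exp_add]
        congr 1
        ring
    obtain ⟨p, hp⟩ := cauchySeq_tendsto_of_complete hc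
    exact ⟨p, (tendsto_add_atTop_iff_nat N).1 hp⟩
  have : Nonempty X := ⟨x⟩
  choose! G hG using hlim
  have hev : ∀ t : ℝ, ∀ᶠ n : ℕ in atTop, t ≤ dist x (ρ.ext n) := fun t => by
    obtain ⟨N, hN⟩ := exists_nat_ge (t + D)
    filter_upwards [eventually_ge_atTop N] with n hn
    have h1 := hL n
    have : (N : ℝ) ≤ n := by exact_mod_cast hn
    linarith
  have hGi : ∀ s ∈ Ici (0 : ℝ), ∀ t ∈ Ici (0 : ℝ), dist (G s) (G t) = |s - t| := by
    intro s hs t ht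
    refine tendsto_nhds_unique ((hG s hs).dist (hG t ht)) (tendsto_const_nhds.congr' ?_)
    filter_upwards [hev s, hev t] with n h1 h2
    exact ((hg n).isometric s ⟨hs, h1⟩ t ⟨ht, h2⟩).symm
  have hG0 : G 0 = x := by
    refine tendsto_nhds_unique (hG 0 le_rfl) (tendsto_const_nhds.congr fun n => ?_)
    exact dist_eq_zero.1 ((hg n).calibrated 0 ⟨self_mem_Ici, dist_nonneg (x := x)⟩)
  refine ⟨Ray.ofIsometric G 0 hGi, by simpa using hG0, Ray.equiv_of_bus hX fun t ht => ?_⟩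
  -- On each segment `-ρ.bus` is at least the minimum of its values at the ends. The bound passes to
  -- the limit ray, along which `-ρ.bus` must then grow at unit speed.
  have hH := Ray.isHeight_neg_bus hX ρ
  have h1 := hH.unit_speed (g := G) (a := 0) (C := min (-ρ.bus x) 0) hGi (fun t ht => ?_) ht
  · simp only [hG0, sub_zero] at h1
    simp only [Ray.ext, Ray.ofIsometric_apply, zero_add, Real.coe_toNNReal t ht, NNReal.coe_zero,
      hG0]
    linarith
  · have h2 := (hH.continuous.tendsto _).comp (hG t ht)
    refine ge_of_tendsto h2 ?_
    filter_upwards [hev t] with n hn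
    have hx0 : g n 0 = x :=
      (dist_eq_zero.1 ((hg n).calibrated 0 ⟨self_mem_Ici, dist_nonneg (x := x)⟩)).symm
    refine hH.le_of_onSegment (x := x) (y := ρ.ext n) ?_ (min_le_left _ _) ?_
    · have := onSegment_of_isometric (hg n).isometric (r := 0) (s := t)
        (t := dist x (ρ.ext n)) ⟨self_mem_Ici, dist_nonneg (x := x)⟩ ⟨ht, hn⟩
        ⟨dist_nonneg (x := x), self_mem_Iic⟩ ht hn
      rwa [hx0, hgρ] at this
    · rw [ρ.bus_apply n.cast_nonneg, neg_neg]
      exact (min_le_right _ _).trans n.cast_nonneg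

theorem isArc_reverse (hX : IsGeodesicCATNegOne X) {ρ σ : Ray X} (h : σ ≈ ρ) :
    IsArc univ ρ.bus (fun t => σ.ext (ρ.bus (σ 0) - t)) (ρ.bus (σ 0)) where
  isometric s hs t ht := by
    have hs' : s ≤ ρ.bus (σ 0) := hs.2
    have ht' : t ≤ ρ.bus (σ 0) := ht.2
    rw [σ.ext_isometric _ (sub_nonneg.2 hs') _ (sub_nonneg.2 ht'), abs_sub_comm]
    congr 1
    ring
  calibrated t ht := by
    have ht' : t ≤ ρ.bus (σ 0) := ht.2
    rw [Ray.bus_of_equiv hX h (sub_nonneg.2 ht')]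
    ring

/-- The ray going back from a point of a calibrated geodesic to its origin at infinity. -/
def backRay {ρ : Ray X} {g : ℝ → X} {T : ℝ} (hg : IsArc univ ρ.bus g T) : Ray X :=
  Ray.ofIsometric (fun t => g (T - t)) 0 fun s hs t ht => by
    rw [hg.isometric _ ⟨mem_univ _, by simpa using hs⟩ _ ⟨mem_univ _, by simpa using ht⟩,
      abs_sub_comm]
    congr 1
    ring

theorem backRay_ext {ρ : Ray X} {g : ℝ → X} {T : ℝ} (hg : IsArc univ ρ.bus g T) {t : ℝ}
    (ht : 0 ≤ t) : (backRay hg).ext t = g (T - t) := by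
  simp [backRay, Ray.ext, Real.coe_toNNReal t ht]

theorem backRay_bus {ρ : Ray X} {g : ℝ → X} {T : ℝ} (hg : IsArc univ ρ.bus g T) {t : ℝ}
    (ht : 0 ≤ t) : ρ.bus ((backRay hg).ext t) = ρ.bus (backRay hg 0) - t := by
  rw [← Ray.ext_zero, backRay_ext hg ht, backRay_ext hg le_rfl,
    hg.calibrated _ ⟨mem_univ _, by simpa using ht⟩, sub_zero,
    hg.calibrated _ ⟨mem_univ _, self_mem_Iic⟩]

/-- The pencil of the geodesics starting from the endpoint of a ray. -/
noncomputable def boundaryPencil [CompleteSpace X] (hX : IsGeodesicCATNegOne X) (ρ : Ray X) :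
    Pencil X where
  dom := univ
  time := ρ.bus
  zero_mem := mem_univ _
  upward _ _ _ _ := mem_univ _
  half_mem _ _ _ _ _ := mem_univ _
  time_sub_le := ρ.bus_sub_le
  time_midpoint x y m h1 h2 := by
    have := (Ray.isHeight_neg_bus hX ρ).midpoint h1 h2
    simpa only [neg_neg] using this
  cosh_le g T hg t _ h y := by
    set σ := backRay hg
    have hb := fun t ht => backRay_bus hg (t := t) ht
    have hσ0 : σ 0 = g T := by rw [← Ray.ext_zero, backRay_ext hg le_rfl, sub_zero]
    have hbus := Ray.bus_eq_of_bus hX hb y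
    rw [hσ0, hg.calibrated T ⟨mem_univ _, self_mem_Iic⟩] at hbus
    -- The inequality is Stewart's on `[σ 0, σ.ext n]`, multiplied by `2 exp (-n)`, as `n` tends to
    -- infinity.
    have l1 := σ.tendsto_cosh y
    rw [hbus] at l1
    have l2 : Tendsto (fun n : ℝ => exp (-n) * exp (-n)) atTop (𝓝 (0 * 0)) :=
      tendsto_exp_neg_atTop_nhds_zero.mul tendsto_exp_neg_atTop_nhds_zero
    rw [zero_mul] at l2
    have l3 : ∀ a : ℝ, Tendsto (fun n : ℝ => 2 * exp (-n) * sinh (n - a)) atTop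
        (𝓝 (exp (-a))) := fun a => by
      have := (l2.const_mul (exp a)).const_sub (exp (-a))
      rw [mul_zero, sub_zero] at this
      refine this.congr fun n => ?_
      have e : exp (-n) * exp n = 1 := by rw [← exp_add]; simp
      rw [sinh_eq, neg_sub, sub_eq_add_neg n, exp_add, sub_eq_add_neg a, exp_add]
      linear_combination (-exp (-a)) * e
    have l4 := l3 0
    simp only [sub_zero, neg_zero, exp_zero] at l4
    have lL := l4.const_mul (cosh (dist (g t) y))
    have lR := ((l3 (T - t)).const_mul (cosh (dist (g T) y))).add (l1.mul_const (sinh (T - t)))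
    have := le_of_tendsto_of_tendsto lL lR ?_
    · rw [mul_one, neg_sub] at this
      linarith
    · filter_upwards [eventually_ge_atTop (T - t), eventually_ge_atTop 0] with n hn hn0
      have hTt : 0 ≤ T - t := by linarith
      have hseg := onSegment_of_isometric σ.ext_isometric (r := 0) (s := T - t) (t := n)
        self_mem_Ici hTt hn0 hTt hn
      have hst := hX.stewart hseg y
      rw [σ.ext_isometric 0 self_mem_Ici n hn0, σ.ext_isometric _ hTt n hn0,
        σ.ext_isometric 0 self_mem_Ici _ hTt, zero_sub, abs_neg, abs_of_nonneg hn0, zero_sub,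
        abs_neg, abs_of_nonneg hTt, abs_of_nonpos (by linarith), neg_sub, σ.ext_zero, hσ0,
        backRay_ext hg hTt, sub_sub_cancel, dist_comm y, dist_comm y] at hst
      have := mul_le_mul_of_nonneg_left hst (mul_pos two_pos (exp_pos (-n))).le
      linarith
  exists_arc x := by
    obtain ⟨σ, h0, hσ⟩ := exists_ray hX x ρ
    have h := isArc_reverse hX hσ
    rw [h0] at h
    exact ⟨_, h, by rw [sub_self, σ.ext_zero, h0]⟩

/-! ### Asymptotic rays and the topology of the boundary. -/

theorem Ray.eq_of_equiv (hX : IsGeodesicCATNegOne X) {σ τ : Ray X} (h : σ ≈ τ) (h0 : σ 0 = τ 0)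
    {t : ℝ} (ht : 0 ≤ t) : σ.ext t = τ.ext t := by
  obtain ⟨C, hC⟩ := h
  have h1 : ∀ T, t ≤ T → dist (σ.ext t) (τ.ext t) ≤ exp (C / 2 + t) * exp (-T) := by
    intro T hT
    have ha := σ.isArc T
    rw [h0] at ha
    refine (Pencil.dist_le_exp (P := pointPencil hX (τ 0)) ha (τ.isArc T) ht hT hT).trans ?_
    rw [← exp_add]
    refine exp_le_exp.2 ?_
    have : dist (σ.ext T) (τ.ext T) ≤ C := hC T.toNNReal
    linarith
  have h2 := tendsto_exp_neg_atTop_nhds_zero.const_mul (exp (C / 2 + t))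
  rw [mul_zero] at h2
  exact dist_le_zero.1 (ge_of_tendsto h2 (eventually_atTop.2 ⟨t, h1⟩))

/-- If rays from `ρ 0` ending at `η` followed `ρ` within `1` on arbitrarily long intervals, they
would all coincide, and this single ray would be asymptotic to `ρ`. -/
theorem Boundary.isClosed_singleton (hX : IsGeodesicCATNegOne X) (η : Boundary X) :
    IsClosed ({η} : Set (Boundary X)) := by
  constructor
  intro ρ hρ
  by_contra hcon
  push Not at hcon
  have hσ := fun n : ℝ≥0 => hcon n 1 one_pos
  choose σ h0 hσ hσ' using hσ
  apply hρ
  have heta : ∀ n, (σ n).endpoint = η := fun n => by simpa using hσ' n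
  rw [mem_singleton_iff, ← heta 0]
  refine Quotient.sound ⟨1, fun t => ?_⟩
  have heq : σ t ≈ σ 0 := Quotient.exact ((heta t).trans (heta 0).symm)
  have := Ray.eq_of_equiv hX heq ((h0 t).trans (h0 0).symm) t.2
  change (σ t).ext ((t : ℝ≥0) : ℝ) = (σ 0).ext ((t : ℝ≥0) : ℝ) at this
  rw [Ray.ext_coe, Ray.ext_coe] at this
  rw [← this]
  exact (hσ t t le_rfl).le

/-- Read backwards, both rays are arcs of the pencil of their common endpoint. The additional `D`
pays for the offset between their Busemann times. -/
theorem Ray.dist_le_of_equiv [CompleteSpace X] (hX : IsGeodesicCATNegOne X) {τ σ : Ray X}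
    (h : τ ≈ σ) {s : ℝ} (hs : dist (τ 0) (σ 0) ≤ s) :
    dist (τ.ext s) (σ.ext s) ≤ exp (dist (τ 0) (σ 0)) + dist (τ 0) (σ 0) := by
  set D := dist (τ 0) (σ 0) with hD
  have hD0 : 0 ≤ D := dist_nonneg
  have h1 := isArc_reverse hX h
  have h2 := isArc_reverse hX (Setoid.refl σ)
  have hb := σ.abs_bus_sub_le (τ 0) (σ 0)
  rw [σ.bus_zero, sub_zero, ← hD] at hb
  rw [σ.bus_zero] at h2
  set T := σ.bus (τ 0)
  obtain ⟨hb1, hb2⟩ := abs_le.1 hb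
  have hs0 : 0 ≤ s := hD0.trans hs
  have h3 := Pencil.dist_le_exp (P := boundaryPencil hX σ) h1 h2 (mem_univ (T - s)) (by linarith)
    (by linarith)
  simp only [sub_self, sub_sub_cancel, τ.ext_zero, σ.ext_zero, ← hD] at h3
  have h4 := σ.ext_isometric (0 - (T - s)) (by rw [mem_Ici]; linarith) s hs0
  have h5 := dist_triangle (τ.ext s) (σ.ext (0 - (T - s))) (σ.ext s)
  rw [h4, show 0 - (T - s) - s = -T by ring, abs_neg] at h5
  have h6 : exp (D / 2 + (T - s) - (T + 0) / 2) ≤ exp D := exp_le_exp.2 (by linarith)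
  linarith

/-- Rays with endpoint in a dense set are dense. -/
theorem exists_ray_near [CompleteSpace X] (hX : IsGeodesicCATNegOne X) {Y : Set (Boundary X)}
    (hY : Dense Y) (ρ : Ray X) {R : ℝ} (hR : 0 ≤ R) :
    ∃ σ : Ray X, σ 0 = ρ 0 ∧ σ.endpoint ∈ Y ∧ dist (σ.ext R) (ρ.ext R) < 1 := by
  set U : Set (Boundary X) :=
    {η | ∃ σ : Ray X, σ 0 = ρ 0 ∧ σ.endpoint = η ∧ dist (σ.ext R) (ρ.ext R) < 1} with hU
  -- If `σ'` follows `ρ'` up to time `R'`, the ray `τ` from `ρ 0` asymptotic to `σ'` is at time `R'`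
  -- within `C'` of `σ`, with `C'` independent of `R'`. For large `R'`, contraction towards `ρ 0`
  -- makes `τ` and `σ` as close as needed at time `R`.
  have hopen : IsOpen U := by
    rintro ρ' ⟨σ, hσ0, hσe, hσR⟩
    obtain ⟨C, hC⟩ : σ ≈ ρ' := Quotient.exact hσe
    set D := dist (ρ 0) (ρ' 0)
    have hD0 : 0 ≤ D := dist_nonneg
    set C' := exp D + D + 1 + C
    obtain ⟨R₁, hR₁⟩ := ((tendsto_exp_neg_atTop_nhds_zero.const_mul (exp (C' / 2 + R))).eventually
      (gt_mem_nhds (show exp (C' / 2 + R) * 0 < 1 - dist (σ.ext R) (ρ.ext R) by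
        rw [mul_zero]; linarith))).exists_forall_of_atTop
    set R' := max (max R₁ R) D
    have hR'0 : 0 ≤ R' := hD0.trans (le_max_right _ _)
    refine ⟨R'.toNNReal, 1, one_pos, fun σ' h0 hσ' => ?_⟩
    obtain ⟨τ, hτ0, hτ⟩ := exists_ray hX (ρ 0) σ'
    refine ⟨τ, hτ0, Quotient.sound hτ, ?_⟩
    have k1 := Ray.dist_le_of_equiv hX hτ (s := R') (by
      rw [hτ0, h0]; exact le_max_right _ _)
    rw [hτ0, h0] at k1
    have k2 : dist (ρ'.ext R') (σ'.ext R') < 1 := hσ' R'.toNNReal le_rfl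
    have k3 : dist (σ.ext R') (ρ'.ext R') ≤ C := hC R'.toNNReal
    have k4 : dist (τ.ext R') (σ.ext R') ≤ C' := by
      have := dist_triangle4 (τ.ext R') (σ'.ext R') (ρ'.ext R') (σ.ext R')
      rw [dist_comm (σ'.ext R'), dist_comm (ρ'.ext R') (σ.ext R')] at this
      linarith
    have a1 := τ.isArc R'
    have a2 := σ.isArc R'
    rw [hτ0] at a1
    rw [hσ0] at a2
    have hRR : R ≤ R' := (le_max_right _ _).trans (le_max_left _ _)
    have k5 := Pencil.dist_le_exp (P := pointPencil hX (ρ 0)) a1 a2 hR hRR hRR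
    have k6 := hR₁ R' ((le_max_left _ _).trans (le_max_left _ _))
    rw [← exp_add] at k6
    have k7 := exp_le_exp.2 (show dist (τ.ext R') (σ.ext R') / 2 + R - (R' + R') / 2 ≤
      C' / 2 + R + -R' by linarith)
    have k8 := dist_triangle (τ.ext R) (σ.ext R) (ρ.ext R)
    linarith
  obtain ⟨η, ⟨σ, h1, h2, h3⟩, hη⟩ := hY.inter_open_nonempty U hopen
    ⟨ρ.endpoint, ρ, rfl, rfl, by simp⟩
  exact ⟨σ, h1, h2 ▸ hη, h3⟩

/-! ### Packings of horoballs and heights along geodesics. -/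

/-- Families of height functions of horoballs with disjoint interiors. -/
structure IsPacking {A : Type*} (f : A → X → ℝ) : Prop where
  height : ∀ α, IsHeight (f α)
  disjoint : ∀ α β, α ≠ β → ∀ y, 0 < f α y → f β y ≤ 0
  deep : ∀ α x, ∃ y, dist x y ≤ 1 ∧ f α x + 1 ≤ f α y

/-- Each such horoball has a point of height at least `1` in the ball of radius `r + 1`. Such points
in distinct horoballs are at distance at least `1`, so balls of radius `1 / 2` covering the compact
ball separate them. -/
theorem IsPacking.finite_meet [ProperSpace X] {A : Type*} {f : A → X → ℝ} (hf : IsPacking f)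
    (x : X) (r : ℝ) : {α | ∃ y, dist x y ≤ r ∧ 0 ≤ f α y}.Finite := by
  have h1 : ∀ α ∈ {α | ∃ y, dist x y ≤ r ∧ 0 ≤ f α y}, ∃ y, dist x y ≤ r + 1 ∧ 1 ≤ f α y := by
    rintro α ⟨y, hy, h0⟩
    obtain ⟨z, hz, h2⟩ := hf.deep α y
    exact ⟨z, by linarith [dist_triangle x y z], by linarith⟩
  have : Nonempty X := ⟨x⟩
  choose! y hy1 hy2 using h1
  obtain ⟨t, -, htf, ht⟩ := finite_cover_balls_of_compact (isCompact_closedBall x (r + 1))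
    (show (0 : ℝ) < 1 / 2 by norm_num)
  have h2 : ∀ α ∈ {α | ∃ y, dist x y ≤ r ∧ 0 ≤ f α y}, ∃ z ∈ t, dist (y α) z < 1 / 2 := by
    intro α hα
    have := ht (Metric.mem_closedBall'.2 (hy1 α hα))
    simpa using this
  choose! z hz1 hz2 using h2
  refine Set.Finite.of_injOn (f := z) hz1 ?_ htf
  intro α hα β hβ hαβ
  by_contra hne
  have h3 := dist_triangle_right (y α) (y β) (z α)
  have h4 := hz2 α hα
  have h5 := hz2 β hβ
  rw [← hαβ] at h5
  have h6 := (hf.height α).lip (y α) (y β)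
  have h7 := hy2 α hα
  have h8 := hy2 β hβ
  have := hf.disjoint α β hne (y β) (by linarith)
  linarith

namespace IsHeight

variable {f : X → ℝ} {g : ℝ → X} {D : Set ℝ}

theorem min_le (hf : IsHeight f) (hg : ∀ s ∈ D, ∀ t ∈ D, dist (g s) (g t) = |s - t|) {r s t c : ℝ}
    (hr : r ∈ D) (hs : s ∈ D) (ht : t ∈ D) (h1 : r ≤ s) (h2 : s ≤ t) (hcr : c ≤ f (g r))
    (hct : c ≤ f (g t)) : c ≤ f (g s) :=
  hf.le_of_onSegment (onSegment_of_isometric hg hr hs ht h1 h2) hcr hct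

/-- Quasi-concavity: a height that has dropped along a geodesic does not recover. -/
theorem le_of_lt (hf : IsHeight f) (hg : ∀ s ∈ D, ∀ t ∈ D, dist (g s) (g t) = |s - t|) {r s t : ℝ}
    (hr : r ∈ D) (hs : s ∈ D) (ht : t ∈ D) (h1 : r ≤ s) (h2 : s ≤ t) (h : f (g s) < f (g r)) :
    f (g t) ≤ f (g s) := by
  by_contra hcon
  push Not at hcon
  have := hf.min_le hg hr hs ht h1 h2 (min_le_left (f (g r)) (f (g t))) (min_le_right _ _)
  exact absurd this (not_le.2 (lt_min h hcon))

theorem le_add (hf : IsHeight f) (hg : ∀ s ∈ D, ∀ t ∈ D, dist (g s) (g t) = |s - t|) {s t : ℝ}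
    (hs : s ∈ D) (ht : t ∈ D) : f (g s) ≤ f (g t) + |s - t| := by
  have := hf.lip (g s) (g t)
  rw [hg s hs t ht] at this
  linarith

theorem tendsto_atBot_of_forall_exists (hf : IsHeight f) {a : ℝ}
    (hg : ∀ s ∈ Ici a, ∀ t ∈ Ici a, dist (g s) (g t) = |s - t|)
    (h : ∀ L, ∃ t ≥ a, f (g t) < L) : Tendsto (fun t => f (g t)) atTop atBot := by
  refine Filter.tendsto_atBot.2 fun L => ?_
  obtain ⟨t₁, ht₁, hlt⟩ := h (min L (f (g a)))
  filter_upwards [eventually_ge_atTop t₁] with t ht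
  exact (hf.le_of_lt hg self_mem_Ici ht₁ (ht₁.trans ht) ht₁ ht
    (hlt.trans_le (min_le_right _ _))).trans (hlt.le.trans (min_le_left _ _))

/-- A height function which is bounded above along a geodesic ray tends to `-∞` along it. -/
theorem tendsto_atBot (hf : IsHeight f) {a C : ℝ}
    (hg : ∀ s ∈ Ici a, ∀ t ∈ Ici a, dist (g s) (g t) = |s - t|) (hC : ∀ t ≥ a, f (g t) ≤ C) :
    Tendsto (fun t => f (g t)) atTop atBot := by
  refine hf.tendsto_atBot_of_forall_exists hg fun L => ?_
  by_contra hcon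
  push Not at hcon
  have := hf.unit_speed hg hcon (t := max a (a + (C - f (g a)) + 1)) (le_max_left _ _)
  have h2 := hC _ (le_max_left a (a + (C - f (g a)) + 1))
  have h3 := le_max_right a (a + (C - f (g a)) + 1)
  linarith

/-- The first time at which a geodesic meets a horoball. -/
theorem exists_entry (hf : IsHeight f) (hD : ∀ s ∈ D, ∀ t, s ≤ t → t ∈ D) {T t₀ : ℝ}
    (hg : ∀ s ∈ D ∩ Iic T, ∀ t ∈ D ∩ Iic T, dist (g s) (g t) = |s - t|) (ht₀ : t₀ ∈ D)
    (hT : t₀ ≤ T) (h0 : f (g t₀) < 0) (h1 : 0 ≤ f (g T)) :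
    ∃ τ ∈ D, t₀ < τ ∧ τ ≤ T ∧ f (g τ) = 0 ∧ ∀ t ∈ D, t < τ → f (g t) < 0 := by
  have hmem : ∀ t ∈ Icc t₀ T, t ∈ D ∩ Iic T := fun t ht => ⟨hD _ ht₀ _ ht.1, ht.2⟩
  have hcont : ContinuousOn (fun t => f (g t)) (Icc t₀ T) := by
    refine hf.continuous.comp_continuousOn ?_
    have : LipschitzOnWith 1 g (Icc t₀ T) := LipschitzOnWith.of_dist_le_mul fun s hs t ht => by
      rw [hg s (hmem s hs) t (hmem t ht), Real.dist_eq]; simp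
    exact this.continuousOn
  have hcl : IsCompact (Icc t₀ T ∩ (fun t => f (g t)) ⁻¹' Ici 0) :=
    isCompact_Icc.of_isClosed_subset (hcont.preimage_isClosed_of_isClosed isClosed_Icc isClosed_Ici)
      inter_subset_left
  obtain ⟨τ, ⟨hτ, hτ0⟩, hmin⟩ := hcl.exists_isLeast ⟨T, ⟨hT, le_rfl⟩, h1⟩
  have hτ0' : 0 ≤ f (g τ) := hτ0
  have hlt : t₀ < τ := lt_of_le_of_ne hτ.1 (by rintro rfl; linarith)
  have hneg : ∀ t ∈ Icc t₀ T, t < τ → f (g t) < 0 := by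
    intro t ht htτ
    by_contra hcon
    exact absurd (hmin ⟨ht, not_lt.1 hcon⟩) (not_le.2 htτ)
  refine ⟨τ, hD _ ht₀ _ hlt.le, hlt, hτ.2, le_antisymm ?_ hτ0', fun t ht htτ => ?_⟩
  · refine le_of_forall_pos_le_add fun ε hε => ?_
    set t := max t₀ (τ - ε)
    have ht : t ∈ Icc t₀ T := ⟨le_max_left _ _, max_le hT (by linarith [hτ.2])⟩
    have htτ : t < τ := max_lt hlt (by linarith)
    have h2 := hneg t ht htτ
    have h3 := hf.le_add hg (hmem τ hτ) (hmem t ht)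
    rw [abs_of_pos (by linarith)] at h3
    linarith [le_max_right t₀ (τ - ε)]
  · rcases le_or_gt t₀ t with h | h
    · exact hneg t ⟨h, htτ.le.trans hτ.2⟩ htτ
    · by_contra hcon
      have := hf.min_le hg ⟨ht, mem_Iic.2 (h.le.trans hT)⟩ (hmem t₀ ⟨le_rfl, hT⟩) (hmem τ hτ) h.le
        hlt.le (not_lt.1 hcon) hτ0'
      linarith

end IsHeight

/-! ### From one prescribed geodesic to the next. -/

/-- The data of a packing of horoballs, of a pencil of geodesics, and of the properties needed to
construct geodesics with prescribed asymptotic penetration. The set `S` consists of the horoballs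
which do not contain the origin of the pencil. -/
structure PenetrationData (X A : Type*) [MetricSpace X] where
  P : Pencil X
  f : A → X → ℝ
  S : Set A
  h : ℝ
  c' : ℝ
  K : ℝ
  K_nonneg : 0 ≤ K
  c'_nonneg : 0 ≤ c'
  -- `5.28 = 3 * 1.76`, where `1.76` is a lower bound for `c₁Inf`.
  h_ge : c' + 5.28 ≤ h
  geodesic : IsGeodesicSpace X
  packing : IsPacking f
  finite_compl : Sᶜ.Finite
  blocked : ∀ α ∉ S, ∀ g, P.IsGeod g → ∃ t ∈ P.dom, t ≤ 0 ∧ 0 ≤ f α (g t)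
  out : ∀ α ∈ S, ∀ g, ∀ T ∈ P.dom, IsArc P.dom P.time g T → ∃ t ∈ P.dom, t ≤ T ∧ f α (g t) < 0
  dense : ∀ g, P.IsGeod g → ∀ R ≥ 0, ∃ σ : ℝ → X,
    (∀ s ∈ Ici (0 : ℝ), ∀ t ∈ Ici (0 : ℝ), dist (σ s) (σ t) = |s - t|) ∧ σ 0 = g 0 ∧
    dist (σ R) (g R) < 1 ∧ ∀ R', ∃ t ≥ R', ∃ α x, 0 ≤ f α x ∧ dist (σ t) x < K + 1
  prescribe : ∀ α ∈ S, ∃ g s, P.IsGeod g ∧ s ∈ P.dom ∧ f α (g s) = 0 ∧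
    (∀ t ∈ P.dom, t < s → f α (g t) < 0) ∧ (∀ t ∈ P.dom, f α (g t) ≤ h / 2) ∧
    (∀ ε > 0, ∃ t ∈ P.dom, h / 2 - ε < f α (g t)) ∧ ∀ β ≠ α, ∀ t, s < t → f β (g t) ≤ c' / 2

namespace PenetrationData

variable {A : Type*} (𝒟 : PenetrationData X A)

/-- A geodesic of the pencil with penetration height exactly `h` in the horoball `α`, which it
enters at time `s`, and small penetration afterwards in the other horoballs. -/
structure IsPrescribed (g : ℝ → X) (s : ℝ) (α : A) : Prop where
  geod : 𝒟.P.IsGeod g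
  mem : s ∈ 𝒟.P.dom
  mem_S : α ∈ 𝒟.S
  eq_zero : 𝒟.f α (g s) = 0
  before : ∀ t ∈ 𝒟.P.dom, t < s → 𝒟.f α (g t) < 0
  le : ∀ t ∈ 𝒟.P.dom, 𝒟.f α (g t) ≤ 𝒟.h / 2
  exists_gt : ∀ ε > 0, ∃ t ∈ 𝒟.P.dom, 𝒟.h / 2 - ε < 𝒟.f α (g t)
  after : ∀ β ≠ α, ∀ t, s < t → 𝒟.f β (g t) ≤ 𝒟.c' / 2

variable {𝒟}

theorem exists_isPrescribed {α : A} (hα : α ∈ 𝒟.S) : ∃ g s, 𝒟.IsPrescribed g s α := by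
  obtain ⟨g, s, h1, h2, h3, h4, h5, h6, h7⟩ := 𝒟.prescribe α hα
  exact ⟨g, s, h1, h2, hα, h3, h4, h5, h6, h7⟩

theorem mem_of_nonneg {t : ℝ} (ht : 0 ≤ t) : t ∈ 𝒟.P.dom := 𝒟.P.upward 0 𝒟.P.zero_mem t ht

theorem height (𝒟 : PenetrationData X A) (α : A) : IsHeight (𝒟.f α) := 𝒟.packing.height α

theorem exp_three_ge : (10 : ℝ) ≤ exp 3 := by
  have h1 := exp_one_gt_d9
  have h3 : exp 3 = exp 1 ^ 3 := by rw [← exp_nat_mul]; norm_num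
  rw [h3]
  calc (10 : ℝ) ≤ 2.7 ^ 3 := by norm_num
    _ ≤ exp 1 ^ 3 := pow_le_pow_left₀ (by norm_num) (by linarith) _

theorem exp_four_ge : (50 : ℝ) ≤ exp 4 := by
  have h1 := exp_one_gt_d9
  have h3 : exp 4 = exp 1 ^ 4 := by rw [← exp_nat_mul]; norm_num
  rw [h3]
  calc (50 : ℝ) ≤ 2.7 ^ 4 := by norm_num
    _ ≤ exp 1 ^ 4 := pow_le_pow_left₀ (by norm_num) (by linarith) _

theorem exp_neg_half_le (𝒟 : PenetrationData X A) : exp (-(𝒟.h / 2)) ≤ 0.072 := by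
  have h1 : 2.64 ≤ 𝒟.h / 2 := by linarith [𝒟.h_ge, 𝒟.c'_nonneg]
  have h2 : (13.9 : ℝ) ≤ exp 2.64 := by
    refine le_of_pow_le_pow_left₀ (n := 25) (by norm_num) (exp_pos _).le ?_
    have : exp 2.64 ^ 25 = exp 1 ^ 66 := by rw [← exp_nat_mul, ← exp_nat_mul]; norm_num
    rw [this]
    calc (13.9 : ℝ) ^ 25 ≤ 2.718 ^ 66 := by norm_num
      _ ≤ exp 1 ^ 66 := pow_le_pow_left₀ (by norm_num) (by linarith [exp_one_gt_d9]) _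
  rw [exp_neg, inv_le_comm₀ (exp_pos _) (by norm_num)]
  exact le_trans (by norm_num) (h2.trans (exp_le_exp.2 h1))

namespace IsPrescribed

variable {g : ℝ → X} {s : ℝ} {α : A}

theorem exists_pos (hg : 𝒟.IsPrescribed g s α) : ∃ t ∈ 𝒟.P.dom, s < t ∧ 0 < 𝒟.f α (g t) := by
  obtain ⟨t, ht, h⟩ := hg.exists_gt (𝒟.h / 2) (by linarith [𝒟.h_ge, 𝒟.c'_nonneg])
  rw [sub_self] at h
  refine ⟨t, ht, ?_, h⟩
  by_contra hcon
  rcases (not_lt.1 hcon).eq_or_lt with h' | h'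
  · rw [h', hg.eq_zero] at h; exact lt_irrefl _ h
  · exact lt_asymm h (hg.before t ht h')

/-- Immediately after `s` the height in `α` is positive, so the one in `β` is not; it remains to
approach `s`. -/
theorem nonpos (hg : 𝒟.IsPrescribed g s α) {β : A} (hβ : β ≠ α) : 𝒟.f β (g s) ≤ 0 := by
  obtain ⟨t, ht, hst, hpos⟩ := hg.exists_pos
  refine le_of_forall_pos_le_add fun ε hε => ?_
  set r := min (s + ε) t
  have hsr : s < r := lt_min (by linarith) hst
  have hr : r ∈ 𝒟.P.dom := 𝒟.P.upward s hg.mem r hsr.le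
  have h1 : 0 < 𝒟.f α (g r) := by
    refine (𝒟.height α).pos_of_onSegment (onSegment_of_isometric hg.geod.isometric hg.mem hr ht
      hsr.le (min_le_right _ _)) hg.eq_zero.ge hpos fun h => ?_
    have := hg.geod.isometric s hg.mem r hr
    rw [h, dist_self, eq_comm, abs_eq_zero] at this
    linarith
  have h2 := 𝒟.packing.disjoint α β hβ.symm _ h1
  have h3 := (𝒟.height β).le_add hg.geod.isometric hg.mem hr
  rw [abs_of_neg (by linarith)] at h3
  linarith [min_le_left (s + ε) t]

theorem tendsto_atBot (hg : 𝒟.IsPrescribed g s α) (β : A) :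
    Tendsto (fun t => 𝒟.f β (g t)) atTop atBot := by
  refine (𝒟.height β).tendsto_atBot (a := s + 1) (C := max (𝒟.h / 2) (𝒟.c' / 2)) ?_ ?_
  · exact fun t ht r hr => hg.geod.isometric t (𝒟.P.upward s hg.mem t (by
      have : s + 1 ≤ t := ht
      linarith)) r (𝒟.P.upward s hg.mem r (by
      have : s + 1 ≤ r := hr
      linarith))
  · intro t ht
    have ht' : s < t := by linarith
    by_cases h : β = α
    · subst h
      exact (hg.le t (𝒟.P.upward s hg.mem t ht'.le)).trans (le_max_left _ _)
    · exact (hg.after β h t ht').trans (le_max_right _ _)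

end IsPrescribed

/-- A prescribed geodesic which is close to `γ` for a long time. -/
def IsCandidate (𝒟 : PenetrationData X A) (γ : ℝ → X) (T R : ℝ) (g : ℝ → X) (σ : ℝ) (δ : A) :
    Prop :=
  -- The constant `20` reproduces itself: passing to the prescribed geodesic of a horoball
  -- penetrated late on the way, with entrance time `σ'`, costs `18 exp (t - σ')`, and the old error
  -- is then at most `2 exp (t - σ')`. Times up to `σ - h / 2` suffice, because a height above `h /
  -- 2` outside `δ` can only be reached there.
  𝒟.IsPrescribed g σ δ ∧ T ≤ σ ∧ ∀ t ∈ 𝒟.P.dom, t ≤ R → t ≤ σ - 𝒟.h / 2 →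
    dist (g t) (γ t) ≤ 0.1 * exp (t - R) + 20 * exp (t - σ)

/-- Since `γ` drifts away from every horoball, a ray leaving it late and ending in the dense set can
only come near a horoball `δ` outside any given finite set. The arc from the origin of the pencil to
`δ` follows `γ`, and the prescribed geodesic of `δ` follows this arc. -/
theorem exists_isCandidate [ProperSpace X] {γ : ℝ → X} {s : ℝ} {α : A}
    (hγ : 𝒟.IsPrescribed γ s α) {T R : ℝ} (hT : 0 ≤ T) (hTR : T + 5 ≤ R) :
    ∃ g σ δ, 𝒟.IsCandidate γ T R g σ δ := by
  have hK := 𝒟.K_nonneg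
  set K := 𝒟.K
  set E : Set A := 𝒟.Sᶜ ∪ {δ | ∃ y, dist (γ 0) y ≤ T + 6 ∧ 0 ≤ 𝒟.f δ y} with hE
  have hEfin : E.Finite := 𝒟.finite_compl.union (𝒟.packing.finite_meet _ _)
  -- The ray passes within `1` of `γ R₁`. The second bound shows that its height has dropped, hence
  -- stays down; the first keeps it below `-(K + 3)`, so no point of such a horoball is within `K +
  -- 1` later.
  have hev : ∀ᶠ t in atTop, ∀ δ ∈ E, 𝒟.f δ (γ t) < min (-(K + 4)) (𝒟.f δ (γ 0) - 1) :=
    (eventually_all_finite hEfin).2 fun δ _ =>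
      (hγ.tendsto_atBot δ).eventually (eventually_lt_atBot _)
  obtain ⟨R₁, hR₁, hdeep⟩ := ((eventually_ge_atTop (R + K + 5)).and hev).exists
  obtain ⟨ρ, hρ, hρ0, hρR, hρ'⟩ := 𝒟.dense γ hγ.geod R₁ (by linarith)
  obtain ⟨t, ht, δ, x, hx0, hx⟩ := hρ' R₁
  have hR₁0 : 0 ≤ R₁ := by linarith
  have ht0 : 0 ≤ t := by linarith
  have hρt : dist (γ 0) (ρ t) = t := by
    rw [← hρ0, hρ 0 self_mem_Ici t ht0, zero_sub, abs_neg, abs_of_nonneg ht0]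
  have hρRt : dist (ρ R₁) (ρ t) = t - R₁ := by
    rw [hρ R₁ hR₁0 t ht0, abs_of_nonpos (by linarith), neg_sub]
  have hδE : δ ∉ E := by
    intro hδ
    have h1 := hdeep δ hδ
    have h2 := h1.trans_le (min_le_left _ _)
    have h3 := h1.trans_le (min_le_right _ _)
    have h4 := (𝒟.height δ).lip (ρ R₁) (γ R₁)
    have h5 := (𝒟.height δ).le_of_lt hρ self_mem_Ici hR₁0 ht0 hR₁0 ht (by rw [hρ0]; linarith)
    have h6 := (𝒟.height δ).lip x (ρ t)
    rw [dist_comm] at h6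
    linarith
  have hδS : δ ∈ 𝒟.S := by
    by_contra h
    exact hδE (Or.inl h)
  have hmeet : ∀ y, 0 ≤ 𝒟.f δ y → T + 6 < dist (γ 0) y := by
    intro y hy
    by_contra h
    exact hδE (Or.inr ⟨y, not_lt.1 h, hy⟩)
  -- The ray starts from `γ 0`, not from the origin of the pencil. As it passes near `γ R₁`, the
  -- last term of `cosh_le` is negligible, and the first must account for `cosh t`.
  have hbt : t - 1 ≤ 𝒟.P.time (ρ t) := by
    have h1 := 𝒟.P.cosh_le γ R₁ (hγ.geod R₁) 0 𝒟.P.zero_mem hR₁0 (ρ t)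
    rw [hρt] at h1
    have h2 : cosh (dist (γ R₁) (ρ t)) ≤ exp (t - R₁ + 1) := by
      refine (cosh_le_exp_of_nonneg dist_nonneg).trans (exp_le_exp.2 ?_)
      have := dist_triangle (γ R₁) (ρ R₁) (ρ t)
      rw [dist_comm (γ R₁) (ρ R₁)] at this
      linarith
    have h3 : exp (𝒟.P.time (ρ t) - R₁) * sinh (R₁ - 0) ≤ exp (𝒟.P.time (ρ t)) / 2 := by
      have e : exp (𝒟.P.time (ρ t) - R₁) * exp R₁ = exp (𝒟.P.time (ρ t)) := by
        rw [← exp_add]; congr 1; ring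
      rw [sub_zero, sinh_eq, ← e]
      have := mul_pos (exp_pos (𝒟.P.time (ρ t) - R₁)) (exp_pos (-R₁))
      linarith
    have h4 : exp (0 - R₁) * exp (t - R₁ + 1) ≤ exp t / 10 := by
      have e3 : exp (-3) ≤ 1 / 10 := by
        rw [exp_neg, inv_le_comm₀ (exp_pos _) (by norm_num)]
        exact le_trans (by norm_num) exp_three_ge
      calc exp (0 - R₁) * exp (t - R₁ + 1) ≤ exp t * exp (-3) := by
            rw [← exp_add, ← exp_add]; exact exp_le_exp.2 (by linarith)
        _ ≤ exp t / 10 := by nlinarith [exp_pos t]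
    have h5 := mul_le_mul_of_nonneg_left h2 (exp_pos (0 - R₁)).le
    have h6 := exp_le_two_mul_cosh t
    have e1 : exp (t - 1) * 2 ≤ exp t := by
      have e : exp (t - 1) * exp 1 = exp t := by rw [← exp_add]; congr 1; ring
      nlinarith [exp_one_gt_d9, exp_pos (t - 1)]
    exact exp_le_exp.1 (by linarith [exp_pos t])
  have hbx : t - K - 2 ≤ 𝒟.P.time x := by
    have := 𝒟.P.time_sub_le (ρ t) x
    linarith
  have hdx : dist x (γ R₁) ≤ t - R₁ + K + 2 := by
    have := dist_triangle4 x (ρ t) (ρ R₁) (γ R₁)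
    rw [dist_comm x (ρ t), dist_comm (ρ t) (ρ R₁)] at this
    linarith
  obtain ⟨g₀, hg₀, hg₀x⟩ := 𝒟.P.exists_arc x
  set T₀ := 𝒟.P.time x with hT₀
  have hclose : ∀ τ ∈ 𝒟.P.dom, τ ≤ R → dist (g₀ τ) (γ τ) ≤ 0.1 * exp (τ - R) := by
    intro τ hτ hτR
    refine (Pencil.dist_le_exp hg₀ (hγ.geod R₁) hτ (by linarith) (by linarith)).trans ?_
    rw [hg₀x]
    have e3 : exp (-3) ≤ 0.1 := by
      rw [exp_neg, inv_le_comm₀ (exp_pos _) (by norm_num)]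
      exact le_trans (by norm_num) exp_three_ge
    calc _ ≤ exp (-3) * exp (τ - R) := by
          rw [← exp_add]; exact exp_le_exp.2 (by linarith)
      _ ≤ _ := mul_le_mul_of_nonneg_right e3 (exp_pos _).le
  have hT₀0 : 0 ≤ T₀ := by linarith
  obtain ⟨t₀, ht₀, ht₀T, hneg⟩ := 𝒟.out δ hδS g₀ T₀ (mem_of_nonneg hT₀0) hg₀
  obtain ⟨τ, hτ, -, hτT, hτ0, hbefore⟩ := (𝒟.height δ).exists_entry 𝒟.P.upward hg₀.isometric ht₀
    ht₀T hneg (by rwa [hg₀x])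
  -- Otherwise the arc meets `δ` at a time of `[0, T + 5]`, where it is within `1` of `γ`, hence
  -- within `T + 6` of `γ 0`.
  have hτbig : T + 5 < τ := by
    by_contra hcon
    push Not at hcon
    have h0 : (0 : ℝ) ∈ 𝒟.P.dom := 𝒟.P.zero_mem
    have hm : max τ 0 ∈ 𝒟.P.dom := mem_of_nonneg (le_max_right _ _)
    have hmR : max τ 0 ≤ T + 5 := max_le hcon (by linarith)
    have h1 : 0 ≤ 𝒟.f δ (g₀ (max τ 0)) :=
      (𝒟.height δ).min_le hg₀.isometric ⟨hτ, hτT⟩ ⟨hm, mem_Iic.2 (max_le hτT hT₀0)⟩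
        ⟨mem_of_nonneg hT₀0, self_mem_Iic⟩ (le_max_left _ _) (max_le hτT hT₀0) hτ0.ge
        (by rwa [hg₀x])
    have h2 := hmeet _ h1
    have h3 := hclose _ hm (hmR.trans hTR)
    have h4 := hγ.geod.isometric 0 h0 _ hm
    rw [zero_sub, abs_neg, abs_of_nonneg (le_max_right _ _)] at h4
    have h5 := dist_triangle (γ 0) (γ (max τ 0)) (g₀ (max τ 0))
    rw [dist_comm (γ (max τ 0))] at h5
    have h6 : exp (max τ 0 - R) ≤ 1 := exp_le_one_iff.2 (by linarith)
    linarith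
  obtain ⟨g, σ, hg⟩ := exists_isPrescribed hδS
  have hbef : ∀ t ∈ 𝒟.P.dom, t < σ → 𝒟.f δ (g t) ≤ 0 := fun t ht h => (hg.before t ht h).le
  have hbef' : ∀ t ∈ 𝒟.P.dom, t < τ → 𝒟.f δ (g₀ t) ≤ 0 := fun t ht h => (hbefore t ht h).le
  have hg₀τ := Pencil.IsArc.mono hg₀ hτT
  have hστ := abs_le.1 (Pencil.entry_close 𝒟.geodesic (𝒟.height δ) hg₀τ (hg.geod σ) hτ hg.mem hτ0
    hg.eq_zero hbef' hbef).2
  have hh := 𝒟.h_ge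
  have hc' := 𝒟.c'_nonneg
  refine ⟨g, σ, δ, hg, by linarith, fun r hr hrR hrσ => ?_⟩
  have h1 := Pencil.dist_le_of_entry 𝒟.geodesic (𝒟.height δ) hg₀τ (hg.geod σ) hτ hg.mem hτ0
    hg.eq_zero hbef' hbef hr (by linarith) (by linarith)
  have h2 := hclose r hr hrR
  have h3 := dist_triangle_left (g r) (γ r) (g₀ r)
  linarith [exp_pos (r - σ)]

/-- Given a prescribed geodesic, there is another one which is close to it for a long time, and
whose penetration heights between the two prescribed horoballs are at most `h`. -/
theorem exists_next [ProperSpace X] {γ : ℝ → X} {s : ℝ} {α : A} (hγ : 𝒟.IsPrescribed γ s α)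
    (T : ℝ) : ∃ g σ δ, 𝒟.IsPrescribed g σ δ ∧ T ≤ σ ∧
      (∀ t ∈ 𝒟.P.dom, t ≤ T → dist (g t) (γ t) ≤ exp (t - T)) ∧
      ∀ β, β ≠ α → β ≠ δ → ∀ t ∈ 𝒟.P.dom, s ≤ t → 𝒟.f β (g t) ≤ 𝒟.h / 2 := by
  have hh := 𝒟.h_ge
  have hc' := 𝒟.c'_nonneg
  have hhalf := 𝒟.exp_neg_half_le
  set h := 𝒟.h
  set T₂ := max T (max s 0) + h + 4 with hT₂
  set R := T₂ + 5 + h / 2 + 4 with hR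
  have hTT₂ : T + h + 4 ≤ T₂ := by linarith [le_max_left T (max s 0)]
  have hsT₂ : s + h + 4 ≤ T₂ := by
    linarith [le_max_right T (max s 0), le_max_left s 0]
  have h0T₂ : 0 ≤ T₂ := by
    linarith [le_max_right T (max s 0), le_max_right s 0]
  set V : Set ℝ := {σ | ∃ g δ, 𝒟.IsCandidate γ T₂ R g σ δ} with hV
  have hVne : V.Nonempty := by
    obtain ⟨g, σ, δ, hg⟩ := exists_isCandidate hγ h0T₂ (R := R) (by linarith)
    exact ⟨σ, g, δ, hg⟩
  have hVb : BddBelow V := ⟨T₂, by rintro σ ⟨g, δ, hg⟩; exact hg.2.1⟩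
  -- An almost minimal entrance time is enough, since the competitor found below enters earlier by
  -- at least `1`.
  obtain ⟨σ, ⟨g, δ, hg, hσ, hclose⟩, hσmin⟩ := exists_lt_of_csInf_lt hVne
    (lt_add_one (sInf V))
  refine ⟨g, σ, δ, hg, by linarith, fun t ht htT => ?_, fun β hβα hβδ t₁ ht₁ hst₁ => ?_⟩
  · refine (hclose t ht (by linarith) (by linarith)).trans ?_
    have e1 : exp (t - R) ≤ exp (t - T) * exp (-4) := by
      rw [← exp_add]; exact exp_le_exp.2 (by linarith)
    have e2 : exp (t - σ) ≤ exp (t - T) * exp (-4) := by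
      rw [← exp_add]; exact exp_le_exp.2 (by linarith)
    have e3 : exp (-4) ≤ 1 / 50 := by
      rw [exp_neg, inv_le_comm₀ (exp_pos _) (by norm_num)]
      exact le_trans (by norm_num) exp_four_ge
    nlinarith [exp_pos (t - T)]
  by_contra hcon
  push Not at hcon
  have hfβ := 𝒟.height β
  have hgi := hg.geod.isometric
  have hβσ := hg.nonpos hβδ
  have ht₁σ : t₁ ≤ σ := by
    by_contra hlt
    have := hg.after β hβδ t₁ (not_le.1 hlt)
    linarith
  have ht₁σ' : t₁ ≤ σ - h / 2 := by
    have := hfβ.le_add hgi ht₁ hg.mem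
    rw [abs_of_nonpos (by linarith)] at this
    linarith
  by_cases hearly : ∃ tb ∈ 𝒟.P.dom, tb ≤ T₂ + 5 ∧ 0 ≤ 𝒟.f β (g tb)
  · obtain ⟨tb, htb, htbT, htb0⟩ := hearly
    -- A time at which `g` is still close to `γ`. If `t₁` exceeds `R`, the delay `h / 2 + 4` between
    -- `tb` and `R` lets convexity keep the height at `R` within `0.1` of `h / 2`.
    set w := min t₁ R with hw
    have hsR : s ≤ R := by linarith
    have hsw : s ≤ w := le_min hst₁ hsR
    have hwmem : w ∈ 𝒟.P.dom := 𝒟.P.upward s hγ.mem w hsw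
    have hfw : h / 2 - 0.1 ≤ 𝒟.f β (g w) := by
      rcases le_total t₁ R with hle | hle
      · rw [hw, min_eq_left hle]; linarith
      · rw [hw, min_eq_right hle]
        have hRmem : R ∈ 𝒟.P.dom := 𝒟.P.upward s hγ.mem R hsR
        have htbR : tb ≤ R := by linarith
        have hst := hfβ.stewart _ _ _ (onSegment_of_isometric hgi htb hRmem ht₁ htbR hle)
        rw [hgi _ htb _ ht₁, hgi _ hRmem _ ht₁, hgi _ htb _ hRmem, abs_of_nonpos (by linarith),
          abs_of_nonpos (by linarith), abs_of_nonpos (by linarith), neg_sub, neg_sub, neg_sub] at hst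
        have hspos : 0 < sinh (t₁ - tb) := sinh_pos_iff.2 (by linarith)
        have k1 := sinh_le_exp_neg_mul_sinh (a := t₁ - R) (b := R - tb) (by linarith)
        rw [sub_add_sub_cancel] at k1
        have k2 : sinh (R - tb) ≤ sinh (t₁ - tb) := sinh_le_sinh.2 (by linarith)
        have k3 : exp (-𝒟.f β (g tb)) ≤ 1 := exp_le_one_iff.2 (by linarith)
        have k4 : exp (-𝒟.f β (g t₁)) ≤ exp (-(h / 2)) := exp_le_exp.2 (by linarith)
        have k5 : 0 ≤ sinh (t₁ - R) := sinh_nonneg_iff.2 (by linarith)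
        have k6 : 0 ≤ sinh (R - tb) := sinh_nonneg_iff.2 (by linarith)
        have k7 : exp (-𝒟.f β (g R)) ≤ exp (-(R - tb)) + exp (-(h / 2)) := by
          refine le_of_mul_le_mul_right ?_ hspos
          have m1 := mul_le_mul_of_nonneg_right k3 k5
          have m2 := mul_le_mul_of_nonneg_right k4 k6
          have m3 := mul_le_mul_of_nonneg_left k2 (exp_pos (-(h / 2))).le
          linarith
        have k8 : exp (-(R - tb)) ≤ exp (-(h / 2)) * exp (-4) := by
          rw [← exp_add]; exact exp_le_exp.2 (by linarith)
        have e3 : exp (-4) ≤ 1 / 50 := by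
          rw [exp_neg, inv_le_comm₀ (exp_pos _) (by norm_num)]
          exact le_trans (by norm_num) exp_four_ge
        have e4 : 1 + 1 / 50 ≤ exp 0.1 := le_trans (by norm_num) (add_one_le_exp 0.1)
        have k9 : exp (-𝒟.f β (g R)) ≤ exp (-(h / 2)) * exp 0.1 := by
          nlinarith [exp_pos (-(h / 2))]
        rw [← exp_add] at k9
        linarith [exp_le_exp.1 k9]
    have hdw := hclose w hwmem (min_le_right _ _) ((min_le_left _ _).trans ht₁σ')
    have e1 : exp (w - R) ≤ 1 := exp_le_one_iff.2 (by linarith [min_le_right t₁ R])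
    have e2 : exp (w - σ) ≤ exp (-(h / 2)) := exp_le_exp.2 (by linarith [min_le_left t₁ R])
    have hfγ := hfβ.lip (g w) (γ w)
    -- The losses add up to at most `0.1 + 0.1 + 20 * 0.072 = 1.64`, while `(h - c') / 2 ≥ 2.64`.
    have hγw : 𝒟.c' / 2 < 𝒟.f β (γ w) := by linarith
    rcases hsw.eq_or_lt with heq | hlt
    · rw [← heq] at hγw
      linarith [hγ.nonpos hβα]
    · exact absurd (hγ.after β hβα w hlt) (not_le.2 hγw)
  · push Not at hearly
    have hβS : β ∈ 𝒟.S := by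
      by_contra hns
      obtain ⟨t, ht, ht0, hft⟩ := 𝒟.blocked β hns g hg.geod
      linarith [hearly t ht (by linarith)]
    have h5mem : T₂ + 5 ∈ 𝒟.P.dom := mem_of_nonneg (by linarith)
    have ht₁big : T₂ + 5 ≤ t₁ := by
      by_contra hlt
      linarith [hearly t₁ ht₁ (not_le.1 hlt).le]
    obtain ⟨tb, htb, htb1, htb2, htb0, hbefore⟩ := hfβ.exists_entry 𝒟.P.upward
      (hg.geod t₁).isometric h5mem ht₁big (hearly _ h5mem le_rfl) (by linarith)
    obtain ⟨g', σ', hg'⟩ := exists_isPrescribed hβS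
    have hbef : ∀ t ∈ 𝒟.P.dom, t < σ' → 𝒟.f β (g' t) ≤ 0 := fun t ht h => (hg'.before t ht h).le
    have hbef' : ∀ t ∈ 𝒟.P.dom, t < tb → 𝒟.f β (g t) ≤ 0 := fun t ht h => (hbefore t ht h).le
    have hστ := abs_le.1 (Pencil.entry_close 𝒟.geodesic hfβ (hg.geod tb) (hg'.geod σ') htb hg'.mem
      htb0 hg'.eq_zero hbef' hbef).2
    have hrise : tb ≤ t₁ - h / 2 := by
      have := hfβ.le_add hgi ht₁ htb
      rw [abs_of_nonneg (by linarith)] at this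
      linarith
    -- `σ' ≤ tb + 5 / 2 ≤ t₁ - h / 2 + 5 / 2 ≤ σ - h + 5 / 2`, and `h ≥ 5.28`.
    have hgap : σ' + 1 ≤ σ := by linarith
    have hcand : 𝒟.IsCandidate γ T₂ R g' σ' β := by
      refine ⟨hg', by linarith, fun t ht htR htσ => ?_⟩
      have h1 := Pencil.dist_le_of_entry 𝒟.geodesic hfβ (hg.geod tb) (hg'.geod σ') htb hg'.mem
        htb0 hg'.eq_zero hbef' hbef ht (by linarith) (by linarith)
      have h2 := hclose t ht htR (by linarith)
      have h3 := dist_triangle_left (g' t) (γ t) (g t)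
      have h4 : exp (t - σ) ≤ 0.1 * exp (t - σ') := by
        have e : exp (t - σ) ≤ exp (t - σ') * (exp (-(h / 2)) ^ 2 * exp (5 / 4) ^ 2) := by
          rw [← exp_nat_mul, ← exp_nat_mul, ← exp_add, ← exp_add]
          exact exp_le_exp.2 (by push_cast; linarith)
        have e1 : exp (-(h / 2)) ^ 2 ≤ 0.072 ^ 2 := pow_le_pow_left₀ (exp_pos _).le hhalf 2
        have e2 : exp (5 / 4) ^ 2 ≤ 3.6 ^ 2 :=
          pow_le_pow_left₀ (exp_pos _).le Pencil.exp_five_fourths_bounds.2 2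
        have e3 : exp (-(h / 2)) ^ 2 * exp (5 / 4) ^ 2 ≤ 0.072 ^ 2 * 3.6 ^ 2 :=
          mul_le_mul e1 e2 (by positivity) (by norm_num)
        have e4 := mul_le_mul_of_nonneg_left e3 (exp_pos (t - σ')).le
        norm_num at e4
        linarith [exp_pos (t - σ')]
      linarith [exp_pos (t - σ')]
    have := csInf_le hVb (show σ' ∈ V from ⟨g', β, hcand⟩)
    linarith

end PenetrationData

/-! ### The limit of the prescribed geodesics. -/

namespace PenetrationData

variable {A : Type*} {𝒟 : PenetrationData X A}

/-- A sequence of prescribed geodesics approximating each other for longer and longer times. -/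
structure IsApproximation (𝒟 : PenetrationData X A) (γ : ℕ → ℝ → X) (s : ℕ → ℝ) (α : ℕ → A) :
    Prop where
  prescribed : ∀ k, 𝒟.IsPrescribed (γ k) (s k) (α k)
  le_succ : ∀ k : ℕ, s k + 𝒟.h + 20 + k ≤ s (k + 1)
  dist_le : ∀ k : ℕ, ∀ t ∈ 𝒟.P.dom, t ≤ s k + 𝒟.h + 20 + k →
    dist (γ (k + 1) t) (γ k t) ≤ exp (t - (s k + 𝒟.h + 20 + k))
  control : ∀ k, ∀ β, β ≠ α k → β ≠ α (k + 1) → ∀ t ∈ 𝒟.P.dom, s k ≤ t →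
    𝒟.f β (γ (k + 1) t) ≤ 𝒟.h / 2

theorem exists_isApproximation [ProperSpace X] (hS : 𝒟.S.Nonempty) :
    ∃ γ s α, 𝒟.IsApproximation γ s α := by
  obtain ⟨α₀, hα₀⟩ := hS
  obtain ⟨γ₀, s₀, h₀⟩ := exists_isPrescribed hα₀
  let Q := {q : (ℝ → X) × ℝ × A // 𝒟.IsPrescribed q.1 q.2.1 q.2.2}
  have hnext : ∀ (k : ℕ) (q : Q), ∃ q' : Q, q.1.2.1 + 𝒟.h + 20 + k ≤ q'.1.2.1 ∧
      (∀ t ∈ 𝒟.P.dom, t ≤ q.1.2.1 + 𝒟.h + 20 + k →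
        dist (q'.1.1 t) (q.1.1 t) ≤ exp (t - (q.1.2.1 + 𝒟.h + 20 + k))) ∧
      ∀ β, β ≠ q.1.2.2 → β ≠ q'.1.2.2 → ∀ t ∈ 𝒟.P.dom, q.1.2.1 ≤ t →
        𝒟.f β (q'.1.1 t) ≤ 𝒟.h / 2 := by
    intro k q
    obtain ⟨g, σ, δ, h1, h2, h3, h4⟩ := exists_next q.2 (q.1.2.1 + 𝒟.h + 20 + k)
    exact ⟨⟨(g, σ, δ), h1⟩, h2, h3, h4⟩
  choose N hN1 hN2 hN3 using hnext
  let u : ℕ → Q := fun n => Nat.rec ⟨(γ₀, s₀, α₀), h₀⟩ (fun k q => N k q) n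
  exact ⟨fun k => (u k).1.1, fun k => (u k).1.2.1, fun k => (u k).1.2.2, fun k => (u k).2,
    fun k => hN1 k (u k), fun k => hN2 k (u k), fun k => hN3 k (u k)⟩

/-- The properties of the limit geodesic: its penetration heights in the horoballs `α k` tend to
`h`, and its other late penetration heights are asymptotically at most `h`. -/
structure IsLimit (𝒟 : PenetrationData X A) (g : ℝ → X) (s : ℕ → ℝ) (α : ℕ → A) : Prop where
  geod : 𝒟.P.IsGeod g
  tendsto : Tendsto s atTop atTop
  exists_ge : ∀ k : ℕ, ∃ t ∈ 𝒟.P.dom, 𝒟.h / 2 - exp (-k) ≤ 𝒟.f (α k) (g t)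
  entry : ∀ k : ℕ, ∃ τ ∈ 𝒟.P.dom, s k - 3 ≤ τ ∧ 𝒟.f (α k) (g τ) = 0 ∧
    ∀ t ∈ 𝒟.P.dom, t < τ → 𝒟.f (α k) (g t) < 0
  le : ∀ k : ℕ, ∀ β, ∀ τ ∈ 𝒟.P.dom, s k ≤ τ → 0 ≤ 𝒟.f β (g τ) →
    (∀ t ∈ 𝒟.P.dom, t < τ → 𝒟.f β (g t) < 0) → ∀ t ∈ 𝒟.P.dom,
    𝒟.f β (g t) ≤ 𝒟.h / 2 + exp (-k)

namespace IsApproximation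

variable {γ : ℕ → ℝ → X} {s : ℕ → ℝ} {α : ℕ → A}

theorem h_pos (𝒟 : PenetrationData X A) : 0 < 𝒟.h := by
  linarith [𝒟.h_ge, 𝒟.c'_nonneg]

theorem add_le (hγ : 𝒟.IsApproximation γ s α) (k n : ℕ) : s k + n ≤ s (k + n) := by
  induction n with
  | zero => simp
  | succ n ih =>
    have h1 := hγ.le_succ (k + n)
    have h2 := h_pos 𝒟
    have h3 : (0 : ℝ) ≤ ((k + n : ℕ) : ℝ) := Nat.cast_nonneg _
    rw [← add_assoc]
    push_cast at *
    linarith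

theorem mono (hγ : 𝒟.IsApproximation γ s α) : Monotone s := by
  refine monotone_nat_of_le_succ fun k => ?_
  have := hγ.add_le k 1
  push_cast at this
  linarith

theorem tendsto (hγ : 𝒟.IsApproximation γ s α) : Tendsto s atTop atTop := by
  refine tendsto_atTop_mono (fun n => ?_)
    (tendsto_atTop_add_const_left atTop (s 0) tendsto_natCast_atTop_atTop)
  simpa using hγ.add_le 0 n

theorem dist_geometric (hγ : 𝒟.IsApproximation γ s α) (k : ℕ) {t : ℝ} (ht : t ∈ 𝒟.P.dom)
    (htk : t ≤ s k + 𝒟.h + 20 + k) (n : ℕ) :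
    dist (γ (k + n) t) (γ (k + (n + 1)) t) ≤ exp (t - (s k + 𝒟.h + 20 + k)) * (1 / 2) ^ n := by
  have h1 := hγ.add_le k n
  have hn : (0 : ℝ) ≤ n := n.cast_nonneg
  have h2 := hγ.dist_le (k + n) t ht (by push_cast; linarith)
  rw [dist_comm, ← add_assoc]
  refine h2.trans ?_
  have h3 : exp (-1) ≤ 1 / 2 := by
    rw [exp_neg, inv_le_comm₀ (exp_pos _) (by norm_num)]
    linarith [exp_one_gt_d9]
  calc exp (t - (s (k + n) + 𝒟.h + 20 + (k + n : ℕ)))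
      ≤ exp (t - (s k + 𝒟.h + 20 + k)) * exp (-1) ^ n := by
        rw [← exp_nat_mul, ← exp_add]
        refine exp_le_exp.2 ?_
        push_cast
        linarith
    _ ≤ _ := mul_le_mul_of_nonneg_left (pow_le_pow_left₀ (exp_pos _).le h3 n) (exp_pos _).le

theorem exists_limit [CompleteSpace X] (hγ : 𝒟.IsApproximation γ s α) :
    ∃ g, 𝒟.P.IsGeod g ∧ ∀ k : ℕ, ∀ t ∈ 𝒟.P.dom, t ≤ s k + 𝒟.h + 15 →
      dist (g t) (γ k t) ≤ exp (-k) / 10 := by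
  have h1 : ∀ t ∈ 𝒟.P.dom, ∃ p, Tendsto (fun n => γ n t) atTop (𝓝 p) := by
    intro t ht
    obtain ⟨k, hk⟩ := (hγ.tendsto.eventually_ge_atTop t).exists
    have := cauchySeq_of_le_geometric _ _ (by norm_num : (1 / 2 : ℝ) < 1)
      (hγ.dist_geometric k ht (by linarith [h_pos 𝒟, (Nat.cast_nonneg k : (0 : ℝ) ≤ k)]))
    obtain ⟨p, hp⟩ := cauchySeq_tendsto_of_complete this
    refine ⟨p, (tendsto_add_atTop_iff_nat k).1 (hp.congr fun n => ?_)⟩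
    rw [add_comm]
  have : Nonempty X := ⟨γ 0 0⟩
  choose! g hg using h1
  have hiso : ∀ r ∈ 𝒟.P.dom, ∀ t ∈ 𝒟.P.dom, dist (g r) (g t) = |r - t| := fun r hr t ht =>
    tendsto_nhds_unique ((hg r hr).dist (hg t ht)) (tendsto_const_nhds.congr fun n =>
      ((hγ.prescribed n).geod.isometric r hr t ht).symm)
  have hcont : Continuous 𝒟.P.time :=
    (LipschitzWith.of_le_add (f := 𝒟.P.time) fun x y => by
      linarith [𝒟.P.time_sub_le x y]).continuous
  have htime : ∀ t ∈ 𝒟.P.dom, 𝒟.P.time (g t) = t := fun t ht =>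
    tendsto_nhds_unique ((hcont.tendsto _).comp (hg t ht)) (tendsto_const_nhds.congr fun n =>
      ((hγ.prescribed n).geod.time_eq ht).symm)
  refine ⟨g, fun T => ⟨fun r hr t ht => hiso r hr.1 t ht.1, fun t ht => htime t ht.1⟩,
    fun k t ht htk => ?_⟩
  have hlim : Tendsto (fun n => γ (k + n) t) atTop (𝓝 (g t)) := by
    refine ((tendsto_add_atTop_iff_nat k).2 (hg t ht)).congr fun n => ?_
    rw [add_comm]
  have hk0 : (0 : ℝ) ≤ k := k.cast_nonneg
  have h2 := dist_le_of_le_geometric_of_tendsto₀ _ _ (by norm_num : (1 / 2 : ℝ) < 1)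
    (hγ.dist_geometric k ht (by linarith)) hlim
  rw [add_zero, dist_comm] at h2
  refine h2.trans ?_
  have e3 : exp (-4) ≤ 1 / 50 := by
    rw [exp_neg, inv_le_comm₀ (exp_pos _) (by norm_num)]
    exact le_trans (by norm_num) exp_four_ge
  have e4 : exp (t - (s k + 𝒟.h + 20 + k)) ≤ exp (-k) * exp (-4) := by
    rw [← exp_add]; exact exp_le_exp.2 (by linarith)
  have := exp_pos (-(k : ℝ))
  norm_num
  nlinarith

/-- Up to time `s k + h + 15` the limit follows `γ k`, and by then it has left `α k` for good, so
its height there is that of `γ k` up to a small error. In a horoball outside the sequence, the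
height at a time between `s k` and `s (k + 1)` is compared with that of `γ (k + 1)`, to which
`control` applies. -/
theorem isLimit (hγ : 𝒟.IsApproximation γ s α) {g : ℝ → X} (hg : 𝒟.P.IsGeod g)
    (hclose : ∀ k : ℕ, ∀ t ∈ 𝒟.P.dom, t ≤ s k + 𝒟.h + 15 →
      dist (g t) (γ k t) ≤ exp (-k) / 10) : 𝒟.IsLimit g s α := by
  have hh := 𝒟.h_ge
  have hc' := 𝒟.c'_nonneg
  have hek : ∀ k : ℕ, exp (-(k : ℝ)) ≤ 1 := fun k =>
    exp_le_one_iff.2 (neg_nonpos.2 k.cast_nonneg)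
  have hek0 : ∀ k : ℕ, 0 < exp (-(k : ℝ)) := fun k => exp_pos _
  have hmem : ∀ k, s k + 𝒟.h + 15 ∈ 𝒟.P.dom := fun k =>
    𝒟.P.upward _ (hγ.prescribed k).mem _ (by linarith)
  -- Otherwise convexity would give a height above `h / 2` halfway, because `exp (15 / 2) > 1 + 3`.
  have hexit : ∀ k, 𝒟.f (α k) (γ k (s k + 𝒟.h + 15)) < -1 := by
    intro k
    have hp := hγ.prescribed k
    by_contra hcon
    push Not at hcon
    have hm : s k + (𝒟.h + 15) / 2 ∈ 𝒟.P.dom := 𝒟.P.upward _ hp.mem _ (by linarith)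
    have hd : dist (γ k (s k)) (γ k (s k + 𝒟.h + 15)) = 𝒟.h + 15 := by
      rw [hp.geod.isometric _ hp.mem _ (hmem k), abs_of_nonpos (by linarith)]; ring
    have h1 := (𝒟.height (α k)).midpoint (x := γ k (s k)) (y := γ k (s k + 𝒟.h + 15))
      (m := γ k (s k + (𝒟.h + 15) / 2))
      (by rw [hd, hp.geod.isometric _ hp.mem _ hm, abs_of_nonpos (by linarith)]; ring)
      (by rw [hd, hp.geod.isometric _ hm _ (hmem k), abs_of_nonpos (by linarith)]; ring)
    rw [hd, hp.eq_zero, neg_zero, exp_zero] at h1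
    have h2 : exp (-𝒟.f (α k) (γ k (s k + 𝒟.h + 15))) ≤ 3 :=
      (exp_le_exp.2 (by linarith)).trans (exp_one_lt_d9.le.trans (by norm_num))
    have h3 := exp_le_two_mul_cosh ((𝒟.h + 15) / 2)
    have h4 : exp (-(𝒟.h / 2)) ≤ exp (-𝒟.f (α k) (γ k (s k + (𝒟.h + 15) / 2))) :=
      exp_le_exp.2 (neg_le_neg (hp.le _ hm))
    have h5 := mul_le_mul h4 h3 (exp_pos _).le (exp_pos _).le
    rw [← exp_add] at h5
    have h6 := add_one_le_exp (-(𝒟.h / 2) + (𝒟.h + 15) / 2)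
    linarith
  have hexit' : ∀ k, 𝒟.f (α k) (g (s k + 𝒟.h + 15)) < 0 := by
    intro k
    have h1 := (𝒟.height (α k)).lip (g (s k + 𝒟.h + 15)) (γ k (s k + 𝒟.h + 15))
    linarith [hclose k _ (hmem k) le_rfl, hek k, hexit k]
  have hdeep : ∀ k : ℕ, ∃ t ∈ 𝒟.P.dom, t ≤ s k + 𝒟.h + 15 ∧
      𝒟.h / 2 - exp (-k) ≤ 𝒟.f (α k) (g t) := by
    intro k
    have hp := hγ.prescribed k
    obtain ⟨t, ht, hgt⟩ := hp.exists_gt (exp (-k) / 2) (by linarith [hek0 k])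
    have htle : t ≤ s k + 𝒟.h + 15 := by
      by_contra hlt
      push Not at hlt
      have := (𝒟.height (α k)).le_of_lt hp.geod.isometric hp.mem (hmem k) ht (by linarith) hlt.le
        (by rw [hp.eq_zero]; linarith [hexit k])
      linarith [hexit k, hek k]
    refine ⟨t, ht, htle, ?_⟩
    have h1 := (𝒟.height (α k)).lip (γ k t) (g t)
    rw [dist_comm] at h1
    linarith [hclose k t ht htle, hek0 k]
  have hafter : ∀ k, ∀ t ∈ 𝒟.P.dom, s k + 𝒟.h + 15 ≤ t → 𝒟.f (α k) (g t) < 0 := by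
    intro k t ht hkt
    obtain ⟨t₁, ht₁, hle, hge⟩ := hdeep k
    have := (𝒟.height (α k)).le_of_lt hg.isometric ht₁ (hmem k) ht hle hkt
      (by linarith [hexit' k, hek k])
    linarith [hexit' k]
  have hupper : ∀ k : ℕ, ∀ t ∈ 𝒟.P.dom, 𝒟.f (α k) (g t) ≤ 𝒟.h / 2 + exp (-k) := by
    intro k t ht
    rcases le_total t (s k + 𝒟.h + 15) with h | h
    · have h1 := (𝒟.height (α k)).lip (g t) (γ k t)
      linarith [hclose k t ht h, (hγ.prescribed k).le t ht, hek0 k]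
    · linarith [hafter k t ht h, hek0 k]
  refine ⟨hg, hγ.tendsto, fun k => ?_, fun k => ?_, fun K β τ hτ hKτ hτ0 hbefore t ht => ?_⟩
  · obtain ⟨t, ht, -, h⟩ := hdeep k
    exact ⟨t, ht, h⟩
  · have hp := hγ.prescribed k
    obtain ⟨t, ht, -, h⟩ := hdeep k
    obtain ⟨t₀, ht₀, ht₀t, hneg⟩ := 𝒟.out (α k) hp.mem_S g t ht (hg t)
    obtain ⟨τ, hτ, -, -, hτ0, hbefore⟩ := (𝒟.height (α k)).exists_entry 𝒟.P.upward
      (hg t).isometric ht₀ ht₀t hneg (by linarith [hek k])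
    have := abs_le.1 (Pencil.entry_close 𝒟.geodesic (𝒟.height (α k)) (hg τ) (hp.geod (s k)) hτ hp.mem
      hτ0 hp.eq_zero (fun t ht h => (hbefore t ht h).le) (fun t ht h => (hp.before t ht h).le)).2
    exact ⟨τ, hτ, by linarith, hτ0, hbefore⟩
  · rcases lt_or_ge t τ with htτ | htτ
    · linarith [hbefore t ht htτ, hek0 K]
    by_cases hβ : ∃ j, β = α j
    · obtain ⟨j, rfl⟩ := hβ
      -- For `j < K` the geodesic has left `α j` before `s K`, so it cannot be there at time `τ`.
      rcases lt_or_ge j K with hjK | hjK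
      · have h1 := hγ.mono (Nat.succ_le_of_lt hjK)
        have h2 := hγ.le_succ j
        have h3 : (0 : ℝ) ≤ j := j.cast_nonneg
        have := hafter j τ hτ (by rw [Nat.succ_eq_add_one] at h1; linarith)
        linarith
      · have : exp (-(j : ℝ)) ≤ exp (-K) := exp_le_exp.2 (neg_le_neg (Nat.cast_le.2 hjK))
        linarith [hupper j t ht]
    · push Not at hβ
      have hex : ∃ n, t < s n := (hγ.tendsto.eventually_gt_atTop t).exists
      obtain ⟨n, hn, hmin⟩ : ∃ n, t < s n ∧ ∀ m < n, ¬t < s m := by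
        classical
        exact ⟨Nat.find hex, Nat.find_spec hex, fun m => Nat.find_min hex⟩
      have hKn : K < n := by
        by_contra hle
        have := hγ.mono (not_lt.1 hle)
        linarith
      obtain ⟨k, rfl⟩ := Nat.exists_eq_succ_of_ne_zero (Nat.ne_zero_of_lt hKn)
      have hkt : s k ≤ t := not_lt.1 (hmin k (Nat.lt_succ_self k))
      have h1 := hγ.control k β (hβ k) (hβ _) t ht hkt
      have h2 := (𝒟.height β).lip (g t) (γ (k + 1) t)
      have h3 := hclose (k + 1) t ht (by rw [Nat.succ_eq_add_one] at hn; linarith)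
      have h4 : exp (-((k + 1 : ℕ) : ℝ)) ≤ exp (-K) := exp_le_exp.2 (neg_le_neg
        (Nat.cast_le.2 hKn.le))
      linarith [hek0 (k + 1)]

end IsApproximation

theorem exists_isLimit [ProperSpace X] (hS : 𝒟.S.Nonempty) : ∃ g s α, 𝒟.IsLimit g s α := by
  obtain ⟨γ, s, α, h⟩ := exists_isApproximation hS
  obtain ⟨g, hg, hclose⟩ := h.exists_limit
  exact ⟨g, s, α, h.isLimit hg hclose⟩

end PenetrationData

/-! ### Horoballs, penetration heights and entrance times as heights along geodesics. -/

namespace Horoball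

/-- The signed height with respect to a horoball, which is nonnegative exactly on the horoball. -/
noncomputable def signedHeight (H : Horoball X) (y : X) : ℝ := busemann H.center H.base y - H.level

theorem mem_carrier {H : Horoball X} {y : X} : y ∈ H.carrier ↔ 0 ≤ H.signedHeight y := by
  rw [signedHeight, sub_nonneg]; rfl

theorem signedHeight_eq (H : Horoball X) (y : X) : H.signedHeight y =
    -(Quotient.out H.center : Ray X).bus y +
      ((Quotient.out H.center : Ray X).bus H.base - H.level) := by
  rw [signedHeight, busemann_eq]; ring

theorem isHeight (hX : IsGeodesicCATNegOne X) (H : Horoball X) : IsHeight H.signedHeight := by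
  have := (Ray.isHeight_neg_bus hX (Quotient.out H.center : Ray X)).add_const
    ((Quotient.out H.center : Ray X).bus H.base - H.level)
  rwa [← funext H.signedHeight_eq] at this

theorem height_eq (H : Horoball X) (y : X) : H.height y = max (H.signedHeight y) 0 := rfl

theorem signedHeight_le_zero_or (hX : IsGeodesicCATNegOne X) {H H' : Horoball X}
    (hdisj : Disjoint (interior H.carrier) (interior H'.carrier)) {y : X}
    (hy : 0 < H.signedHeight y) : H'.signedHeight y ≤ 0 := by
  by_contra hcon
  have key : ∀ G : Horoball X, 0 < G.signedHeight y → y ∈ interior G.carrier := fun G hG =>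
    interior_maximal (fun z (hz : 0 < G.signedHeight z) => mem_carrier.2 hz.le)
      (isOpen_lt continuous_const (G.isHeight hX).continuous) hG
  exact disjoint_left.1 hdisj (key H hy) (key H' (not_le.1 hcon))

theorem isPacking [CompleteSpace X] (hX : IsGeodesicCATNegOne X) {A : Type*} {H : A → Horoball X}
    (hdisj : Pairwise fun α β => Disjoint (interior (H α).carrier) (interior (H β).carrier)) :
    IsPacking fun α => (H α).signedHeight where
  height α := (H α).isHeight hX
  disjoint α β hαβ y hy := signedHeight_le_zero_or hX (hdisj hαβ) hy
  deep α x := by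
    obtain ⟨σ, h0, hσ⟩ := exists_ray hX x (Quotient.out (H α).center : Ray X)
    refine ⟨σ.ext 1, ?_, ?_⟩
    · have := σ.ext_isometric 0 self_mem_Ici 1 (mem_Ici.2 zero_le_one)
      rw [σ.ext_zero, h0] at this
      rw [this]; norm_num
    · have := Ray.bus_of_equiv hX hσ zero_le_one
      rw [h0] at this
      rw [signedHeight_eq, signedHeight_eq, this]
      linarith

/-- A ray along which the height is bounded below ends at the center of the horoball. -/
theorem endpoint_eq_center (hX : IsGeodesicCATNegOne X) {H : Horoball X} {σ : Ray X} {C : ℝ}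
    (hC : ∀ t ≥ 0, C ≤ H.signedHeight (σ.ext t)) : σ.endpoint = H.center := by
  have h1 : σ ≈ (Quotient.out H.center : Ray X) := by
    refine Ray.equiv_of_bus hX fun t ht => ?_
    have := (H.isHeight hX).unit_speed σ.ext_isometric hC ht
    rw [signedHeight_eq, signedHeight_eq, σ.ext_zero] at this
    linarith
  exact (Quotient.sound h1).trans (Quotient.out_eq _)

theorem tendsto_atBot (hX : IsGeodesicCATNegOne X) {H : Horoball X} {σ : Ray X}
    (hσ : σ.endpoint ≠ H.center) : Tendsto (fun t => H.signedHeight (σ.ext t)) atTop atBot := by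
  refine (H.isHeight hX).tendsto_atBot_of_forall_exists σ.ext_isometric fun L => ?_
  by_contra hcon
  push Not at hcon
  exact hσ (endpoint_eq_center hX hcon)

end Horoball

namespace RayOrLine

variable (γ : RayOrLine X)

theorem upward : ∀ s ∈ γ.dom, ∀ t, s ≤ t → t ∈ γ.dom := by
  intro s hs t hst
  rcases γ.dom_eq with h | ⟨a, h⟩
  · rw [h]; trivial
  · rw [h] at hs ⊢
    exact le_trans (mem_Ici.1 hs) hst

variable {γ}

theorem penetrationHeight_le_iff {H : Horoball X} {x : ℝ} (hx : 0 ≤ x) :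
    penetrationHeight H γ ≤ ENNReal.ofReal x ↔ ∀ t ∈ γ.dom, 2 * H.signedHeight (γ t) ≤ x := by
  have h2 : (2 : ℝ≥0∞) ≠ 0 := two_ne_zero
  have h2' : (2 : ℝ≥0∞) ≠ ⊤ := ENNReal.ofNat_ne_top
  rw [penetrationHeight, ENNReal.mul_iSup]
  simp only [ENNReal.mul_iSup, iSup_le_iff]
  refine forall₂_congr fun t _ => ?_
  rw [show (2 : ℝ≥0∞) = ENNReal.ofReal 2 by simp, ← ENNReal.ofReal_mul two_pos.le,
    ENNReal.ofReal_le_ofReal_iff hx, Horoball.height_eq, mul_max_of_nonneg _ _ two_pos.le]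
  simp [hx]

theorem lt_penetrationHeight_iff {H : Horoball X} {x : ℝ} (hx : 0 ≤ x) :
    ENNReal.ofReal x < penetrationHeight H γ ↔ ∃ t ∈ γ.dom, x < 2 * H.signedHeight (γ t) := by
  rw [← not_le, penetrationHeight_le_iff hx]
  push Not
  rfl

theorem EntersAt.signedHeight_eq_zero (hX : IsGeodesicCATNegOne X) {H : Horoball X} {t : ℝ}
    (h : γ.EntersAt H.carrier t) : H.signedHeight (γ t) = 0 := by
  obtain ⟨ht, hmem, ⟨s, hs, hst⟩, hbefore⟩ := h
  have hneg : ∀ r ∈ γ.dom, r < t → H.signedHeight (γ r) < 0 := fun r hr hrt =>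
    not_le.1 fun h => hbefore r hr hrt (Horoball.mem_carrier.2 h)
  obtain ⟨τ, hτ, -, hτt, hτ0, -⟩ := (H.isHeight hX).exists_entry γ.upward (T := t)
    (fun a ha b hb => γ.isometric a ha.1 b hb.1) hs hst.le (hneg s hs hst)
    (Horoball.mem_carrier.1 hmem)
  rcases hτt.eq_or_lt with h | h
  · rw [← h, hτ0]
  · exact absurd (hneg τ hτ h) (by rw [hτ0]; exact lt_irrefl _)

theorem entersAt_iff (hX : IsGeodesicCATNegOne X) {H : Horoball X} {t : ℝ} :
    γ.EntersAt H.carrier t ↔ t ∈ γ.dom ∧ H.signedHeight (γ t) = 0 ∧ (∃ s ∈ γ.dom, s < t) ∧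
      ∀ s ∈ γ.dom, s < t → H.signedHeight (γ s) < 0 := by
  constructor
  · intro h
    exact ⟨h.1, h.signedHeight_eq_zero hX, h.2.2.1, fun s hs hst =>
      not_le.1 fun h' => h.2.2.2 s hs hst (Horoball.mem_carrier.2 h')⟩
  · rintro ⟨h1, h2, h3, h4⟩
    exact ⟨h1, Horoball.mem_carrier.2 h2.ge, h3, fun s hs hst h =>
      absurd (Horoball.mem_carrier.1 h) (not_le.2 (h4 s hs hst))⟩

end RayOrLine

/-! ### The pencil attached to `ξ` and the horoballs containing `ξ`. -/

/-- The pencil `P` consists of the geodesics starting from `ξ`. -/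
structure Pencil.IsPencilOf (P : Pencil X) (ξ : X ⊕ Boundary X) : Prop where
  exists_shift : ∀ γ : RayOrLine X, γ.StartsFrom ξ →
    ∃ τ, (∀ t, t ∈ P.dom ↔ t - τ ∈ γ.dom) ∧ P.IsGeod fun t => γ (t - τ)
  exists_rayOrLine : ∀ g, P.IsGeod g →
    ∃ γ : RayOrLine X, γ.StartsFrom ξ ∧ γ.dom = P.dom ∧ γ.toFun = g
  blocked : ∀ H : Horoball X, ξ ∈ H.withCenter → ∀ g, P.IsGeod g →
    ∃ t ∈ P.dom, t ≤ 0 ∧ 0 ≤ H.signedHeight (g t)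
  out : ∀ H : Horoball X, ξ ∉ H.withCenter → ∀ g, ∀ T ∈ P.dom, IsArc P.dom P.time g T →
    ∃ t ∈ P.dom, t ≤ T ∧ H.signedHeight (g t) < 0

theorem isPencilOf_pointPencil (hX : IsGeodesicCATNegOne X) (x : X) :
    (pointPencil hX x).IsPencilOf (Sum.inl x) where
  exists_shift := by
    rintro γ ⟨a, ha, hγa⟩
    have hmem : ∀ t : ℝ, t ∈ Ici (0 : ℝ) ↔ t - -a ∈ γ.dom := fun t => by
      rw [ha, mem_Ici, mem_Ici, sub_neg_eq_add, le_add_iff_nonneg_left]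
    refine ⟨-a, hmem, fun T => ⟨fun s hs t ht => ?_, fun t ht => ?_⟩⟩
    · rw [γ.isometric _ ((hmem s).1 hs.1) _ ((hmem t).1 ht.1)]
      congr 1
      ring
    · have ht0 : (0 : ℝ) ≤ t := ht.1
      change dist x (γ (t - -a)) = t
      rw [← hγa, γ.isometric a (by rw [ha]; exact self_mem_Ici) _ ((hmem t).1 ht.1),
        abs_of_nonpos (by linarith)]
      ring
  exists_rayOrLine g hg := by
    refine ⟨⟨Ici 0, g, Or.inr ⟨0, rfl⟩, hg.isometric⟩, ⟨0, rfl, ?_⟩, rfl, rfl⟩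
    exact (dist_eq_zero.1 (hg.time_eq (t := 0) (pointPencil hX x).zero_mem)).symm
  blocked H hH g hg := by
    have hx : x ∈ H.carrier := by simpa [Horoball.withCenter] using hH
    have h0 : x = g 0 := dist_eq_zero.1 (hg.time_eq (t := 0) (pointPencil hX x).zero_mem)
    exact ⟨0, (pointPencil hX x).zero_mem, le_rfl, by rw [← h0]; exact Horoball.mem_carrier.1 hx⟩
  out H hH g T hT hg := by
    have hx : x ∉ H.carrier := by simpa [Horoball.withCenter] using hH
    have hT0 : (0 : ℝ) ≤ T := hT
    have h0 : x = g 0 := dist_eq_zero.1 (hg.calibrated 0 ⟨self_mem_Ici, hT0⟩)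
    refine ⟨0, (pointPencil hX x).zero_mem, hT0, ?_⟩
    rw [← h0]
    exact not_le.1 fun h => hx (Horoball.mem_carrier.2 h)

theorem backRay_equiv (hX : IsGeodesicCATNegOne X) {ρ : Ray X} {g : ℝ → X} {T : ℝ}
    (hg : IsArc univ ρ.bus g T) : backRay hg ≈ ρ :=
  Ray.equiv_of_bus hX fun _ ht => backRay_bus hg ht

theorem isPencilOf_boundaryPencil [CompleteSpace X] (hX : IsGeodesicCATNegOne X)
    (η : Boundary X) :
    (boundaryPencil hX (Quotient.out η : Ray X)).IsPencilOf (Sum.inr η) where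
  exists_shift := by
    rintro γ ⟨hdom, σ, hσ, hση⟩
    set ρ : Ray X := Quotient.out η
    have hσρ : σ ≈ ρ := Quotient.exact (hση.trans (Quotient.out_eq η).symm)
    have hmem : ∀ t, t ∈ γ.dom := fun t => by rw [hdom]; trivial
    have hbus : ∀ T t, 0 ≤ T → t ≤ T → ρ.bus (γ t) = ρ.bus (γ T) - (T - t) := by
      intro T t hT htT
      let τ : Ray X := Ray.ofIsometric (fun r => γ (T - r)) 0 fun r _ s _ => by
        rw [γ.isometric _ (hmem _) _ (hmem _), abs_sub_comm]
        congr 1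
        ring
      have hτ : τ ≈ σ := ⟨T, fun r => by
        rw [hσ, Ray.ofIsometric_apply, γ.isometric _ (hmem _) _ (hmem _),
          show T - (0 + (r : ℝ)) - -(r : ℝ) = T by ring, abs_of_nonneg hT]⟩
      have := Ray.bus_of_equiv hX (Setoid.trans hτ hσρ) (sub_nonneg.2 htT)
      rw [Ray.ext, Ray.ofIsometric_apply, Ray.ofIsometric_apply,
        Real.coe_toNNReal _ (sub_nonneg.2 htT)] at this
      simpa using this
    have hbus' : ∀ t, ρ.bus (γ t) = ρ.bus (γ 0) + t := by
      intro t
      have h1 := hbus (max t 0) t (le_max_right _ _) (le_max_left _ _)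
      have h2 := hbus (max t 0) 0 (le_max_right _ _) (le_max_right _ _)
      linarith
    refine ⟨ρ.bus (γ 0), fun t => ⟨fun _ => hmem _, fun _ => mem_univ _⟩,
      fun T => ⟨fun s _ t _ => ?_, fun t _ => ?_⟩⟩
    · rw [γ.isometric _ (hmem _) _ (hmem _)]
      congr 1
      ring
    · change ρ.bus (γ (t - ρ.bus (γ 0))) = t
      rw [hbus']
      ring
  exists_rayOrLine g hg := by
    have h0 : IsArc univ (Quotient.out η : Ray X).bus g 0 := hg 0
    refine ⟨⟨univ, g, Or.inl rfl, hg.isometric⟩, ⟨rfl, backRay h0, fun t => ?_, ?_⟩, rfl, rfl⟩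
    · simp [backRay]
    · exact (Quotient.sound (backRay_equiv hX h0)).trans (Quotient.out_eq η)
  blocked H hH g hg := by
    have hc : η = H.center := by simpa [Horoball.withCenter] using hH
    subst hc
    -- At time `t` the signed height is `c - t`, so any `t ≤ c` lies in the horoball.
    set c := (Quotient.out H.center : Ray X).bus H.base - H.level
    refine ⟨min 0 c, mem_univ _, min_le_left _ _, ?_⟩
    have := hg.time_eq (t := min 0 c) (mem_univ _)
    change (Quotient.out H.center : Ray X).bus (g (min 0 c)) = min 0 c at this
    rw [Horoball.signedHeight_eq, this]
    linarith [min_le_right 0 c]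
  out H hH g T _ hg := by
    have hc : η ≠ H.center := by simpa [Horoball.withCenter] using hH
    by_contra hcon
    push Not at hcon
    have hg' : IsArc univ (Quotient.out η : Ray X).bus g T := hg
    refine hc ?_
    rw [← Horoball.endpoint_eq_center hX (H := H) (σ := backRay hg') (C := 0) fun t ht => ?_]
    · exact ((Quotient.sound (backRay_equiv hX hg')).trans (Quotient.out_eq η)).symm
    · rw [backRay_ext hg' ht]
      exact hcon _ (mem_univ _) (by linarith)

theorem exists_isPencilOf [CompleteSpace X] (hX : IsGeodesicCATNegOne X) (ξ : X ⊕ Boundary X) :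
    ∃ P : Pencil X, P.IsPencilOf ξ := by
  rcases ξ with x | η
  · exact ⟨_, isPencilOf_pointPencil hX x⟩
  · exact ⟨_, isPencilOf_boundaryPencil hX η⟩

/-- For a point of `X` this is local finiteness. At infinity at most one horoball occurs: the
heights of two with the same center would both become positive along a ray towards it. -/
theorem finite_withCenter [ProperSpace X] (hX : IsGeodesicCATNegOne X) {A : Type*}
    {H : A → Horoball X}
    (hdisj : Pairwise fun α β => Disjoint (interior (H α).carrier) (interior (H β).carrier))
    (ξ : X ⊕ Boundary X) : {α | ξ ∈ (H α).withCenter}.Finite := by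
  rcases ξ with x | η
  · refine ((Horoball.isPacking hX hdisj).finite_meet x 0).subset fun α hα => ?_
    have hx : x ∈ (H α).carrier := by simpa [Horoball.withCenter] using hα
    exact ⟨x, (dist_self x).le, Horoball.mem_carrier.1 hx⟩
  · refine Set.Subsingleton.finite fun α hα β hβ => ?_
    have hα' : η = (H α).center := by simpa [Horoball.withCenter] using hα
    have hβ' : η = (H β).center := by simpa [Horoball.withCenter] using hβ
    by_contra hne
    set ρ : Ray X := Quotient.out η
    have key : ∀ δ, η = (H δ).center → ∀ t ≥ 0, (H δ).signedHeight (ρ.ext t) =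
        t + (ρ.bus (H δ).base - (H δ).level) := fun δ hδ t ht => by
      rw [Horoball.signedHeight_eq, ← hδ, ρ.bus_apply ht]; ring
    set a := ρ.bus (H α).base - (H α).level
    set b := ρ.bus (H β).base - (H β).level
    have ht : 0 ≤ |a| + |b| + 1 := by positivity
    have h1 := key α hα' _ ht
    have h2 := key β hβ' _ ht
    have h3 := (Horoball.isPacking hX hdisj).disjoint α β hne (ρ.ext (|a| + |b| + 1)) (by
      rw [h1]; linarith [neg_abs_le a, abs_nonneg b])
    linarith [neg_abs_le b, abs_nonneg a]

theorem exists_near_carrier {A : Type*} {H : A → Horoball X} {K : ℝ≥0} {ρ : Ray X}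
    (hK : liminf (fun t : ℝ≥0 => Metric.infEDist (ρ t) (⋃ α, (H α).carrier)) atTop ≤ (K : ℝ≥0∞))
    (R : ℝ) : ∃ t ≥ R, 0 ≤ t ∧ ∃ α x, 0 ≤ (H α).signedHeight x ∧ dist (ρ.ext t) x < K + 1 := by
  have hlt : liminf (fun t : ℝ≥0 => Metric.infEDist (ρ t) (⋃ α, (H α).carrier)) atTop <
      ENNReal.ofReal (K + 1) := by
    refine hK.trans_lt ?_
    rw [← ENNReal.ofReal_coe_nnreal]
    exact (ENNReal.ofReal_lt_ofReal_iff (by positivity)).2 (by linarith)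
  obtain ⟨t, ht, hdist⟩ := frequently_atTop.1 (frequently_lt_of_liminf_lt (by isBoundedDefault) hlt)
    R.toNNReal
  obtain ⟨x, hx, hd⟩ := Metric.infEDist_lt_iff.1 hdist
  obtain ⟨α, hα⟩ := mem_iUnion.1 hx
  refine ⟨t, Real.toNNReal_le_iff_le_coe.1 ht, t.2, α, x, Horoball.mem_carrier.1 hα, ?_⟩
  rw [ρ.ext_coe]
  rw [edist_dist] at hd
  exact (ENNReal.ofReal_lt_ofReal_iff (by positivity)).1 hd

/-- Otherwise the family is finite. A ray not ending at one of the centers drifts away from all its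
members, so `Y` lies in the finite, hence closed, set of centers, and density makes the boundary
finite. -/
theorem exists_not_mem_withCenter [ProperSpace X] (hX : IsGeodesicCATNegOne X)
    (hinf : Infinite (Boundary X)) {A : Type*} {H : A → Horoball X}
    (hdisj : Pairwise fun α β => Disjoint (interior (H α).carrier) (interior (H β).carrier))
    {K : ℝ≥0} {Y : Set (Boundary X)} (hY : Dense Y)
    (hK : ∀ ρ : Ray X, ρ.endpoint ∈ Y →
      liminf (fun t : ℝ≥0 => Metric.infEDist (ρ t) (⋃ α, (H α).carrier)) atTop ≤ (K : ℝ≥0∞))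
    (ξ : X ⊕ Boundary X) : ∃ α, ξ ∉ (H α).withCenter := by
  by_contra hcon
  push Not at hcon
  have hfin : (univ : Set A).Finite :=
    (finite_withCenter hX hdisj ξ).subset fun α _ => hcon α
  have hfin' : (range fun α => (H α).center).Finite := by
    rw [← image_univ]; exact hfin.image _
  have hclosed : IsClosed (range fun α => (H α).center) := by
    rw [← biUnion_of_singleton (range fun α => (H α).center)]
    exact hfin'.isClosed_biUnion fun η _ => Boundary.isClosed_singleton hX η
  have hsub : Y ⊆ range fun α => (H α).center := by
    intro y hy
    by_contra hne
    have hend : (Quotient.out y : Ray X).endpoint = y := Quotient.out_eq y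
    have hev : ∀ᶠ t in atTop, ∀ α ∈ (univ : Set A),
        (H α).signedHeight ((Quotient.out y : Ray X).ext t) < -(K + 1) :=
      (eventually_all_finite hfin).2 fun α _ => (Horoball.tendsto_atBot hX (by
        rw [hend]; rintro rfl; exact hne ⟨α, rfl⟩)).eventually (eventually_lt_atBot _)
    obtain ⟨R, hR⟩ := hev.exists_forall_of_atTop
    obtain ⟨t, ht, -, α, x, hx, hd⟩ := exists_near_carrier (hK (Quotient.out y) (by rwa [hend])) R
    have h1 := hR t ht α trivial
    have h2 := ((H α).isHeight hX).lip x ((Quotient.out y : Ray X).ext t)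
    rw [dist_comm] at h2
    linarith
  have huniv : (univ : Set (Boundary X)) ⊆ range fun α => (H α).center := by
    rw [← hY.closure_eq]
    exact closure_minimal hsub hclosed
  exact infinite_univ (hfin'.subset huniv)

/-! ### Numerical bounds and enumeration of the deep entries. -/

theorem log_one_add_sqrt_two_bounds : 0.88 ≤ log (1 + √2) ∧ log (1 + √2) ≤ 1.42 := by
  have h1 : 1.414 ≤ √2 := le_sqrt_of_sq_le (by norm_num)
  have h2 : √2 ≤ 1.42 := sqrt_le_iff.2 ⟨by norm_num, by norm_num⟩
  constructor
  · rw [le_log_iff_exp_le (by linarith)]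
    refine le_trans ?_ (show (2.414 : ℝ) ≤ 1 + √2 by linarith)
    refine le_of_pow_le_pow_left₀ (n := 25) (by norm_num) (by norm_num) ?_
    have : exp 0.88 ^ 25 = exp 1 ^ 22 := by rw [← exp_nat_mul, ← exp_nat_mul]; norm_num
    rw [this]
    calc exp 1 ^ 22 ≤ 2.7183 ^ 22 :=
          pow_le_pow_left₀ (exp_pos _).le (by linarith [exp_one_lt_d9]) _
      _ ≤ 2.414 ^ 25 := by norm_num
  · have := log_le_sub_one_of_pos (show 0 < 1 + √2 by linarith)
    linarith

/-- An unbounded set of nonnegative real numbers which is finite below every bound is the range of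
an increasing sequence. -/
theorem exists_strictMono_range_eq {Θ : Set ℝ} (h0 : ∀ t ∈ Θ, 0 ≤ t)
    (hfin : ∀ T, (Θ ∩ Iic T).Finite) (hunb : ∀ T, ∃ t ∈ Θ, T < t) :
    ∃ u : ℕ → ℝ, StrictMono u ∧ range u = Θ := by
  have hnext : ∀ x, ∃ y ∈ Θ, x < y ∧ ∀ z ∈ Θ, x < z → y ≤ z := by
    intro x
    obtain ⟨t, ht, hxt⟩ := hunb x
    obtain ⟨y, hy, hmin⟩ := Set.exists_min_image (Θ ∩ Iic t ∩ Ioi x) id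
      ((hfin t).inter_of_left _) ⟨t, ⟨ht, self_mem_Iic⟩, hxt⟩
    refine ⟨y, hy.1.1, hy.2, fun z hz hxz => ?_⟩
    rcases le_total z t with h | h
    · exact hmin z ⟨⟨hz, h⟩, hxz⟩
    · exact le_trans hy.1.2 h
  choose N hN1 hN2 hN3 using hnext
  let u : ℕ → ℝ := fun n => Nat.rec (N (-1)) (fun _ x => N x) n
  have hu : StrictMono u := strictMono_nat_of_lt_succ fun n => hN2 (u n)
  have hmem : ∀ n, u n ∈ Θ := fun n => by
    cases n with
    | zero => exact hN1 _
    | succ n => exact hN1 _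
  refine ⟨u, hu, Subset.antisymm (by rintro _ ⟨n, rfl⟩; exact hmem n) fun θ hθ => ?_⟩
  by_contra hne
  have hlt : ∀ n, u n < θ := by
    intro n
    refine lt_of_le_of_ne ?_ fun h => hne ⟨n, h⟩
    induction n with
    | zero => exact hN3 _ θ hθ (by linarith [h0 θ hθ])
    | succ n ih => exact hN3 _ θ hθ (lt_of_le_of_ne ih fun h => hne ⟨n, h⟩)
  exact infinite_of_injective_forall_mem hu.injective
    (fun n => (⟨hmem n, (hlt n).le⟩ : u n ∈ Θ ∩ Iic θ)) (hfin θ)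

section DeepEntries

variable {A : Type*} {H : A → Horoball X} {γ : RayOrLine X}

theorem c₁Inf_nonneg : 0 ≤ c₁Inf :=
  mul_nonneg two_pos.le (by linarith [log_one_add_sqrt_two_bounds.1])

theorem IsDeepEntry.exists_pos (hX : IsGeodesicCATNegOne X) {t : ℝ} {α : A}
    (h : IsDeepEntry H γ t α) : ∃ r ∈ γ.dom, t < r ∧ 0 < (H α).signedHeight (γ r) := by
  obtain ⟨r, hr, hlt⟩ := (RayOrLine.lt_penetrationHeight_iff c₁Inf_nonneg).1 h.2.2
  obtain ⟨-, h0, -, hbefore⟩ := (RayOrLine.entersAt_iff hX).1 h.2.1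
  have hpos : 0 < (H α).signedHeight (γ r) := by linarith [c₁Inf_nonneg]
  refine ⟨r, hr, ?_, hpos⟩
  by_contra hle
  rcases (not_lt.1 hle).eq_or_lt with h' | h'
  · rw [h', h0] at hpos; exact lt_irrefl _ hpos
  · exact lt_asymm hpos (hbefore r hr h')

/-- Two horoballs entered deeply at the same time would both have positive height just afterwards.
-/
theorem IsDeepEntry.unique (hX : IsGeodesicCATNegOne X)
    (hpack : IsPacking fun α => (H α).signedHeight) {t : ℝ} {α β : A}
    (hα : IsDeepEntry H γ t α) (hβ : IsDeepEntry H γ t β) : α = β := by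
  by_contra hne
  obtain ⟨r, hr, htr, hpos⟩ := hα.exists_pos hX
  obtain ⟨r', hr', htr', hpos'⟩ := hβ.exists_pos hX
  have htmem := hα.2.1.1
  have hm : t < min r r' := lt_min htr htr'
  have hmmem := γ.upward t htmem _ hm.le
  have hneq : γ t ≠ γ (min r r') := fun h => by
    have := γ.isometric t htmem _ hmmem
    rw [h, dist_self, eq_comm, abs_eq_zero] at this
    linarith
  have key : ∀ (δ : A) (q : ℝ), q ∈ γ.dom → min r r' ≤ q → IsDeepEntry H γ t δ →
      0 < (H δ).signedHeight (γ q) → 0 < (H δ).signedHeight (γ (min r r')) :=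
    fun δ q hq hle hδ hpos => ((H δ).isHeight hX).pos_of_onSegment
      (onSegment_of_isometric γ.isometric htmem hmmem hq hm.le hle)
      (hδ.2.1.signedHeight_eq_zero hX).ge hpos hneq
  have h1 := key α r hr (min_le_left _ _) hα hpos
  have h2 := key β r' hr' (min_le_right _ _) hβ hpos'
  exact absurd (hpack.disjoint α β hne _ h1) (not_le.2 h2)

theorem IsDeepEntry.time_unique {t t' : ℝ} {α : A} (h : IsDeepEntry H γ t α)
    (h' : IsDeepEntry H γ t' α) : t = t' := by
  rcases lt_trichotomy t t' with hlt | rfl | hlt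
  · exact absurd h.2.1.2.1 (h'.2.1.2.2.2 t h.2.1.1 hlt)
  · rfl
  · exact absurd h'.2.1.2.1 (h.2.1.2.2.2 t' h'.2.1.1 hlt)

theorem finite_deepEntry_times [ProperSpace X] (hX : IsGeodesicCATNegOne X)
    (hpack : IsPacking fun α => (H α).signedHeight) (h0 : (0 : ℝ) ∈ γ.dom) (T : ℝ) :
    ({t | ∃ α, IsDeepEntry H γ t α} ∩ Iic T).Finite := by
  have h1 : ∀ t ∈ {t | ∃ α, IsDeepEntry H γ t α} ∩ Iic T, ∃ α, IsDeepEntry H γ t α :=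
    fun t ht => ht.1
  rcases isEmpty_or_nonempty A with hA | hA
  · refine (finite_empty (α := ℝ)).subset fun t ht => ?_
    obtain ⟨α, -⟩ := ht.1
    exact hA.elim α
  choose! α hα using h1
  refine Set.Finite.of_injOn (f := α) (fun t ht => ?_) (fun t ht t' ht' h => ?_)
    (hpack.finite_meet (γ 0) T)
  · have hd := hα t ht
    refine ⟨γ t, ?_, (hd.2.1.signedHeight_eq_zero hX).ge⟩
    rw [γ.isometric 0 h0 t hd.2.1.1, zero_sub, abs_neg, abs_of_nonneg hd.1]
    exact ht.2
  · have h2 := hα t' ht'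
    rw [← h] at h2
    exact (hα t ht).time_unique h2

/-- If the deep entries occur at arbitrarily large times, they can be enumerated. -/
theorem exists_enumeration [ProperSpace X] (hX : IsGeodesicCATNegOne X)
    (hpack : IsPacking fun α => (H α).signedHeight) (h0 : (0 : ℝ) ∈ γ.dom)
    (hunb : ∀ T, ∃ t α, T < t ∧ IsDeepEntry H γ t α) :
    ∃ (u : ℕ → ℝ) (α : ℕ → A), StrictMono u ∧ Tendsto u atTop atTop ∧
      (∀ n, IsDeepEntry H γ (u n) (α n)) ∧
      ∀ t β, IsDeepEntry H γ t β → ∃ n, u n = t ∧ α n = β := by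
  obtain ⟨u, hu, hrange⟩ := exists_strictMono_range_eq (Θ := {t | ∃ α, IsDeepEntry H γ t α})
    (fun t ⟨_, h⟩ => h.1) (finite_deepEntry_times hX hpack h0)
    (fun T => by
      obtain ⟨t, α, h1, h2⟩ := hunb T
      exact ⟨t, ⟨α, h2⟩, h1⟩)
  have hmem : ∀ n, ∃ α, IsDeepEntry H γ (u n) α := fun n => by
    have : u n ∈ {t | ∃ α, IsDeepEntry H γ t α} := hrange ▸ mem_range_self n
    exact this
  choose α hα using hmem
  refine ⟨u, α, hu, tendsto_atTop_atTop_of_monotone hu.monotone fun T => ?_, hα, fun t β h => ?_⟩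
  · obtain ⟨t, β, h1, h2⟩ := hunb T
    have : t ∈ range u := hrange ▸ ⟨β, h2⟩
    obtain ⟨n, rfl⟩ := this
    exact ⟨n, h1.le⟩
  · have : t ∈ range u := hrange ▸ ⟨β, h⟩
    obtain ⟨n, rfl⟩ := this
    exact ⟨n, rfl, (hα n).unique hX hpack h⟩

end DeepEntries

theorem limsup_univ_eq {a : ↥(univ : Set ℕ) → ℝ≥0∞} {h : ℝ}
    (hle : ∀ ε > 0, ∃ n : ℕ, ∀ i, n ≤ i → a ⟨i, trivial⟩ ≤ ENNReal.ofReal (h + ε))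
    (hge : ∀ ε > 0, ∀ n : ℕ, ∃ i, n ≤ i ∧ ENNReal.ofReal (h - ε) ≤ a ⟨i, trivial⟩) :
    limsup a atTop = ENNReal.ofReal h := by
  have hε : Tendsto (fun n : ℕ => 1 / ((n : ℝ) + 1)) atTop (𝓝 0) :=
    tendsto_one_div_add_atTop_nhds_zero_nat
  apply le_antisymm
  · have hlim := ENNReal.tendsto_ofReal (hε.const_add h)
    rw [add_zero] at hlim
    refine ge_of_tendsto' hlim fun k => limsup_le_of_le (by isBoundedDefault) ?_
    obtain ⟨n, hn⟩ := hle (1 / ((k : ℝ) + 1)) (by positivity)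
    exact eventually_atTop.2 ⟨⟨n, trivial⟩, fun i hi => hn i.1 hi⟩
  · have hlim := ENNReal.tendsto_ofReal (hε.const_sub h)
    rw [sub_zero] at hlim
    refine le_of_tendsto' hlim fun k => le_limsup_of_frequently_le ?_ (by isBoundedDefault)
    refine frequently_atTop.2 fun n => ?_
    obtain ⟨i, hi, h⟩ := hge (1 / ((k : ℝ) + 1)) (by positivity) n.1
    exact ⟨⟨i, trivial⟩, hi, h⟩

theorem exists_prescribed_of_rayOrLine (hX : IsGeodesicCATNegOne X) {P : Pencil X}
    {ξ : X ⊕ Boundary X} (hP : P.IsPencilOf ξ) {A : Type*} {H : A → Horoball X} {c' h : ℝ}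
    (hc' : 0 ≤ c') (hh : 0 ≤ h) {α : A} {γ : RayOrLine X} (hγ : γ.StartsFrom ξ)
    (hent : γ.EntersAt (H α).carrier 0) (hph : penetrationHeight (H α) γ = ENNReal.ofReal h)
    (hafter : ∀ β, β ≠ α → (∃ t : ℝ, 0 < t ∧ γ t ∈ (H β).carrier) →
      penetrationHeight (H β) γ ≤ ENNReal.ofReal c') :
    ∃ g s, P.IsGeod g ∧ s ∈ P.dom ∧ (H α).signedHeight (g s) = 0 ∧
      (∀ t ∈ P.dom, t < s → (H α).signedHeight (g t) < 0) ∧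
      (∀ t ∈ P.dom, (H α).signedHeight (g t) ≤ h / 2) ∧
      (∀ ε > 0, ∃ t ∈ P.dom, h / 2 - ε < (H α).signedHeight (g t)) ∧
      ∀ β ≠ α, ∀ t, s < t → (H β).signedHeight (g t) ≤ c' / 2 := by
  obtain ⟨τ, hdom, hg⟩ := hP.exists_shift γ hγ
  obtain ⟨h0mem, h0, hs, hbefore⟩ := (RayOrLine.entersAt_iff hX).1 hent
  have hshift : ∀ t ∈ γ.dom, t + τ ∈ P.dom := fun t ht => by
    rw [hdom, add_sub_cancel_right]; exact ht
  refine ⟨_, τ, hg, by rw [hdom, sub_self]; exact h0mem, by rw [sub_self]; exact h0,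
    fun t ht htτ => hbefore _ ((hdom t).1 ht) (by linarith), fun t ht => ?_, fun ε hε => ?_,
    fun β hβ t ht => ?_⟩
  · have := (RayOrLine.penetrationHeight_le_iff hh).1 hph.le _ ((hdom t).1 ht)
    linarith
  · rcases le_or_gt 0 (h - 2 * ε) with hx | hx
    · obtain ⟨t, ht, hlt⟩ := (RayOrLine.lt_penetrationHeight_iff (H := H α) (γ := γ) hx).1 (by
        rw [hph]
        exact (ENNReal.ofReal_lt_ofReal_iff (by linarith)).2 (by linarith))
      refine ⟨t + τ, hshift t ht, ?_⟩
      rw [add_sub_cancel_right]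
      linarith
    -- When `h < 2 * ε` the entrance point, of height `0`, is deep enough.
    · exact ⟨0 + τ, hshift 0 h0mem, by rw [add_sub_cancel_right, h0]; linarith⟩
  · by_cases hmeet : γ (t - τ) ∈ (H β).carrier
    · have htm : t - τ ∈ γ.dom := γ.upward 0 h0mem _ (by linarith)
      have := (RayOrLine.penetrationHeight_le_iff hc').1
        (hafter β hβ ⟨t - τ, by linarith, hmeet⟩) _ htm
      linarith
    · have : (H β).signedHeight (γ (t - τ)) < 0 :=
        not_le.1 fun h => hmeet (Horoball.mem_carrier.2 h)
      linarith

theorem Pencil.IsGeod.exists_ray_near [CompleteSpace X] (hX : IsGeodesicCATNegOne X)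
    {P : Pencil X} {A : Type*} {H : A → Horoball X} {K : ℝ≥0} {Y : Set (Boundary X)}
    (hY : Dense Y)
    (hK : ∀ ρ : Ray X, ρ.endpoint ∈ Y →
      liminf (fun t : ℝ≥0 => Metric.infEDist (ρ t) (⋃ α, (H α).carrier)) atTop ≤ (K : ℝ≥0∞))
    {g : ℝ → X} (hg : P.IsGeod g) {R : ℝ} (hR : 0 ≤ R) : ∃ σ : ℝ → X,
    (∀ s ∈ Ici (0 : ℝ), ∀ t ∈ Ici (0 : ℝ), dist (σ s) (σ t) = |s - t|) ∧ σ 0 = g 0 ∧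
    dist (σ R) (g R) < 1 ∧ ∀ R', ∃ t ≥ R', ∃ α x, 0 ≤ (H α).signedHeight x ∧
      dist (σ t) x < (K : ℝ) + 1 := by
  have hmem : ∀ t ∈ Ici (0 : ℝ), t ∈ P.dom := fun t ht => P.upward 0 P.zero_mem t ht
  have hgi : ∀ s ∈ Ici (0 : ℝ), ∀ t ∈ Ici (0 : ℝ), dist (g s) (g t) = |s - t| :=
    fun s hs t ht => hg.isometric s (hmem s hs) t (hmem t ht)
  obtain ⟨σ, h0, hend, hd⟩ := NegCurv.exists_ray_near hX hY (Ray.ofIsometric g 0 hgi) hR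
  refine ⟨σ.ext, σ.ext_isometric, ?_, ?_, fun R' => ?_⟩
  · rw [σ.ext_zero, h0]; simp
  · simpa [Ray.ext, Real.coe_toNNReal R hR] using hd
  · obtain ⟨t, ht, -, α, x, hx, hdx⟩ := exists_near_carrier (hK σ hend) R'
    exact ⟨t, ht, α, x, hx, hdx⟩

end NegCurv

/-! ### Assembly: the penetration sequence of the limit geodesic. -/

theorem theorem5p13 {X A : Type*} [MetricSpace X] [ProperSpace X]
    (hX : IsGeodesicCATNegOne X) (hinf : Infinite (Boundary X))
    (H : A → Horoball X)
    (hdisj : Pairwise fun α β => Disjoint (interior (H α).carrier) (interior (H β).carrier))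
    (K : ℝ≥0) (Y : Set (Boundary X)) (hY : Dense Y)
    (hK : ∀ ρ : Ray X, ρ.endpoint ∈ Y →
      liminf (fun t : ℝ≥0 => Metric.infEDist (ρ t) (⋃ α, (H α).carrier)) atTop ≤ (K : ℝ≥0∞))
    (ξ : X ⊕ Boundary X) (c c' : ℝ) (hc : 0 ≤ c) (hc' : 0 ≤ c')
    (hpresc : ∀ h : ℝ, c ≤ h → ∀ α, ξ ∉ (H α).withCenter →
      ∃ γ : RayOrLine X, γ.StartsFrom ξ ∧ γ.EntersAt (H α).carrier 0 ∧
        penetrationHeight (H α) γ = ENNReal.ofReal h ∧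
        ∀ β, β ≠ α → (∃ t : ℝ, 0 < t ∧ γ t ∈ (H β).carrier) →
          penetrationHeight (H β) γ ≤ ENNReal.ofReal c')
    (h : ℝ) (hh : max c (c' + 3 * c₁Inf + (10 : ℝ)⁻¹ ^ 5) ≤ h) :
    ∃ γ : RayOrLine X, γ.StartsFrom ξ ∧
      ∃ (N : Set ℕ) (a : N → ℝ≥0∞), IsPenetrationSequence H γ N a ∧ N.Infinite ∧
        limsup a atTop = ENNReal.ofReal h := by
  obtain ⟨P, hP⟩ := exists_isPencilOf hX ξ
  have hpack := Horoball.isPacking hX hdisj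
  have hc₁ : 0 ≤ c₁Inf ∧ 1.76 ≤ c₁Inf ∧ c₁Inf ≤ 2.84 := by
    have := log_one_add_sqrt_two_bounds
    rw [c₁Inf]
    refine ⟨?_, ?_, ?_⟩ <;> linarith
  have hhc : c ≤ h := (le_max_left _ _).trans hh
  have hhc' : c' + 5.28 ≤ h := by
    have h1 := (le_max_right _ _).trans hh
    have h2 : (0 : ℝ) ≤ (10 : ℝ)⁻¹ ^ 5 := by positivity
    linarith
  have hh0 : 0 ≤ h := by linarith
  let 𝒟 : PenetrationData X A :=
    { P := P
      f := fun α => (H α).signedHeight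
      S := {α | ξ ∉ (H α).withCenter}
      h := h
      c' := c'
      K := K
      K_nonneg := K.2
      c'_nonneg := hc'
      h_ge := hhc'
      geodesic := hX.geodesic
      packing := hpack
      finite_compl := (finite_withCenter hX hdisj ξ).subset fun α hα => not_not.1 hα
      blocked := fun α hα g hg => hP.blocked (H α) (not_not.1 hα) g hg
      out := fun α hα g T hT hg => hP.out (H α) hα g T hT hg
      dense := fun g hg R hR => hg.exists_ray_near hX hY hK hR
      prescribe := fun α hα => by
        obtain ⟨γ, h1, h2, h3, h4⟩ := hpresc h hhc α hα
        exact exists_prescribed_of_rayOrLine hX hP hc' hh0 h1 h2 h3 h4 }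
  obtain ⟨g, s, δ, hg⟩ := PenetrationData.exists_isLimit (𝒟 := 𝒟)
    (exists_not_mem_withCenter hX hinf hdisj hY hK ξ)
  obtain ⟨γ, hγξ, hdom, hfun⟩ := hP.exists_rayOrLine g hg.geod
  have hγg : ∀ t, γ t = g t := fun t => congrFun hfun t
  have h0 : (0 : ℝ) ∈ γ.dom := by rw [hdom]; exact P.zero_mem
  have hlate : ∀ ε > 0, ∃ k : ℕ, ∀ j ≥ k, 2 * Real.exp (-(j : ℝ)) ≤ ε := fun ε hε => by
    have h1 := (Real.tendsto_exp_neg_atTop_nhds_zero.comp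
      (tendsto_natCast_atTop_atTop (R := ℝ))).const_mul 2
    rw [mul_zero] at h1
    obtain ⟨k, hk⟩ := eventually_atTop.1 (h1.eventually (gt_mem_nhds hε))
    exact ⟨k, fun j hj => (hk j hj).le⟩
  -- With `ε ≤ 2` one has `h - ε ≥ 3.28`, above the upper bound `2.84` of `c₁Inf`, so these visits
  -- are deep.
  have hheight : ∀ ε > 0, ε ≤ 2 → ∃ k : ℕ, ∀ j ≥ k,
      ENNReal.ofReal (h - ε) < penetrationHeight (H (δ j)) γ := by
    intro ε hε hε2
    obtain ⟨k, hk⟩ := hlate (ε / 2) (by linarith)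
    refine ⟨k, fun j hj => (RayOrLine.lt_penetrationHeight_iff (by linarith)).2 ?_⟩
    obtain ⟨t, ht, hge⟩ := hg.exists_ge j
    refine ⟨t, by rw [hdom]; exact ht, ?_⟩
    change h / 2 - Real.exp (-j) ≤ (H (δ j)).signedHeight (g t) at hge
    rw [hγg]
    linarith [hk j hj]
  have hentry : ∀ T : ℝ, ∀ ε > 0, ε ≤ 2 → ∃ t α, T < t ∧ IsDeepEntry H γ t α ∧
      ENNReal.ofReal (h - ε) ≤ penetrationHeight (H α) γ := by
    intro T ε hε hε2
    obtain ⟨k, hk⟩ := hheight ε hε hε2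
    -- The `3` absorbs the possible advance of the entrance time over `s j`; `max T 0` makes it
    -- positive as well.
    obtain ⟨j, hj1, hj2⟩ := ((hg.tendsto.eventually_gt_atTop (max T 0 + 3)).and
      (eventually_ge_atTop k)).exists
    obtain ⟨τ, hτ, hτs, hτ0, hbefore⟩ := hg.entry j
    have hph := hk j hj2
    have hτpos : max T 0 < τ := by linarith
    refine ⟨τ, δ j, (le_max_left _ _).trans_lt hτpos, ⟨?_, ?_, ?_⟩, hph.le⟩
    · exact ((le_max_right _ _).trans_lt hτpos).le
    · refine (RayOrLine.entersAt_iff hX).2 ⟨by rw [hdom]; exact hτ, by rw [hγg]; exact hτ0,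
        ⟨0, h0, (le_max_right _ _).trans_lt hτpos⟩, fun r hr hrτ => ?_⟩
      rw [hdom] at hr
      rw [hγg]
      exact hbefore r hr hrτ
    · exact (ENNReal.ofReal_le_ofReal (by linarith)).trans_lt hph
  obtain ⟨u, β, hu, hutop, hdeep, hall⟩ := exists_enumeration hX hpack h0 fun T => by
    obtain ⟨t, α, h1, h2, -⟩ := hentry T 1 one_pos (by norm_num)
    exact ⟨t, α, h1, h2⟩
  refine ⟨γ, hγξ, univ, fun i => penetrationHeight (H (β i)) γ,
    ⟨h0, isLowerSet_univ, fun i => u i, fun i => β i, fun i j hij => hu hij,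
      fun i => ⟨hdeep i, rfl⟩, fun t α hd => ?_⟩, infinite_univ, ?_⟩
  · obtain ⟨n, h1, h2⟩ := hall t α hd
    exact ⟨⟨n, trivial⟩, h1, h2⟩
  · refine limsup_univ_eq (fun ε hε => ?_) (fun ε hε n => ?_)
    · obtain ⟨k, hk⟩ := hlate ε hε
      obtain ⟨n, hn⟩ := eventually_atTop.1 (hutop.eventually_ge_atTop (s k))
      refine ⟨n, fun i hi => (RayOrLine.penetrationHeight_le_iff (by linarith)).2 fun t ht => ?_⟩
      obtain ⟨h1, h2, -, h4⟩ := (RayOrLine.entersAt_iff hX).1 (hdeep i).2.1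
      have := hg.le k (β i) (u i) (by rw [← hdom]; exact h1) (hn i hi)
        (by rw [← hγg]; exact h2.ge)
        (fun r hr hru => by rw [← hγg]; exact h4 r (by rw [hdom]; exact hr) hru) t
        (by rw [← hdom]; exact ht)
      change (H (β i)).signedHeight (g t) ≤ h / 2 + Real.exp (-k) at this
      rw [hγg]
      linarith [hk k le_rfl]
    · obtain ⟨t, α, h1, h2, h3⟩ := hentry (u n) (min ε 2) (lt_min hε two_pos) (min_le_right _ _)
      obtain ⟨i, rfl, rfl⟩ := hall t α h2
      exact ⟨i, (hu.lt_iff_lt.1 h1).le,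
        (ENNReal.ofReal_le_ofReal (by linarith [min_le_left ε 2])).trans h3⟩
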